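/- Work with $\mathbb Z/2$-graded vector spaces over a field $k$ of characteristic zero. Let $V$ be finite-dimensional, $\Pi V$ its parity reversion, and let $\hat S\Pi V^*=(S\Pi V)^*$ and $\hat T\Pi V^*=(T\Pi V)^*$ be the completed symmetric and tensor algebras on $\Pi V^*$. Let $\mathfrak g=\mathrm{Der}_0(\hat S\Pi V^*)$ and $\mathfrak h=\mathrm{Der}_0(\hat T\Pi V^*)$ be the graded Lie algebras of continuous derivations with vanishing constant term. If $V$ carries a graded symmetric non-degenerate (even or odd) inner product, so that $\Pi V$ carries the form $\omega(\Pi a,\Pi b)=(-1)^{|a|}\langle a,b\rangle$, let $\tilde{\mathfrak g}\subset\mathfrak g$ and $\tilde{\mathfrak h}\subset\mathfrak h$ be the graded Lie subalgebras of symplectic derivations, i.e. those $\delta$ with components $\delta_n$ for which $\omega(\delta_n(x_1,\dots,x_n),x_{n+1})$ is invariant, with Koszul signs, under cyclic permutations of $x_1,\dots,x_{n+1}\in\Pi V$. An $L_\infty$- (resp. $A_\infty$-, cyclic $L_\infty$-, cyclic $A_\infty$-) structure on $V$ is an odd element $m$ of $\mathfrak g$ (resp. $\mathfrak h,\tilde{\mathfrak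 g},\tilde{\mathfrak h}$) with $m^2=0$; its components are the maps $m_n$ from $S^n\Pi V$ (resp. $T^n\Pi V$) to $\Pi V$ that are dual to $m|_{\Pi V^*}$. In the $A_\infty$-cases $V$ is also regarded as an $L_\infty$-algebra with components $\bar m_n(x_1,\dots,x_n)=\sum_{\sigma\in S_n}m_n(\sigma(x_1\otimes\dots\otimes x_n))$. Let $\mathrm{CE}_*(V)=S\Pi V$ be the dg coalgebra whose differential is the coderivation cogenerated by the components of the $L_\infty$-structure. For a graded Lie algebra $\mathfrak a$ let $\mathrm{CE}_*(\mathfrak a)=\prod_{n\ge0}S^n(\Pi\mathfrak a)$ be its Chevalley--Eilenberg dg coalgebra, completed with respect to weight, whose differential is cogenerated by $\Pi x\cdot\Pi y\mapsto(-1)^{|\Pi x|}\Pi[x,y]$. Let $\mathfrak a$ be $\mathfrak g,\mathfrak h,\tilde{\mathfrak g},\tilde{\mathfrak h}$ and $m\in\mathfrak a$ an $L_\infty$-, $A_\infty$-, cyclic $L_\infty$-, cyclic $A_\infty$-structure on $V$ respectively. Then there is a map of dg coalgebras $\chi:\mathrm{CE}_*(V)\to\mathrm{CE}_*(\mathfrak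 a)$, which is determined uniquely, as a map of graded coalgebras, by its components $\chi_r:S^r\Pi V\to\Pi\mathfrak a$, $r\ge0$; these are given, for $w_i,x_j\in\Pi V$, $r\ge0$ and $n\ge1$, by $$\chi_r(w_1,\dots,w_r)(x_1,\dots,x_n)=m_{r+n}(w_1,\dots,w_r,x_1,\dots,x_n)$$ in the $L_\infty$-cases, and by $$\chi_r(w_1,\dots,w_r)(x_1,\dots,x_n)=\sum_{\sigma\in S_r}m_{r+n}(\sigma(w_1\otimes\dots\otimes w_r)\,|\,x_1,\dots,x_n)$$ in the $A_\infty$-cases, where $m_{r+n}(z_1,\dots,z_r|x_1,\dots,x_n)$ is the sum of the values of $m_{r+n}$ on all shuffles of $z_1,\dots,z_r$ and $x_1,\dots,x_n$, and $S_r$ and shuffles act with Koszul signs. In particular $\chi$ induces a map from the homology of $\mathrm{CE}_*(V)$ to that of $\mathrm{CE}_*(\mathfrak a)$. -/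

import Mathlib

/-!
Super vector spaces are given by their even and odd parts: the space with even part `E` and odd
part `O` is `E × O`.  For `V = V₀ ⊕ V₁` the parity reversion `ΠV` has even part `V₁` and odd part
`V₀`, so that it is `V₁ × V₀`.
-/

open scoped TensorProduct

noncomputable section

namespace SuperCE

/-! ### Signs and parity -/

/-- The sign `(-1)^i` of `i : ℤ/2`, in `k`. -/
def sgn (k : Type*) [Ring k] (i : ZMod 2) : k := if i = 0 then 1 else -1

/-- `x` is homogeneous of parity `i` for the parity involution `γ` (which is `1` on even and `-1`
on odd elements). -/
def IsHomog {k M : Type*} [Field k] [AddCommGroup M] [Module k M] (γ : M →ₗ[k] M) (i : ZMod 2)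
    (x : M) : Prop :=
  γ x = sgn k i • x

/-- The Koszul sign of the rearrangement `z_{τ 0} ⊗ z_{τ 1} ⊗ ⋯` of `z_0 ⊗ z_1 ⊗ ⋯`, where `z_i` has
parity `p i`. -/
def koszul (k : Type*) [Field k] {n : ℕ} (p : Fin n → ZMod 2) (τ : Equiv.Perm (Fin n)) : k :=
  ∏ i : Fin n, ∏ j : Fin n, if i < j ∧ τ j < τ i then sgn k (p (τ i) * p (τ j)) else 1

section Coalgebras

variable (k E O : Type*) [Field k] [AddCommGroup E] [Module k E] [AddCommGroup O] [Module k O]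

/-- The parity involution of the super vector space `E × O`. -/
def par : (E × O) →ₗ[k] (E × O) := LinearMap.prodMap LinearMap.id (-LinearMap.id)

/-- Projection to the even part, as an endomorphism. -/
def evenPart : (E × O) →ₗ[k] (E × O) := LinearMap.prodMap LinearMap.id 0

/-- Projection to the odd part, as an endomorphism. -/
def oddPart : (E × O) →ₗ[k] (E × O) := LinearMap.prodMap 0 LinearMap.id

/-! ### The tensor coalgebra `T U` -/

/-- The tensor space `T U = ⨁ U^{⊗n}` of `U = E × O`. -/
abbrev T := TensorAlgebra k (E × O)

/-- The inclusion `U → T U`. -/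
abbrev tι : (E × O) →ₗ[k] T k E O := TensorAlgebra.ι k

/-- The projection `T U → U`. -/
abbrev tProj : T k E O →ₗ[k] (E × O) := TensorAlgebra.ιInv

/-- The parity involution of `T U`. -/
def tPar : T k E O →ₐ[k] T k E O := TensorAlgebra.lift k (tι k E O ∘ₗ par k E O)

/-- The endomorphism `(t, D) ↦ (x t, 1 ⊗ x t + x D)` of `T U × (T U ⊗ T U)`. -/
def deconcStep : (E × O) →ₗ[k] Module.End k (T k E O × (T k E O ⊗[k] T k E O)) :=
  LinearMap.mk₂ k
    (fun x p => (tι k E O x * p.1,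
      (1 : T k E O) ⊗ₜ[k] (tι k E O x * p.1) + (tι k E O x ⊗ₜ[k] (1 : T k E O)) * p.2))
    (fun x y p => by
      simp [add_mul, TensorProduct.add_tmul, TensorProduct.tmul_add]; abel)
    (fun c x p => by
      simp only [map_smul, smul_mul_assoc, TensorProduct.tmul_smul, ← TensorProduct.smul_tmul',
        Prod.smul_mk, smul_add])
    (fun x p q => by
      simp [mul_add, TensorProduct.tmul_add]; abel)
    (fun c x p => by simp)

/-- The deconcatenation coproduct `Δ (x₁ ⋯ xₙ) = ∑ᵢ (x₁ ⋯ xᵢ) ⊗ (xᵢ₊₁ ⋯ xₙ)` of `T U`; see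
`deconc_one` and `deconc_ι_mul`, which determine it. -/
def deconc : T k E O →ₗ[k] T k E O ⊗[k] T k E O where
  toFun t := (TensorAlgebra.lift k (deconcStep k E O) t (1, 1 ⊗ₜ[k] 1)).2
  map_add' := by intros; simp
  map_smul' := by intros; simp

/-! ### The symmetric coalgebra `S U` -/

/-- The relations of graded commutativity: even elements commute with everything, odd elements
anticommute. -/
inductive SRel : T k E O → T k E O → Prop
  | even (a : E) (w : E × O) : SRel (tι k E O (a, 0) * tι k E O w) (tι k E O w * tι k E O (a, 0))
  | odd (b c : O) : SRel (tι k E O (0, b) * tι k E O (0, c)) (-(tι k E O (0, c) * tι k E O (0, b)))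

/-- The graded symmetric algebra `S U` of `U = E × O`. -/
def S := RingQuot (SRel k E O)

instance : Ring (S k E O) := inferInstanceAs (Ring (RingQuot (SRel k E O)))

instance : Algebra k (S k E O) := inferInstanceAs (Algebra k (RingQuot (SRel k E O)))

/-- The quotient map `T U → S U`. -/
def sMk : T k E O →ₐ[k] S k E O := RingQuot.mkAlgHom k (SRel k E O)

/-- The inclusion `U → S U`. -/
def sι : (E × O) →ₗ[k] S k E O := (sMk k E O).toLinearMap ∘ₗ tι k E O

variable {k E O}

theorem sι_even_comm (a : E) (w : E × O) :
    sι k E O (a, 0) * sι k E O w = sι k E O w * sι k E O (a, 0) := by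
  have := RingQuot.mkAlgHom_rel k (SRel.even (k := k) a w)
  rw [map_mul, map_mul] at this
  exact this

theorem sι_odd_comm (b c : O) :
    sι k E O (0, b) * sι k E O (0, c) = -(sι k E O (0, c) * sι k E O (0, b)) := by
  have := RingQuot.mkAlgHom_rel k (SRel.odd (k := k) (E := E) b c)
  rw [map_neg, map_mul, map_mul] at this
  exact this

/-- The universal property of `S U` as the free graded commutative algebra. -/
def sLift {A : Type*} [Ring A] [Algebra k A] (f : (E × O) →ₗ[k] A)
    (he : ∀ (a : E) (w : E × O), f (a, 0) * f w = f w * f (a, 0))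
    (ho : ∀ b c : O, f (0, b) * f (0, c) = -(f (0, c) * f (0, b))) : S k E O →ₐ[k] A :=
  RingQuot.liftAlgHom k ⟨TensorAlgebra.lift k f, by
    intro x y h
    cases h with
    | even a w => simp only [map_mul, TensorAlgebra.lift_ι_apply, he]
    | odd b c => simp only [map_mul, map_neg, TensorAlgebra.lift_ι_apply]; exact ho b c⟩

theorem sLift_ι {A : Type*} [Ring A] [Algebra k A] (f : (E × O) →ₗ[k] A) (he ho) (u : E × O) :
    sLift f he ho (sι k E O u) = f u := by
  have := RingQuot.liftAlgHom_mkAlgHom_apply k (TensorAlgebra.lift k f) (s := SRel k E O) (by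
    intro x y h
    cases h with
    | even a w => simp only [map_mul, TensorAlgebra.lift_ι_apply, he]
    | odd b c => simp only [map_mul, map_neg, TensorAlgebra.lift_ι_apply]; exact ho b c)
    (tι k E O u)
  rw [TensorAlgebra.lift_ι_apply] at this
  exact this

variable (k E O)

/-- The parity involution of `S U`. -/
def sPar : S k E O →ₐ[k] S k E O :=
  sLift (sι k E O ∘ₗ par k E O)
    (fun a w => by simpa [par] using sι_even_comm (k := k) a _)
    (fun b c => by simpa [par] using sι_odd_comm (k := k) (E := E) (-b) (-c))

theorem sPar_ι (u : E × O) : sPar k E O (sι k E O u) = sι k E O (par k E O u) := by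
  simp [sPar, sLift_ι]

/-- The projection `S U → U` onto the component of weight one. -/
def sProj : S k E O →ₗ[k] (E × O) := by
  letI : Module kᵐᵒᵖ (E × O) := Module.compHom _ ((RingHom.id k).fromOpposite mul_comm)
  haveI : IsCentralScalar k (E × O) := ⟨fun r m => rfl⟩
  exact (TrivSqZeroExt.sndHom k (E × O)).comp
    (sLift (TrivSqZeroExt.inrHom k (E × O)) (fun a w => by simp) (fun b c => by simp)).toLinearMap

/-- The counit `S U → k`. -/
def sCounit : S k E O →ₐ[k] k := sLift 0 (fun a w => by simp) (fun b c => by simp)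

/-- Left multiplication by `u ⊗ 1 + 1 ⊗ u` on `S U ⊗ S U` with its Koszul signed product:
`a ⊗ b ↦ u a ⊗ b + (-1)^{|u||a|} a ⊗ u b`. -/
def comulStep : (E × O) →ₗ[k] Module.End k (S k E O ⊗[k] S k E O) where
  toFun u :=
    TensorProduct.map (LinearMap.mulLeft k (sι k E O u)) LinearMap.id
      + TensorProduct.map LinearMap.id (LinearMap.mulLeft k (sι k E O (evenPart k E O u)))
      + TensorProduct.map (sPar k E O).toLinearMap
          (LinearMap.mulLeft k (sι k E O (oddPart k E O u)))
  map_add' u v := by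
    refine TensorProduct.ext' fun a b => ?_
    simp [add_mul, TensorProduct.add_tmul, TensorProduct.tmul_add]; abel
  map_smul' c u := by
    refine TensorProduct.ext' fun a b => ?_
    simp [TensorProduct.smul_tmul']

theorem comulStep_even (a : E) (x y : S k E O) :
    comulStep k E O (a, 0) (x ⊗ₜ y)
      = (sι k E O (a, 0) * x) ⊗ₜ y + x ⊗ₜ (sι k E O (a, 0) * y) := by
  simp [comulStep, evenPart, oddPart, Prod.mk_zero_zero]

theorem comulStep_odd (b : O) (x y : S k E O) :
    comulStep k E O (0, b) (x ⊗ₜ y)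
      = (sι k E O (0, b) * x) ⊗ₜ y + sPar k E O x ⊗ₜ (sι k E O (0, b) * y) := by
  simp [comulStep, evenPart, oddPart, Prod.mk_zero_zero]

theorem sPar_even (a : E) : sPar k E O (sι k E O (a, 0)) = sι k E O (a, 0) := by
  simp [sPar_ι, par]

theorem sPar_odd (b : O) : sPar k E O (sι k E O (0, b)) = -sι k E O (0, b) := by
  rw [sPar_ι, ← map_neg]; simp [par]

theorem split_eq (w : E × O) : w = (w.1, 0) + (0, w.2) := by simp

/-- The algebra map `S U → End (S U ⊗ S U)` by which `S U` acts on `S U ⊗ S U` through its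
coproduct. -/
def comulAct : S k E O →ₐ[k] Module.End k (S k E O ⊗[k] S k E O) :=
  sLift (comulStep k E O)
    (fun a w => by
      have hc : ∀ (w : E × O) (z : S k E O),
          sι k E O (a, 0) * (sι k E O w * z) = sι k E O w * (sι k E O (a, 0) * z) := fun w z => by
        rw [← mul_assoc, sι_even_comm, mul_assoc]
      refine TensorProduct.ext' fun x y => ?_
      rw [split_eq E O w]
      simp only [map_add, mul_add, add_mul, LinearMap.add_apply, Module.End.mul_apply,
        comulStep_even, comulStep_odd, map_mul, sPar_even, hc (w.1, 0), hc (0, w.2)]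
      abel)
    (fun b c => by
      have hc : ∀ z : S k E O,
          sι k E O (0, b) * (sι k E O (0, c) * z) = -(sι k E O (0, c) * (sι k E O (0, b) * z)) :=
        fun z => by rw [← mul_assoc, sι_odd_comm, neg_mul, mul_assoc]
      refine TensorProduct.ext' fun x y => ?_
      simp only [map_add, LinearMap.neg_apply, Module.End.mul_apply, comulStep_odd, map_mul,
        sPar_odd, hc, TensorProduct.neg_tmul, TensorProduct.tmul_neg, neg_mul]
      abel)

/-- The coproduct of `S U`: the algebra map, for the Koszul signed product of `S U ⊗ S U`, with
`Δ u = u ⊗ 1 + 1 ⊗ u` for `u` in `U`; see `comul_one` and `comul_ι_mul`, which determine it. -/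
def comul : S k E O →ₗ[k] S k E O ⊗[k] S k E O where
  toFun c := comulAct k E O c (1 ⊗ₜ 1)
  map_add' := by intros; simp
  map_smul' := by intros; simp

theorem comul_one : comul k E O 1 = 1 ⊗ₜ 1 := by simp [comul]

theorem comul_ι_mul (u : E × O) (c : S k E O) :
    comul k E O (sι k E O u * c) = comulStep k E O u (comul k E O c) := by
  simp [comul, comulAct, sLift_ι]

theorem deconc_one : deconc k E O 1 = 1 ⊗ₜ 1 := by simp [deconc]

theorem deconc_ι_mul (u : E × O) (t : T k E O) :
    deconc k E O (tι k E O u * t)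
      = 1 ⊗ₜ (tι k E O u * t) + (tι k E O u ⊗ₜ 1) * deconc k E O t := by
  have key : ∀ t : T k E O, (TensorAlgebra.lift k (deconcStep k E O) t (1, 1 ⊗ₜ[k] 1)).1 = t := by
    have h2 : ∀ t s : T k E O, ∀ z, (TensorAlgebra.lift k (deconcStep k E O) t (s, z)).1 = t * s := by
      intro t
      induction t using TensorAlgebra.induction with
      | algebraMap r => intro s z; simp [Module.algebraMap_end_apply, Algebra.smul_def]
      | ι x => intro s z; simp [deconcStep]
      | mul a b ha hb =>
        intro s z
        rw [map_mul, Module.End.mul_apply, mul_assoc, ← hb s z, ← ha _ _]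
      | add a b ha hb => intro s z; simp [ha, hb, add_mul]
    intro t; simp [h2]
  have step : ∀ p, deconcStep k E O u p = (tι k E O u * p.1,
      (1 : T k E O) ⊗ₜ[k] (tι k E O u * p.1) + (tι k E O u ⊗ₜ[k] (1 : T k E O)) * p.2) :=
    fun _ => rfl
  simp only [deconc, LinearMap.coe_mk, AddHom.coe_mk, map_mul, Module.End.mul_apply,
    TensorAlgebra.lift_ι_apply, step, key]

/-! ### Shuffles -/

/-- The signed insertion `u ⧢ (x₁ ⋯ xₙ) = ∑ᵢ (-1)^{|u|(|x₁| + ⋯ + |xᵢ|)} x₁ ⋯ xᵢ u xᵢ₊₁ ⋯ xₙ`. -/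
def insertion : (E × O) →ₗ[k] Module.End k (T k E O) where
  toFun u := LinearMap.mul' k (T k E O) ∘ₗ
    (TensorProduct.map LinearMap.id (LinearMap.mulLeft k (tι k E O (evenPart k E O u)))
      + TensorProduct.map (tPar k E O).toLinearMap
          (LinearMap.mulLeft k (tι k E O (oddPart k E O u)))) ∘ₗ deconc k E O
  map_add' u v := by
    have h : ∀ z : T k E O ⊗[k] T k E O, ∀ f : T k E O →ₗ[k] T k E O, ∀ a b : T k E O,
        TensorProduct.map f (LinearMap.mulLeft k (a + b)) z
          = TensorProduct.map f (LinearMap.mulLeft k a) z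
            + TensorProduct.map f (LinearMap.mulLeft k b) z := by
      intro z f a b
      rw [← LinearMap.add_apply, ← TensorProduct.map_add_right]
      congr 2
      ext; simp [add_mul]
    ext1 t
    simp only [map_add, LinearMap.comp_apply, LinearMap.add_apply, h]
    abel
  map_smul' c u := by
    have h : ∀ z : T k E O ⊗[k] T k E O, ∀ f : T k E O →ₗ[k] T k E O, ∀ a : T k E O,
        TensorProduct.map f (LinearMap.mulLeft k (c • a)) z
          = c • TensorProduct.map f (LinearMap.mulLeft k a) z := by
      intro z f a
      rw [← LinearMap.smul_apply, ← TensorProduct.map_smul_right]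
      congr 2
      ext; simp
    ext1 t
    simp only [map_add, map_smul, LinearMap.comp_apply, LinearMap.add_apply, h, RingHom.id_apply,
      LinearMap.smul_apply, smul_add]

theorem insertion_one (u : E × O) : insertion k E O u 1 = tι k E O u := by
  have h : tι k E O (u.1, 0) + tι k E O (0, u.2) = tι k E O u := by
    rw [← map_add]; simp
  simp [insertion, deconc_one, evenPart, oddPart, h]

theorem tPar_ι (u : E × O) : tPar k E O (tι k E O u) = tι k E O (par k E O u) := by
  simp [tPar]

theorem insertion_even_ι_mul (a : E) (u : E × O) (t : T k E O) :
    insertion k E O (a, 0) (tι k E O u * t)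
      = tι k E O (a, 0) * tι k E O u * t + tι k E O u * insertion k E O (a, 0) t := by
  have h : ∀ z : T k E O ⊗[k] T k E O,
      LinearMap.mul' k (T k E O) (TensorProduct.map LinearMap.id
        (LinearMap.mulLeft k (tι k E O (a, 0))) ((tι k E O u ⊗ₜ 1) * z))
      = tι k E O u * LinearMap.mul' k (T k E O) (TensorProduct.map LinearMap.id
        (LinearMap.mulLeft k (tι k E O (a, 0))) z) := by
    intro z
    induction z using TensorProduct.induction_on with
    | zero => simp
    | tmul x y => simp [mul_assoc]
    | add x y hx hy => simp only [mul_add, map_add, hx, hy]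
  simp [insertion, deconc_ι_mul, evenPart, oddPart, Prod.mk_zero_zero, h, mul_assoc]

theorem insertion_odd_ι_mul (b : O) (u : E × O) (t : T k E O) :
    insertion k E O (0, b) (tι k E O u * t)
      = tι k E O (0, b) * tι k E O u * t
        + tι k E O (par k E O u) * insertion k E O (0, b) t := by
  have h : ∀ z : T k E O ⊗[k] T k E O,
      LinearMap.mul' k (T k E O) (TensorProduct.map (tPar k E O).toLinearMap
        (LinearMap.mulLeft k (tι k E O (0, b))) ((tι k E O u ⊗ₜ 1) * z))
      = tι k E O (par k E O u) * LinearMap.mul' k (T k E O)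
        (TensorProduct.map (tPar k E O).toLinearMap
          (LinearMap.mulLeft k (tι k E O (0, b))) z) := by
    intro z
    induction z using TensorProduct.induction_on with
    | zero => simp
    | tmul x y => simp [mul_assoc, tPar_ι]
    | add x y hx hy => simp only [mul_add, map_add, hx, hy]
  simp [insertion, deconc_ι_mul, evenPart, oddPart, Prod.mk_zero_zero, h, mul_assoc]

theorem T_ext {M : Type*} [AddCommGroup M] [Module k M] {f g : T k E O →ₗ[k] M}
    (h1 : f 1 = g 1) (h : ∀ u t, f t = g t → f (tι k E O u * t) = g (tι k E O u * t)) : f = g := by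
  have key : ∀ t s : T k E O, f s = g s → f (t * s) = g (t * s) := by
    intro t
    induction t using TensorAlgebra.induction with
    | algebraMap r => intro s hs; simp [← Algebra.smul_def, hs]
    | ι x => intro s hs; exact h x s hs
    | mul a b ha hb => intro s hs; rw [mul_assoc]; exact ha _ (hb _ hs)
    | add a b ha hb => intro s hs; simp only [add_mul, map_add, ha s hs, hb s hs]
  ext1 t
  simpa using key t 1 h1

theorem insertion_even_comm (a : E) (w : E × O) :
    insertion k E O (a, 0) * insertion k E O w = insertion k E O w * insertion k E O (a, 0) := by
  rw [split_eq E O w]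
  simp only [map_add, mul_add, add_mul]
  congr 1
  · refine T_ext k E O ?_ fun u t h => ?_
    · have := insertion_even_ι_mul k E O a (w.1, 0) 1
      have := insertion_even_ι_mul k E O w.1 (a, 0) 1
      simp_all [insertion_one, add_comm]
    · simp only [Module.End.mul_apply, insertion_even_ι_mul, map_add, mul_add, mul_assoc] at h ⊢
      rw [h]; abel
  · refine T_ext k E O ?_ fun u t h => ?_
    · have := insertion_even_ι_mul k E O a (0, w.2) 1
      have := insertion_odd_ι_mul k E O w.2 (a, 0) 1
      simp_all [insertion_one, add_comm, par]
    · simp only [Module.End.mul_apply, insertion_even_ι_mul, insertion_odd_ι_mul, map_add,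
        mul_add, mul_assoc] at h ⊢
      rw [h]
      have : par k E O (a, 0) = (a, 0) := by simp [par]
      rw [this]; abel

theorem insertion_odd_comm (b c : O) :
    insertion k E O (0, b) * insertion k E O (0, c)
      = -(insertion k E O (0, c) * insertion k E O (0, b)) := by
  have hp : ∀ b, tι k E O (par k E O (0, b)) = -tι k E O (0, b) := by
    intro b; rw [← map_neg]; simp [par]
  refine T_ext k E O ?_ fun u t h => ?_
  · have h1 := insertion_odd_ι_mul k E O b (0, c) 1
    have h2 := insertion_odd_ι_mul k E O c (0, b) 1
    simp only [mul_one, insertion_one, hp] at h1 h2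
    simp only [Module.End.mul_apply, LinearMap.neg_apply, insertion_one, h1, h2, neg_mul]
    abel
  · simp only [Module.End.mul_apply, LinearMap.neg_apply, insertion_odd_ι_mul, map_add,
      mul_add, mul_assoc, hp, neg_mul] at h ⊢
    rw [h, mul_neg]; abel

/-- The action of `S U` on `T U` by signed shuffles: `w₁ ⋯ w_r` acts on `x₁ ⋯ xₙ` as the sum of all
rearrangements of `w₁, …, w_r, x₁, …, xₙ` in which `x₁, …, xₙ` occur in this order, with Koszul
signs. -/
def shuffleAct : S k E O →ₐ[k] Module.End k (T k E O) :=
  sLift (insertion k E O) (insertion_even_comm k E O) (insertion_odd_comm k E O)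

/-- The symmetrization `S U → T U`, which sends `w₁ ⋯ w_r` to the sum of all its rearrangements
with Koszul signs. -/
def symmetrize : S k E O →ₗ[k] T k E O where
  toFun c := shuffleAct k E O c 1
  map_add' := by intros; simp
  map_smul' := by intros; simp

end Coalgebras

/-! ### Formal vector fields -/

section VectorFields

variable {k C : Type*} [Field k] [Ring C] [Algebra k C]

/-- The product of the formal algebra `C^*` dual to the coalgebra `C`.  Here `f ⊗ g` is paired with
`c ⊗ d` by `g c * f d`, which involves no Koszul sign.  For `C = T U` or `C = S U` with `U` of
finite dimension, `C^*` is the completed tensor or symmetric algebra of `U^*`. -/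
def fmul (Δ : C →ₗ[k] C ⊗[k] C) (f g : Module.Dual k C) : Module.Dual k C :=
  LinearMap.mul' k k ∘ₗ TensorProduct.map g f ∘ₗ Δ

/-- `f ↦ (-1)^{i|f|} f` on the dual of a space with parity involution `γ`. -/
def twist {M : Type*} [AddCommGroup M] [Module k M] (γ : M →ₗ[k] M) (i : ZMod 2)
    (f : Module.Dual k M) : Module.Dual k M :=
  if i = 0 then f else f ∘ₗ γ

/-- `δ` is a continuous derivation of parity `i` of the formal algebra `C^*`, with vanishing
constant term. -/
structure IsVectorField (Δ : C →ₗ[k] C ⊗[k] C) (γ : C →ₗ[k] C) (i : ZMod 2)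
    (δ : Module.End k (Module.Dual k C)) : Prop where
  parity : ∀ f, δ (f ∘ₗ γ) = sgn k i • (δ f ∘ₗ γ)
  leibniz : ∀ f g, δ (fmul Δ f g) = fmul Δ (δ f) g + fmul Δ (twist γ i f) (δ g)
  /-- continuity for the topology of pointwise convergence on `C^*`, with `k` discrete -/
  continuous : ∀ c, ∃ s : Finset C, ∀ f : Module.Dual k C, (∀ x ∈ s, f x = 0) → δ f c = 0
  vanishing : ∀ f, δ f 1 = 0

/-- The space of formal vector fields of parity `i` that vanish at zero. -/
def vectorFields (Δ : C →ₗ[k] C ⊗[k] C) (γ : C →ₗ[k] C) (i : ZMod 2) :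
    Submodule k (Module.End k (Module.Dual k C)) where
  carrier := {δ | IsVectorField Δ γ i δ}
  zero_mem' := ⟨by simp, by simp [fmul], fun c => ⟨∅, by simp⟩, by simp⟩
  add_mem' := by
    classical
    intro a b ha hb
    refine ⟨fun f => ?_, fun f g => ?_, fun c => ?_, fun f => ?_⟩
    · simp [ha.parity, hb.parity, LinearMap.add_comp]
    · simp only [LinearMap.add_apply, ha.leibniz, hb.leibniz]
      simp only [fmul, TensorProduct.map_add_left, TensorProduct.map_add_right,
        LinearMap.add_comp, LinearMap.comp_add]
      abel
    · obtain ⟨s, hs⟩ := ha.continuous c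
      obtain ⟨t, ht⟩ := hb.continuous c
      refine ⟨s ∪ t, fun f hf => ?_⟩
      simp [hs f fun x hx => hf x (Finset.mem_union_left _ hx),
        ht f fun x hx => hf x (Finset.mem_union_right _ hx)]
    · simp [ha.vanishing, hb.vanishing]
  smul_mem' := by
    intro r a ha
    refine ⟨fun f => ?_, fun f g => ?_, fun c => ?_, fun f => ?_⟩
    · simp [ha.parity, LinearMap.smul_comp, smul_comm r]
    · simp only [LinearMap.smul_apply, ha.leibniz]
      simp only [fmul, TensorProduct.map_smul_left, TensorProduct.map_smul_right,
        LinearMap.smul_comp, LinearMap.comp_smul, smul_add]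
    · obtain ⟨s, hs⟩ := ha.continuous c
      exact ⟨s, fun f hf => by simp [hs f hf]⟩
    · simp [ha.vanishing]

variable {U : Type*} [AddCommGroup U] [Module k U] [FiniteDimensional k U]

/-- For a linear map `q : C → U`, the map `t : C → U` that is dual to the restriction of `δ` along
`q^* : U^* → C^*`, that is, `f (t c) = δ (f ∘ q) c` for `f` in `U^*` and `c` in `C`. -/
def dualRestrict (q : C →ₗ[k] U) (δ : Module.End k (Module.Dual k C)) : C →ₗ[k] U :=
  (Module.evalEquiv k U).symm.toLinearMap ∘ₗ (δ ∘ₗ q.dualMap).dualMap ∘ₗ Module.Dual.eval k C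

theorem apply_dualRestrict (q : C →ₗ[k] U) (δ : Module.End k (Module.Dual k C))
    (f : Module.Dual k U) (c : C) : f (dualRestrict q δ c) = δ (f ∘ₗ q) c := by
  simp [dualRestrict, LinearMap.dualMap_apply']

theorem dualRestrict_add (q : C →ₗ[k] U) (δ δ' : Module.End k (Module.Dual k C)) :
    dualRestrict q (δ + δ') = dualRestrict q δ + dualRestrict q δ' := by
  ext1 c
  refine (Module.evalEquiv k U).injective (LinearMap.ext fun f => ?_)
  simp [apply_dualRestrict]

theorem dualRestrict_smul (q : C →ₗ[k] U) (r : k) (δ : Module.End k (Module.Dual k C)) :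
    dualRestrict q (r • δ) = r • dualRestrict q δ := by
  ext1 c
  refine (Module.evalEquiv k U).injective (LinearMap.ext fun f => ?_)
  simp [apply_dualRestrict]

/-- The components of a vector field `δ` of parity `i`, all `n` together: the dual
`t : C → U` of the restriction of `δ` to `U^*`, with its Koszul sign:
`f (t c) = (-1)^{i|f|} (δ f) c`.  Here `p : C → U` is the projection and `σ` the parity involution
of `U`. -/
def taylor (p : C →ₗ[k] U) (σ : U →ₗ[k] U) (i : ZMod 2) (δ : Module.End k (Module.Dual k C)) :
    C →ₗ[k] U :=
  dualRestrict (if i = 0 then p else σ ∘ₗ p) δ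

/-- The vector fields of parity `i` that are symplectic for the form `ω` on `U`: the expressions
`ω (δₙ (x₁, …, xₙ), xₙ₊₁)` are invariant, with Koszul signs, under cyclic permutations
of `x₁, …, xₙ₊₁`.  Here `x₁ = u`, the word `x₂ ⋯ xₙ` is `c`, and `xₙ₊₁ = v`. -/
def symplecticFields (Δ : C →ₗ[k] C ⊗[k] C) (γ : C →ₗ[k] C) (ι : U →ₗ[k] C) (p : C →ₗ[k] U)
    (σ : U →ₗ[k] U) (ω : U →ₗ[k] U →ₗ[k] k) (i : ZMod 2) :
    Submodule k (Module.End k (Module.Dual k C)) where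
  carrier := {δ | δ ∈ vectorFields Δ γ i ∧ ∀ (a b l : ZMod 2) (u v : U) (c : C),
    IsHomog σ a u → IsHomog σ b v → IsHomog γ l c →
      ω (taylor p σ i δ (ι u * c)) v = sgn k (a * (l + b)) * ω (taylor p σ i δ (c * ι v)) u}
  zero_mem' := by
    refine ⟨Submodule.zero_mem _, fun a b l u v c _ _ _ => ?_⟩
    have : taylor p σ i (0 : Module.End k (Module.Dual k C)) = 0 := by
      simpa [taylor] using dualRestrict_smul (if i = 0 then p else σ ∘ₗ p) (0 : k) 0
    simp [this]
  add_mem' := by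
    rintro x y ⟨hx, hx'⟩ ⟨hy, hy'⟩
    refine ⟨Submodule.add_mem _ hx hy, fun a b l u v c hu hv hc => ?_⟩
    have h1 := hx' a b l u v c hu hv hc
    have h2 := hy' a b l u v c hu hv hc
    simp only [taylor] at h1 h2 ⊢
    simp only [dualRestrict_add, LinearMap.add_apply, map_add, h1, h2, mul_add]
  smul_mem' := by
    rintro r x ⟨hx, hx'⟩
    refine ⟨Submodule.smul_mem _ r hx, fun a b l u v c hu hv hc => ?_⟩
    have h1 := hx' a b l u v c hu hv hc
    simp only [taylor] at h1 ⊢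
    simp only [dualRestrict_smul, LinearMap.smul_apply, map_smul, h1, smul_eq_mul]
    ring

end VectorFields

/-! ### Coderivations and Chevalley–Eilenberg complexes -/

section ChevalleyEilenberg

variable {k : Type*} [Field k]

/-- The coderivation `c ↦ ∑ t(c₍₁₎) c₍₂₎` of `S U` cogenerated by `t : S U → U`. -/
def sCoder {E O : Type*} [AddCommGroup E] [Module k E] [AddCommGroup O] [Module k O]
    (t : S k E O →ₗ[k] (E × O)) : Module.End k (S k E O) :=
  LinearMap.mul' k (S k E O) ∘ₗ TensorProduct.map (sι k E O ∘ₗ t) LinearMap.id ∘ₗ comul k E O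

/-- `K₀ ⊕ K₁` is a graded Lie subalgebra of the algebra `A`, under the graded commutator. -/
structure IsLieSubalgebra {A : Type*} [Ring A] [Algebra k A] (K₀ K₁ : Submodule k A) : Prop where
  even_even : ∀ x ∈ K₀, ∀ y ∈ K₀, x * y - y * x ∈ K₀
  even_odd : ∀ x ∈ K₀, ∀ y ∈ K₁, x * y - y * x ∈ K₁
  odd_odd : ∀ x ∈ K₁, ∀ y ∈ K₁, x * y + y * x ∈ K₀

variable {A : Type*} [Ring A] [Algebra k A] {K₀ K₁ : Submodule k A}

/-- The map `Πg ⊗ Πg → Πg`, `Πx ⊗ Πy ↦ (-1)^{|Πx|} Π[x, y]`, for the graded Lie algebra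
`g = K₀ ⊕ K₁` with the graded commutator as its bracket.  The even part of `Πg` is `K₁`, its odd
part is `K₀`. -/
def ceBracket (h : IsLieSubalgebra K₀ K₁) : (K₁ × K₀) →ₗ[k] (K₁ × K₀) →ₗ[k] (K₁ × K₀) :=
  LinearMap.mk₂ k
    (fun x y =>
      (⟨((x.1 : A) * y.2 - y.2 * x.1) - (x.2 * y.1 - y.1 * x.2), by
          have h1 := h.even_odd _ y.2.2 _ x.1.2
          have h2 := h.even_odd _ x.2.2 _ y.1.2
          have := Submodule.sub_mem _ (Submodule.neg_mem _ h1) h2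
          rwa [neg_sub] at this⟩,
       ⟨((x.1 : A) * y.1 + y.1 * x.1) - (x.2 * y.2 - y.2 * x.2),
          Submodule.sub_mem _ (h.odd_odd _ x.1.2 _ y.1.2) (h.even_even _ x.2.2 _ y.2.2)⟩))
    (fun x x' y => by ext <;> simp [add_mul, mul_add] <;> abel)
    (fun c x y => by ext <;> simp [smul_sub, smul_add])
    (fun x y y' => by ext <;> simp [add_mul, mul_add] <;> abel)
    (fun c x y => by ext <;> simp [smul_sub, smul_add])

/-- The Chevalley–Eilenberg differential on `S(Πg)`: the coderivation whose corestriction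
`S(Πg) → Πg` is `Πx · Πy ↦ (-1)^{|Πx|} Π[x, y]` in weight two and zero in all other weights. -/
def ceDiff (h : IsLieSubalgebra K₀ K₁) : Module.End k (S k K₁ K₀) :=
  sCoder ((2⁻¹ : k) • (TensorProduct.lift (ceBracket h) ∘ₗ
    TensorProduct.map (sProj k K₁ K₀) (sProj k K₁ K₀) ∘ₗ comul k K₁ K₀))

variable (K₀ K₁) in
/-- `CE_*(g)`, completed with respect to weight: the product `∏ₙ Sⁿ(Πg)` of the symmetric powers
of `Πg`. -/
def ceCompleted : Submodule k (ℕ → S k K₁ K₀) where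
  carrier := {f | ∀ n, f n ∈ LinearMap.range (sι k K₁ K₀) ^ n}
  zero_mem' := fun _ => Submodule.zero_mem _
  add_mem' := fun hf hg n => Submodule.add_mem _ (hf n) (hg n)
  smul_mem' := fun c _ hf n => Submodule.smul_mem _ c (hf n)

/-- The differential of the completed complex; it lowers the weight by one. -/
def ceDiffCompleted (h : IsLieSubalgebra K₀ K₁) : Module.End k (ℕ → S k K₁ K₀) :=
  LinearMap.pi fun n => ceDiff h ∘ₗ LinearMap.proj (n + 1)

/-- The homology of the complex `N` with differential the restriction of `d`. -/
abbrev Homology {M : Type*} [AddCommGroup M] [Module k M] (d : Module.End k M)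
    (N : Submodule k M) : Type _ :=
  ↥(N ⊓ LinearMap.ker d) ⧸ (N.map d).comap (N ⊓ LinearMap.ker d).subtype

/-- `F = (Fₙ)` is a map of graded coalgebras from `S U` to the weight completed coalgebra
`∏ₙ Sⁿ W`. -/
structure IsCoalgMap {E O E' O' : Type*} [AddCommGroup E] [Module k E] [AddCommGroup O]
    [Module k O] [AddCommGroup E'] [Module k E'] [AddCommGroup O'] [Module k O']
    (F : ℕ → S k E O →ₗ[k] S k E' O') : Prop where
  weight : ∀ n c, F n c ∈ LinearMap.range (sι k E' O') ^ n
  even : ∀ n c, F n (sPar k E O c) = sPar k E' O' (F n c)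
  counit : ∀ c, sCounit k E' O' (F 0 c) = sCounit k E O c
  comul : ∀ n c, comul k E' O' (F n c)
    = ∑ p ∈ Finset.HasAntidiagonal.antidiagonal n, TensorProduct.map (F p.1) (F p.2) (comul k E O c)

/-- `g = K₀ ⊕ K₁` is a graded Lie algebra, `(S U, d)` and `CE_*(g)` are complexes, and there is a
map `F` of dg coalgebras from `(S U, d)` to `CE_*(g)` whose component `χ : S U → Πg` satisfies
`value χ`.  It is the only map of graded coalgebras with this property, and it induces a map in
homology. -/
def HasCEMap {E O : Type*} [AddCommGroup E] [Module k E] [AddCommGroup O] [Module k O]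
    (d : Module.End k (S k E O)) (K₀ K₁ : Submodule k A)
    (value : (S k E O →ₗ[k] (K₁ × K₀)) → Prop) : Prop :=
  ∃ h : IsLieSubalgebra K₀ K₁,
    (∀ c, d (d c) = 0) ∧
    (∀ f ∈ ceCompleted K₀ K₁, ceDiffCompleted h f ∈ ceCompleted K₀ K₁ ∧
      ceDiffCompleted h (ceDiffCompleted h f) = 0) ∧
    ∃ F : ℕ → S k E O →ₗ[k] S k K₁ K₀,
      IsCoalgMap F ∧
      (∀ c, (fun n => F n (d c)) = ceDiffCompleted h (fun n => F n c)) ∧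
      value (sProj k K₁ K₀ ∘ₗ F 1) ∧
      (∀ G : ℕ → S k E O →ₗ[k] S k K₁ K₀,
        IsCoalgMap G → value (sProj k K₁ K₀ ∘ₗ G 1) → G = F) ∧
      ∃ φ : Homology d ⊤ →ₗ[k] Homology (ceDiffCompleted h) (ceCompleted K₀ K₁),
        ∀ z : ↥(⊤ ⊓ LinearMap.ker d),
          ∃ z' : ↥(ceCompleted K₀ K₁ ⊓ LinearMap.ker (ceDiffCompleted h)),
            (z' : ℕ → S k K₁ K₀) = (fun n => F n z) ∧
            φ (Submodule.Quotient.mk z) = Submodule.Quotient.mk z'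

end ChevalleyEilenberg

/-! ### Infinity structures on `V = V₀ ⊕ V₁`, with `U = ΠV = V₁ × V₀` -/

section Structures

variable (k V₀ V₁ : Type*) [Field k] [AddCommGroup V₀] [Module k V₀] [AddCommGroup V₁]
  [Module k V₁] [FiniteDimensional k V₀] [FiniteDimensional k V₁]

/-- The part of parity `i` of `g = Der₀ (Ŝ ΠV^*)`, where `Ŝ ΠV^*` is the dual of `S ΠV`. -/
abbrev lieFields (i : ZMod 2) : Submodule k (Module.End k (Module.Dual k (S k V₁ V₀))) :=
  vectorFields (comul k V₁ V₀) (sPar k V₁ V₀).toLinearMap i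

/-- The part of parity `i` of `h = Der₀ (T̂ ΠV^*)`, where `T̂ ΠV^*` is the dual of `T ΠV`. -/
abbrev assocFields (i : ZMod 2) : Submodule k (Module.End k (Module.Dual k (T k V₁ V₀))) :=
  vectorFields (deconc k V₁ V₀) (tPar k V₁ V₀).toLinearMap i

variable {k V₀ V₁}

/-- `B` is a graded symmetric non-degenerate inner product of parity `π` on `V = V₀ ⊕ V₁`. -/
structure IsInnerProduct (π : ZMod 2) (B : (V₀ × V₁) →ₗ[k] (V₀ × V₁) →ₗ[k] k) : Prop where
  homogeneous : ∀ (i j : ZMod 2) (x y : V₀ × V₁), IsHomog (par k V₀ V₁) i x →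
    IsHomog (par k V₀ V₁) j y → i + j ≠ π → B x y = 0
  symmetric : ∀ (i j : ZMod 2) (x y : V₀ × V₁), IsHomog (par k V₀ V₁) i x →
    IsHomog (par k V₀ V₁) j y → B x y = sgn k (i * j) * B y x
  nondegenerate : ∀ x, (∀ y, B x y = 0) → x = 0

/-- The symplectic form `ω (Πa, Πb) = (-1)^{|a|} B (a, b)` on `ΠV`. -/
def symplecticForm (B : (V₀ × V₁) →ₗ[k] (V₀ × V₁) →ₗ[k] k) :
    (V₁ × V₀) →ₗ[k] (V₁ × V₀) →ₗ[k] k :=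
  B.compl₁₂ (par k V₀ V₁ ∘ₗ (LinearEquiv.prodComm k V₁ V₀).toLinearMap)
    (LinearEquiv.prodComm k V₁ V₀).toLinearMap

/-- The symplectic vector fields of parity `i` in `g`. -/
abbrev cyclicLieFields (B : (V₀ × V₁) →ₗ[k] (V₀ × V₁) →ₗ[k] k) (i : ZMod 2) :
    Submodule k (Module.End k (Module.Dual k (S k V₁ V₀))) :=
  symplecticFields (comul k V₁ V₀) (sPar k V₁ V₀).toLinearMap (sι k V₁ V₀) (sProj k V₁ V₀)
    (par k V₁ V₀) (symplecticForm B) i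

/-- The symplectic vector fields of parity `i` in `h`. -/
abbrev cyclicAssocFields (B : (V₀ × V₁) →ₗ[k] (V₀ × V₁) →ₗ[k] k) (i : ZMod 2) :
    Submodule k (Module.End k (Module.Dual k (T k V₁ V₀))) :=
  symplecticFields (deconc k V₁ V₀) (tPar k V₁ V₀).toLinearMap (tι k V₁ V₀) (tProj k V₁ V₀)
    (par k V₁ V₀) (symplecticForm B) i

/-- The components of a vector field of parity `i` on `Ŝ ΠV^*`, as one map `S ΠV → ΠV`; the `n`-th
component is its restriction to products of `n` elements of `ΠV`. -/
def lieComponents (i : ZMod 2) (δ : Module.End k (Module.Dual k (S k V₁ V₀))) :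
    S k V₁ V₀ →ₗ[k] (V₁ × V₀) :=
  taylor (sProj k V₁ V₀) (par k V₁ V₀) i δ

/-- The components of a vector field of parity `i` on `T̂ ΠV^*`, as one map `T ΠV → ΠV`. -/
def assocComponents (i : ZMod 2) (δ : Module.End k (Module.Dual k (T k V₁ V₀))) :
    T k V₁ V₀ →ₗ[k] (V₁ × V₀) :=
  taylor (tProj k V₁ V₀) (par k V₁ V₀) i δ

/-- The differential of `CE_*(V) = S ΠV` for an `L_∞`-structure `m`. -/
def lieCE (m : Module.End k (Module.Dual k (S k V₁ V₀))) : Module.End k (S k V₁ V₀) :=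
  sCoder (lieComponents 1 m)

/-- The differential of `CE_*(V) = S ΠV` for an `A_∞`-structure `m`: that of the associated
`L_∞`-structure, whose components are `∑_σ ± mₙ (x_{σ 1}, …, x_{σ n})`. -/
def assocCE (m : Module.End k (Module.Dual k (T k V₁ V₀))) : Module.End k (S k V₁ V₀) :=
  sCoder (assocComponents 1 m ∘ₗ symmetrize k V₁ V₀)

/-- The product `x₁ ⋯ xₙ` in `S ΠV`. -/
def sProd {n : ℕ} (x : Fin n → V₁ × V₀) : S k V₁ V₀ :=
  (List.ofFn fun i => sι k V₁ V₀ (x i)).prod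

/-- The word `x₁ ⊗ ⋯ ⊗ xₙ` in `T ΠV`. -/
def tProd {n : ℕ} (x : Fin n → V₁ × V₀) : T k V₁ V₀ :=
  (List.ofFn fun i => tι k V₁ V₀ (x i)).prod

/-- `χ_r (w₁, …, w_r)(x₁, …, xₙ) = m_{r+n} (w₁, …, w_r, x₁, …, xₙ)` for all `r ≥ 0` and `n ≥ 1`. An
element of `Πg` has an even part in `K₁` and an odd part in `K₀`. -/
def LieFormula (m : Module.End k (Module.Dual k (S k V₁ V₀)))
    {K₀ K₁ : Submodule k (Module.End k (Module.Dual k (S k V₁ V₀)))}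
    (χ : S k V₁ V₀ →ₗ[k] (K₁ × K₀)) : Prop :=
  ∀ (r n : ℕ) (w : Fin r → V₁ × V₀) (x : Fin n → V₁ × V₀), 1 ≤ n →
    lieComponents 1 ((χ (sProd w)).1 : Module.End k (Module.Dual k (S k V₁ V₀))) (sProd x)
        + lieComponents 0 ((χ (sProd w)).2 : Module.End k (Module.Dual k (S k V₁ V₀))) (sProd x)
      = lieComponents 1 m (sProd w * sProd x)

/-- `χ_r (w₁, …, w_r)(x₁, …, xₙ) = ∑_{σ ∈ S_r} m_{r+n} (σ (w₁ ⊗ ⋯ ⊗ w_r) | x₁, …, xₙ)` for all `r ≥ 0`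
and `n ≥ 1`, where `m_{r+n} (z | x)` is the sum over all shuffles of `z` and `x` with Koszul signs.
The two sums together range over all rearrangements of `w₁, …, w_r, x₁, …, xₙ` in which
`x₁, …, xₙ` occur in this order. -/
def AssocFormula (m : Module.End k (Module.Dual k (T k V₁ V₀)))
    {K₀ K₁ : Submodule k (Module.End k (Module.Dual k (T k V₁ V₀)))}
    (χ : S k V₁ V₀ →ₗ[k] (K₁ × K₀)) : Prop :=
  ∀ (r n : ℕ) (w : Fin r → V₁ × V₀) (x : Fin n → V₁ × V₀) (a : Fin r → ZMod 2)
    (b : Fin n → ZMod 2), 1 ≤ n →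
    (∀ i, IsHomog (par k V₁ V₀) (a i) (w i)) → (∀ i, IsHomog (par k V₁ V₀) (b i) (x i)) →
    assocComponents 1 ((χ (sProd w)).1 : Module.End k (Module.Dual k (T k V₁ V₀))) (tProd x)
        + assocComponents 0 ((χ (sProd w)).2 : Module.End k (Module.Dual k (T k V₁ V₀))) (tProd x)
      = ∑ τ : Equiv.Perm (Fin (r + n)) with
          ∀ i j : Fin n, i < j → τ.symm (Fin.natAdd r i) < τ.symm (Fin.natAdd r j),
        koszul k (Fin.append a b) τ • assocComponents 1 m (tProd fun i => Fin.append w x (τ i))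

end Structures

end SuperCE

end

noncomputable section

namespace SuperCE

/-! ### Parity -/

section Parity

/-! Write `U = ΠV`, and let `C` be the coalgebra `S U` or `T U`. A vector field on `C^*` that
vanishes at zero is the transpose, up to a power of the parity involution, of a coderivation of `C`
that kills `1` (`IsVectorField.exists_coder`). A coderivation is determined by its corestriction `C
→ U`, and every homogeneous map occurs as one. So `m` amounts to an odd map `t : C → U` with `coder
t * coder t = 0`. Let `a` in `S U` act on `C` by multiplication or by signed shuffles. Then `χ a` is
the dual of the coderivation with components `c ↦ t (a · c)`, made to vanish at `1` (`component`,
`actCoder`).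

Coalgebra maps. A map of graded coalgebras from `S U` to the completed `∏ Sⁿ W` is the convolution
exponential of its component (`comul_expMap`, `IsCoalgMap.eq_expMap`). The tool is the Euler
operator `sCoder sProj`, which multiplies weight `n` by `n` and so recovers an element of positive
weight from its coproduct in characteristic zero. The failure of the exponential `F` to commute with
the differentials is a derivation along `F`, hence zero as soon as its component is zero
(`derivation_eq_zero`). That component is the Maurer–Cartan equation: `χ (d a)` is half the sum of
the brackets of `χ a₍₁₎` and `χ a₍₂₎` (`expMap_comm_diff`).

The Maurer–Cartan equation. Elements `u` of `U` act on `C` by coderivations with constant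
components, so the graded commutator of `coder t` with `u` is `coder` of `c ↦ t (u · c)`. Iterating
over the letters of `a` shows that `coder t ∘ a` is the signed sum of `a₍₁₎ ∘ coder (t ∘ a₍₂₎)`
(`coder_mul_act`). The constant parts of the maps `t ∘ a₍₂₎` add up to the action of `d a`, where
`d` is the differential of `CE_*(V)` (`coder_mul_act_eq`). Now apply `t`: the left side dies because
`t ∘ coder t` is the corestriction of the square of `coder t`, and what remains is the Maurer–Cartan
equation (`component_sCoder`). Cocommutativity of `S U` turns products into halves of brackets
(`dualField_bracketEven`, `dualField_bracketOdd`). `IsShuffleSystem` collects what this argument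
uses, so that it runs once for `S U` and `T U`.

In the cyclic cases, symplectic fields are closed under the bracket (`IsCyclic.commutator`), and
cyclicity of `t` passes to `t ∘ a` (`IsCyclic.comp_act`), so `χ` has symplectic values. The explicit
formula with permutations comes from expanding the shuffle action letter by letter
(`shuffleAct_take_drop`). It determines `χ`, because a vector field is determined by its components.
-/

theorem sgn_zero (k : Type*) [Ring k] : sgn k 0 = 1 := by simp [sgn]

theorem sgn_one (k : Type*) [Ring k] : sgn k 1 = -1 := by simp [sgn]

theorem zmod_two_cases (i : ZMod 2) : i = 0 ∨ i = 1 := by revert i; decide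

theorem zmod_two_one_add_one : (1 + 1 : ZMod 2) = 0 := by decide

theorem sgn_add (k : Type*) [Ring k] (i j : ZMod 2) : sgn k (i + j) = sgn k i * sgn k j := by
  rcases zmod_two_cases i with rfl | rfl <;> rcases zmod_two_cases j with rfl | rfl <;>
    simp [sgn_zero, sgn_one, zmod_two_one_add_one]

theorem sgn_mul_self (k : Type*) [Ring k] (i : ZMod 2) : sgn k i * sgn k i = 1 := by
  rcases zmod_two_cases i with rfl | rfl <;> simp [sgn_zero, sgn_one]

variable {k M N : Type*} [Field k] [AddCommGroup M] [Module k M] [AddCommGroup N] [Module k N]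

/-- The power `γ ^ i` of a parity involution. -/
def parPow (γ : M →ₗ[k] M) (i : ZMod 2) : M →ₗ[k] M := if i = 0 then LinearMap.id else γ

theorem parPow_zero (γ : M →ₗ[k] M) : parPow γ 0 = LinearMap.id := by simp [parPow]

theorem parPow_one (γ : M →ₗ[k] M) : parPow γ 1 = γ := by simp [parPow]

/-- `f` is a homogeneous linear map of parity `i`. -/
def HasParity (γ : M →ₗ[k] M) (σ : N →ₗ[k] N) (i : ZMod 2) (f : M →ₗ[k] N) : Prop :=
  ∀ c, f (γ c) = sgn k i • σ (f c)

/-- Projection to the even elements. -/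
def evProj (γ : M →ₗ[k] M) : M →ₗ[k] M := (2⁻¹ : k) • (LinearMap.id + γ)

/-- Projection to the odd elements. -/
def odProj (γ : M →ₗ[k] M) : M →ₗ[k] M := (2⁻¹ : k) • (LinearMap.id - γ)

theorem evProj_apply (γ : M →ₗ[k] M) (x : M) : evProj γ x = (2⁻¹ : k) • (x + γ x) := rfl

theorem odProj_apply (γ : M →ₗ[k] M) (x : M) : odProj γ x = (2⁻¹ : k) • (x - γ x) := rfl

theorem evProj_add_odProj [CharZero k] (γ : M →ₗ[k] M) (x : M) :
    evProj γ x + odProj γ x = x := by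
  rw [evProj_apply, odProj_apply, ← smul_add, add_add_sub_cancel, ← two_smul k x, smul_smul,
    inv_mul_cancel₀ two_ne_zero, one_smul]

theorem par_evProj {γ : M →ₗ[k] M} (h : ∀ x, γ (γ x) = x) (x : M) :
    γ (evProj γ x) = evProj γ x := by
  simp [evProj_apply, h, add_comm]

theorem par_odProj {γ : M →ₗ[k] M} (h : ∀ x, γ (γ x) = x) (x : M) :
    γ (odProj γ x) = -odProj γ x := by
  simp [odProj_apply, h, ← smul_neg]

theorem evProj_of_even [CharZero k] {γ : M →ₗ[k] M} {x : M} (h : γ x = x) : evProj γ x = x := by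
  rw [evProj_apply, h, ← two_smul k x, smul_smul, inv_mul_cancel₀ two_ne_zero, one_smul]

theorem odProj_of_odd [CharZero k] {γ : M →ₗ[k] M} {x : M} (h : γ x = -x) : odProj γ x = x := by
  rw [odProj_apply, h, sub_neg_eq_add, ← two_smul k x, smul_smul, inv_mul_cancel₀ two_ne_zero,
    one_smul]

theorem odProj_of_even {γ : M →ₗ[k] M} {x : M} (h : γ x = x) : odProj γ x = 0 := by
  simp [odProj_apply, h]

theorem evProj_of_odd {γ : M →ₗ[k] M} {x : M} (h : γ x = -x) : evProj γ x = 0 := by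
  simp [evProj_apply, h]

/-- The signed exchange `x ⊗ y ↦ (-1)^{|x||y|} y ⊗ x`. -/
def braid (γ : M →ₗ[k] M) : M ⊗[k] M →ₗ[k] M ⊗[k] M :=
  (TensorProduct.comm k M M).toLinearMap ∘ₗ
    (TensorProduct.map (evProj γ) LinearMap.id + TensorProduct.map (odProj γ) γ)

theorem braid_tmul (γ : M →ₗ[k] M) (x y : M) :
    braid γ (x ⊗ₜ y) = y ⊗ₜ evProj γ x + γ y ⊗ₜ odProj γ x := by
  simp [braid]

variable {C : Type*} [AddCommGroup C] [Module k C]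

/-- `X` is a coderivation of parity `i`. -/
structure IsCoder (Δ : C →ₗ[k] C ⊗[k] C) (γ : C →ₗ[k] C) (i : ZMod 2) (X : Module.End k C) :
    Prop where
  parity : HasParity γ γ i X
  coleibniz : ∀ c, Δ (X c) = TensorProduct.map X LinearMap.id (Δ c)
    + TensorProduct.map (parPow γ i) X (Δ c)

end Parity

/-! ### The bialgebra identities of the graded symmetric coalgebra -/

section SymmetricCoalgebra

variable {k E O : Type*} [Field k] [AddCommGroup E] [Module k E] [AddCommGroup O] [Module k O]

theorem par_par (u : E × O) : par k E O (par k E O u) = u := by simp [par]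

theorem par_apply (u : E × O) : par k E O u = (u.1, -u.2) := by simp [par]

theorem par_mk (a : E) (b : O) : par k E O (a, b) = (a, -b) := by simp [par]

theorem sMk_surjective : Function.Surjective (sMk k E O) := RingQuot.mkAlgHom_surjective k _

theorem T_induction {P : T k E O → Prop} (one : P 1) (add : ∀ x y, P x → P y → P (x + y))
    (smul : ∀ (r : k) x, P x → P (r • x)) (ι_mul : ∀ u x, P x → P (tι k E O u * x)) (c) : P c := by
  -- Strengthened to left multiplication by any `t`, since the induction principle of the tensor
  -- algebra splits arbitrary products while `P` is only known to survive multiplication by a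
  -- letter.
  have key : ∀ t s : T k E O, P s → P (t * s) := by
    intro t
    induction t using TensorAlgebra.induction with
    | algebraMap r => intro s hs; rw [← Algebra.smul_def]; exact smul _ _ hs
    | ι x => intro s hs; exact ι_mul x s hs
    | mul a b ha hb => intro s hs; rw [mul_assoc]; exact ha _ (hb _ hs)
    | add a b ha hb => intro s hs; rw [add_mul]; exact add _ _ (ha s hs) (hb s hs)
  simpa using key c 1 one

theorem T_induction_homog {P : T k E O → Prop} (one : P 1) (add : ∀ x y, P x → P y → P (x + y))
    (smul : ∀ (r : k) x, P x → P (r • x)) (even : ∀ a x, P x → P (tι k E O (a, 0) * x))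
    (odd : ∀ b x, P x → P (tι k E O (0, b) * x)) (c) : P c := by
  refine T_induction one add smul (fun u x hx => ?_) c
  rw [split_eq E O u, map_add, add_mul]
  exact add _ _ (even _ _ hx) (odd _ _ hx)

/-- Letters are taken purely even or purely odd, because the coproduct has one clean formula in each
of these cases. -/
theorem S_induction {P : S k E O → Prop} (one : P 1) (add : ∀ x y, P x → P y → P (x + y))
    (smul : ∀ (r : k) x, P x → P (r • x)) (even : ∀ a x, P x → P (sι k E O (a, 0) * x))
    (odd : ∀ b x, P x → P (sι k E O (0, b) * x)) (c) : P c := by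
  obtain ⟨t, rfl⟩ := sMk_surjective c
  refine T_induction_homog (P := fun t => P (sMk k E O t)) ?_ (fun x y hx hy => ?_)
    (fun r x hx => ?_) (fun a x hx => ?_) (fun b x hx => ?_) t
  · simpa using one
  · rw [map_add]; exact add _ _ hx hy
  · rw [map_smul]; exact smul _ _ hx
  · rw [map_mul]; exact even _ _ hx
  · rw [map_mul]; exact odd _ _ hx

theorem sPar_sPar (c : S k E O) : sPar k E O (sPar k E O c) = c := by
  induction c using S_induction with
  | one => simp
  | add x y hx hy => simp [hx, hy]
  | smul r x hx => simp [hx]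
  | even a x hx => simp [sPar_even, hx]
  | odd b x hx => simp [sPar_odd, hx]

/-- In this form the coproduct of `a c` is a sum of maps applied factorwise to the coproduct of `c`,
so that later maps on the two factors can be composed with it. -/
theorem comul_even (a : E) (c : S k E O) :
    comul k E O (sι k E O (a, 0) * c)
      = TensorProduct.map (LinearMap.mulLeft k (sι k E O (a, 0))) LinearMap.id (comul k E O c)
        + TensorProduct.map LinearMap.id (LinearMap.mulLeft k (sι k E O (a, 0))) (comul k E O c) := by
  rw [comul_ι_mul]
  generalize comul k E O c = z
  induction z with
  | zero => simp
  | tmul x y => simp [comulStep_even]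
  | add x y hx hy => simp only [map_add, hx, hy]; abel

theorem comul_odd (b : O) (c : S k E O) :
    comul k E O (sι k E O (0, b) * c)
      = TensorProduct.map (LinearMap.mulLeft k (sι k E O (0, b))) LinearMap.id (comul k E O c)
        + TensorProduct.map (sPar k E O).toLinearMap (LinearMap.mulLeft k (sι k E O (0, b)))
          (comul k E O c) := by
  rw [comul_ι_mul]
  generalize comul k E O c = z
  induction z with
  | zero => simp
  | tmul x y => simp [comulStep_odd]
  | add x y hx hy => simp only [map_add, hx, hy]; abel

theorem comul_sPar (c : S k E O) : comul k E O (sPar k E O c)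
    = TensorProduct.map (sPar k E O).toLinearMap (sPar k E O).toLinearMap (comul k E O c) := by
  induction c using S_induction with
  | one => simp [comul_one]
  | add x y hx hy => simp [hx, hy]
  | smul r x hx => simp [hx]
  | even a x hx =>
    rw [map_mul, sPar_even, comul_even, comul_even, hx]
    generalize comul k E O x = z
    induction z with
    | zero => simp
    | tmul x y => simp [sPar_even]
    | add x y hx hy => simp only [map_add] at *; rw [add_add_add_comm, hx, hy]; abel
  | odd b x hx =>
    rw [map_mul, sPar_odd, neg_mul, map_neg, comul_odd, comul_odd, hx]
    generalize comul k E O x = z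
    induction z with
    | zero => simp
    | tmul x y => simp [sPar_odd, TensorProduct.neg_tmul, TensorProduct.tmul_neg, add_comm]
    | add x y hx hy =>
      simp only [map_add, neg_add] at *; rw [add_add_add_comm, hx, hy]; abel

theorem sCounit_ι_mul (u : E × O) (c : S k E O) : sCounit k E O (sι k E O u * c) = 0 := by
  simp [sCounit, sLift_ι]

theorem sCounit_sPar (c : S k E O) : sCounit k E O (sPar k E O c) = sCounit k E O c := by
  induction c using S_induction with
  | one => simp
  | add x y hx hy => simp [hx, hy]
  | smul r x hx => simp [hx]
  | even a x hx => simp [sPar_even, sCounit_ι_mul]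
  | odd a x hx => simp [sPar_odd, sCounit_ι_mul]

/-- An arbitrary `f` makes the induction close: a letter that lands in the second factor changes `f`
into `f` after multiplication by it, and a letter in the first factor is killed by the counit. -/
theorem counit_comul {M : Type*} [AddCommGroup M] [Module k M] (f : S k E O →ₗ[k] M)
    (c : S k E O) :
    TensorProduct.lid k M
      (TensorProduct.map (sCounit k E O).toLinearMap f (comul k E O c)) = f c := by
  induction c using S_induction generalizing f with
  | one => simp [comul_one]
  | add x y hx hy => simp [hx, hy]
  | smul r x hx => simp [hx]
  | even a x hx =>
    rw [comul_even]
    simp only [map_add, TensorProduct.map_map]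
    have := hx (f ∘ₗ LinearMap.mulLeft k (sι k E O (a, 0)))
    have h0 : (sCounit k E O).toLinearMap ∘ₗ LinearMap.mulLeft k (sι k E O (a, 0)) = 0 := by
      ext; simp [sCounit, sLift_ι]
    simpa [h0] using this
  | odd b x hx =>
    rw [comul_odd]
    simp only [map_add, TensorProduct.map_map]
    have := hx (f ∘ₗ LinearMap.mulLeft k (sι k E O (0, b)))
    have h0 : (sCounit k E O).toLinearMap ∘ₗ LinearMap.mulLeft k (sι k E O (0, b)) = 0 := by
      ext; simp [sCounit, sLift_ι]
    have h1 : (sCounit k E O).toLinearMap ∘ₗ (sPar k E O).toLinearMap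
        = (sCounit k E O).toLinearMap := by
      ext; simp [sCounit_sPar]
    simpa [h0, h1] using this

theorem comul_counit {M : Type*} [AddCommGroup M] [Module k M] (f : S k E O →ₗ[k] M)
    (c : S k E O) :
    TensorProduct.rid k M
      (TensorProduct.map f (sCounit k E O).toLinearMap (comul k E O c)) = f c := by
  induction c using S_induction generalizing f with
  | one => simp [comul_one]
  | add x y hx hy => simp [hx, hy]
  | smul r x hx => simp [hx]
  | even a x hx =>
    rw [comul_even]
    simp only [map_add, TensorProduct.map_map]
    have := hx (f ∘ₗ LinearMap.mulLeft k (sι k E O (a, 0)))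
    have h0 : (sCounit k E O).toLinearMap ∘ₗ LinearMap.mulLeft k (sι k E O (a, 0)) = 0 := by
      ext; simp [sCounit, sLift_ι]
    simpa [h0] using this
  | odd b x hx =>
    rw [comul_odd]
    simp only [map_add, TensorProduct.map_map]
    have := hx (f ∘ₗ LinearMap.mulLeft k (sι k E O (0, b)))
    have h0 : (sCounit k E O).toLinearMap ∘ₗ LinearMap.mulLeft k (sι k E O (0, b)) = 0 := by
      ext; simp [sCounit, sLift_ι]
    simpa [h0] using this

/-- Graded cocommutativity. The signed exchange commutes with `comulStep`, since it interchanges the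
two factors in which the new letter can be placed. -/
theorem braid_comul [CharZero k] (c : S k E O) :
    braid (sPar k E O).toLinearMap (comul k E O c) = comul k E O c := by
  induction c using S_induction with
  | one =>
    simp [comul_one, braid_tmul, evProj_of_even, odProj_of_even]
  | add x y hx hy => simp [hx, hy]
  | smul r x hx => simp [hx]
  | even a x hx =>
    rw [comul_ι_mul]
    conv_rhs => rw [← hx]
    generalize comul k E O x = z
    induction z with
    | zero => simp
    | tmul x y =>
      simp only [comulStep_even, map_add, braid_tmul, evProj_apply, odProj_apply,
        AlgHom.toLinearMap_apply, map_mul, sPar_even]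
      simp only [mul_add, mul_sub, mul_smul_comm]
      abel
    | add x y hx hy => simp only [map_add, hx, hy]
  | odd b x hx =>
    rw [comul_ι_mul]
    conv_rhs => rw [← hx]
    generalize comul k E O x = z
    induction z with
    | zero => simp
    | tmul x y =>
      simp only [comulStep_odd, map_add, braid_tmul, evProj_apply, odProj_apply,
        AlgHom.toLinearMap_apply, map_mul, sPar_odd, sPar_sPar, neg_mul]
      simp only [mul_add, mul_sub, mul_smul_comm, sub_neg_eq_add, ← sub_eq_add_neg,
        TensorProduct.tmul_smul, TensorProduct.tmul_add, TensorProduct.tmul_sub,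
        TensorProduct.neg_tmul, smul_add, smul_sub, smul_neg]
      abel
    | add x y hx hy => simp only [map_add, hx, hy]

theorem comul_coassoc (c : S k E O) :
    TensorProduct.assoc k _ _ _ (TensorProduct.map (comul k E O) LinearMap.id (comul k E O c))
      = TensorProduct.map LinearMap.id (comul k E O) (comul k E O c) := by
  induction c using S_induction with
  | one => simp [comul_one]
  | add x y hx hy => simp [hx, hy]
  | smul r x hx => simp [hx]
  | even a x hx =>
    -- `step` places the letter in each of the three factors. Both iterated coproducts intertwine
    -- multiplication by the letter with `step`.
    let step : S k E O ⊗[k] (S k E O ⊗[k] S k E O) →ₗ[k] S k E O ⊗[k] (S k E O ⊗[k] S k E O) :=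
      TensorProduct.map (LinearMap.mulLeft k (sι k E O (a, 0))) LinearMap.id
        + TensorProduct.map LinearMap.id (comulStep k E O (a, 0))
    have h1 : ∀ z : S k E O ⊗[k] S k E O,
        TensorProduct.map LinearMap.id (comul k E O) (comulStep k E O (a, 0) z)
          = step (TensorProduct.map LinearMap.id (comul k E O) z) := by
      intro z
      induction z with
      | zero => simp
      | tmul x y => simp [comulStep_even, comul_ι_mul, step]
      | add x y hx hy => simp only [map_add, hx, hy]
    have h2 : ∀ z : S k E O ⊗[k] S k E O, TensorProduct.assoc k _ _ _
        (TensorProduct.map (comul k E O) LinearMap.id (comulStep k E O (a, 0) z))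
          = step (TensorProduct.assoc k _ _ _
              (TensorProduct.map (comul k E O) LinearMap.id z)) := by
      intro z
      induction z with
      | zero => simp
      | tmul x y =>
        simp only [comulStep_even, map_add, TensorProduct.map_tmul, comul_ι_mul,
          LinearMap.id_apply]
        generalize comul k E O x = w
        induction w with
        | zero => simp
        | tmul x y => simp [step, comulStep_even, TensorProduct.add_tmul, TensorProduct.tmul_add]; abel
        | add x y hx hy =>
          simp only [map_add, TensorProduct.add_tmul] at *
          rw [add_add_add_comm, hx, hy]
      | add x y hx hy => simp only [map_add, hx, hy]
    rw [comul_ι_mul, h1, h2, hx]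
  | odd b x hx =>
    let step : S k E O ⊗[k] (S k E O ⊗[k] S k E O) →ₗ[k] S k E O ⊗[k] (S k E O ⊗[k] S k E O) :=
      TensorProduct.map (LinearMap.mulLeft k (sι k E O (0, b))) LinearMap.id
        + TensorProduct.map (sPar k E O).toLinearMap (comulStep k E O (0, b))
    have h1 : ∀ z : S k E O ⊗[k] S k E O,
        TensorProduct.map LinearMap.id (comul k E O) (comulStep k E O (0, b) z)
          = step (TensorProduct.map LinearMap.id (comul k E O) z) := by
      intro z
      induction z with
      | zero => simp
      | tmul x y => simp [comulStep_odd, comul_ι_mul, step]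
      | add x y hx hy => simp only [map_add, hx, hy]
    have h2 : ∀ z : S k E O ⊗[k] S k E O, TensorProduct.assoc k _ _ _
        (TensorProduct.map (comul k E O) LinearMap.id (comulStep k E O (0, b) z))
          = step (TensorProduct.assoc k _ _ _
              (TensorProduct.map (comul k E O) LinearMap.id z)) := by
      intro z
      induction z with
      | zero => simp
      | tmul x y =>
        simp only [comulStep_odd, map_add, TensorProduct.map_tmul, comul_ι_mul, comul_sPar,
          LinearMap.id_apply]
        generalize comul k E O x = w
        induction w with
        | zero => simp
        | tmul x y => simp [step, comulStep_odd, TensorProduct.add_tmul, TensorProduct.tmul_add]; abel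
        | add x y hx hy =>
          simp only [map_add, TensorProduct.add_tmul] at *
          rw [add_add_add_comm, hx, hy]
      | add x y hx hy => simp only [map_add, hx, hy]
    rw [comul_ι_mul, h1, h2, hx]

end SymmetricCoalgebra

/-! ### Coderivations of the symmetric coalgebra -/

section SymmetricCoder

variable {k E O : Type*} [Field k] [AddCommGroup E] [Module k E] [AddCommGroup O] [Module k O]

theorem sProj_one : sProj k E O 1 = 0 := by
  let _ : Module kᵐᵒᵖ (E × O) := Module.compHom _ ((RingHom.id k).fromOpposite mul_comm)
  have _ : IsCentralScalar k (E × O) := ⟨fun r m => rfl⟩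
  let L : S k E O →ₐ[k] TrivSqZeroExt k (E × O) :=
    sLift (TrivSqZeroExt.inrHom k (E × O)) (fun a w => by simp) (fun b c => by simp)
  change (L 1).snd = 0
  simp

/-- `sProj` is the second component of an algebra map to the trivial square-zero extension whose
first component is the counit, so the product rule there gives the value. -/
theorem sProj_ι_mul (u : E × O) (c : S k E O) :
    sProj k E O (sι k E O u * c) = sCounit k E O c • u := by
  let _ : Module kᵐᵒᵖ (E × O) := Module.compHom _ ((RingHom.id k).fromOpposite mul_comm)
  have _ : IsCentralScalar k (E × O) := ⟨fun r m => rfl⟩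
  let L : S k E O →ₐ[k] TrivSqZeroExt k (E × O) :=
    sLift (TrivSqZeroExt.inrHom k (E × O)) (fun a w => by simp) (fun b c => by simp)
  have hL : ∀ c, sProj k E O c = (L c).snd := fun c => rfl
  have hι : ∀ u, L (sι k E O u) = TrivSqZeroExt.inr u := fun u => sLift_ι _ _ _ u
  have hfst : ∀ c, (L c).fst = sCounit k E O c := by
    intro c
    induction c using S_induction with
    | one => simp
    | add x y hx hy => simp [hx, hy]
    | smul r x hx => simp [hx]
    | even a x hx => rw [map_mul, hι, sCounit_ι_mul]; simp
    | odd a x hx => rw [map_mul, hι, sCounit_ι_mul]; simp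
  rw [hL, map_mul, hι, TrivSqZeroExt.snd_mul, hfst]
  simp

theorem sProj_ι (u : E × O) : sProj k E O (sι k E O u) = u := by
  simpa using sProj_ι_mul u (1 : S k E O)

theorem sProj_sPar (c : S k E O) : sProj k E O (sPar k E O c) = par k E O (sProj k E O c) := by
  induction c using S_induction with
  | one => simp [sProj_one]
  | add x y hx hy => simp [hx, hy]
  | smul r x hx => simp [hx]
  | even a x hx => simp [sPar_even, sProj_ι_mul, sCounit_sPar, par_mk]
  | odd b x hx =>
    simp [sPar_odd, sProj_ι_mul, sCounit_sPar, par_mk]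

theorem sι_par_mul_odd (w : E × O) (b : O) :
    sι k E O (par k E O w) * sι k E O (0, b) = sι k E O (0, b) * sι k E O w := by
  have h : sι k E O w = sι k E O (w.1, 0) + sι k E O (0, w.2) := by
    rw [← map_add, ← split_eq]
  have h' : sι k E O (par k E O w) = sι k E O (w.1, 0) - sι k E O (0, w.2) := by
    rw [← map_sub]; congr 1; simp [par]
  rw [h, h', mul_add, sub_mul, sι_even_comm, sι_odd_comm]; abel

theorem sCoder_add (t t' : S k E O →ₗ[k] E × O) : sCoder (t + t') = sCoder t + sCoder t' := by
  simp [sCoder, LinearMap.comp_add, TensorProduct.map_add_left, LinearMap.add_comp]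

theorem sCoder_smul (r : k) (t : S k E O →ₗ[k] E × O) : sCoder (r • t) = r • sCoder t := by
  simp [sCoder, LinearMap.comp_smul, TensorProduct.map_smul_left, LinearMap.smul_comp]

theorem sCoder_one (t : S k E O →ₗ[k] E × O) : sCoder t 1 = sι k E O (t 1) := by
  simp [sCoder, comul_one]

theorem sCoder_even_mul (t : S k E O →ₗ[k] E × O) (a : E) (c : S k E O) :
    sCoder t (sι k E O (a, 0) * c)
      = sCoder (t ∘ₗ LinearMap.mulLeft k (sι k E O (a, 0))) c
        + sι k E O (a, 0) * sCoder t c := by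
  simp only [sCoder, LinearMap.comp_apply, comul_even, map_add]
  congr 1
  · simp [TensorProduct.map_map, LinearMap.comp_assoc]
  · generalize comul k E O c = z
    induction z with
    | zero => simp
    | tmul x y => simp [← mul_assoc, sι_even_comm]
    | add x y hx hy => simp only [map_add, mul_add, hx, hy]

/-- The sign is that of moving `b` past `t`. The parity involution that the coproduct puts on the
first factor is absorbed when `b` is commuted to the front (`sι_par_mul_odd`). -/
theorem sCoder_odd_mul {i : ZMod 2} {t : S k E O →ₗ[k] E × O}
    (ht : HasParity (sPar k E O).toLinearMap (par k E O) i t) (b : O) (c : S k E O) :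
    sCoder t (sι k E O (0, b) * c)
      = sCoder (t ∘ₗ LinearMap.mulLeft k (sι k E O (0, b))) c
        + sgn k i • (sι k E O (0, b) * sCoder t c) := by
  have ht' : ∀ x, t (sPar k E O x) = sgn k i • par k E O (t x) := ht
  simp only [sCoder, LinearMap.comp_apply, comul_odd, map_add]
  congr 1
  · simp [TensorProduct.map_map, LinearMap.comp_assoc]
  · generalize comul k E O c = z
    induction z with
    | zero => simp
    | tmul x y => simp [← mul_assoc, ht', sι_par_mul_odd]
    | add x y hx hy => simp only [map_add, mul_add, smul_add, hx, hy]

theorem HasParity.comp_even {i : ZMod 2} {t : S k E O →ₗ[k] E × O}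
    (ht : HasParity (sPar k E O).toLinearMap (par k E O) i t) (a : E) :
    HasParity (sPar k E O).toLinearMap (par k E O) i
      (t ∘ₗ LinearMap.mulLeft k (sι k E O (a, 0))) := by
  intro c
  have := ht (sι k E O (a, 0) * c)
  simpa [sPar_even] using this

theorem HasParity.comp_odd {i : ZMod 2} {t : S k E O →ₗ[k] E × O}
    (ht : HasParity (sPar k E O).toLinearMap (par k E O) i t) (b : O) :
    HasParity (sPar k E O).toLinearMap (par k E O) (i + 1)
      (t ∘ₗ LinearMap.mulLeft k (sι k E O (0, b))) := by
  intro c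
  have := ht (sι k E O (0, b) * c)
  simp [sPar_odd] at this
  simp [sgn_add, sgn_one, ← this]

theorem sCoder_parity {i : ZMod 2} {t : S k E O →ₗ[k] E × O}
    (ht : HasParity (sPar k E O).toLinearMap (par k E O) i t) :
    HasParity (sPar k E O).toLinearMap (sPar k E O).toLinearMap i (sCoder t) := by
  have ht' : ∀ x, t (sPar k E O x) = sgn k i • par k E O (t x) := ht
  intro c
  simp only [sCoder, AlgHom.toLinearMap_apply, LinearMap.comp_apply, comul_sPar]
  generalize comul k E O c = z
  induction z with
  | zero => simp
  | tmul x y => simp [ht', sPar_ι]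
  | add x y hx hy => simp only [map_add, smul_add, hx, hy]

/-- Induction on `c` for all `t` and `i` at once: taking a letter off `c` produces the coderivation
of `t` precomposed with that letter, and an odd letter shifts the parity. -/
theorem sCoder_isCoder {i : ZMod 2} {t : S k E O →ₗ[k] E × O}
    (ht : HasParity (sPar k E O).toLinearMap (par k E O) i t) :
    IsCoder (comul k E O) (sPar k E O).toLinearMap i (sCoder t) := by
  refine ⟨sCoder_parity ht, fun c => ?_⟩
  induction c using S_induction generalizing t i with
  | one =>
    rw [sCoder_one, comul_one]
    have h1 : parPow (sPar k E O).toLinearMap i 1 = 1 := by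
      rcases zmod_two_cases i with rfl | rfl <;> simp [parPow]
    rw [TensorProduct.map_tmul, TensorProduct.map_tmul, h1, sCoder_one]
    obtain ⟨a, b⟩ := t 1
    have h := comul_ι_mul k E O (a, 0) 1
    have h' := comul_ι_mul k E O (0, b) 1
    rw [mul_one, comul_one, comulStep_even, mul_one] at h
    rw [mul_one, comul_one, comulStep_odd, mul_one, map_one] at h'
    rw [split_eq E O (a, b), map_add, map_add, h, h', LinearMap.id_apply, TensorProduct.add_tmul,
      TensorProduct.tmul_add]
    abel
  | add x y hx hy => simp only [map_add, hx ht, hy ht]; abel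
  | smul r x hx => simp only [map_smul, hx ht, smul_add]
  | even a x hx =>
    rw [sCoder_even_mul, map_add, hx (ht.comp_even a), comul_ι_mul, comul_ι_mul, hx ht]
    generalize comul k E O x = z
    induction z with
    | zero => simp
    | tmul x y =>
      rcases zmod_two_cases i with rfl | rfl <;>
      simp [comulStep_even, sCoder_even_mul, parPow, sPar_even, TensorProduct.add_tmul,
        TensorProduct.tmul_add] <;> abel
    | add x y hx hy =>
      simp only [map_add] at hx hy ⊢
      linear_combination (norm := module) hx + hy
  | odd b x hx =>
    have hp : ∀ x, sCoder t (sPar k E O x) = sgn k i • sPar k E O (sCoder t x) := sCoder_parity ht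
    rw [sCoder_odd_mul ht, map_add, hx (ht.comp_odd b), map_smul, comul_ι_mul, comul_ι_mul, hx ht]
    generalize comul k E O x = z
    induction z with
    | zero => simp
    | tmul x y =>
      rcases zmod_two_cases i with rfl | rfl <;>
      simp [comulStep_odd, sCoder_odd_mul ht, hp, parPow, sPar_odd, TensorProduct.add_tmul,
        TensorProduct.tmul_add, sgn_zero, sgn_one, sPar_sPar, zmod_two_one_add_one,
        TensorProduct.neg_tmul, TensorProduct.tmul_neg] <;> abel
    | add x y hx hy =>
      simp only [map_add, smul_add] at hx hy ⊢
      linear_combination (norm := module) hx + hy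

/-- In `∑ t(c₍₁₎) c₍₂₎` only the counit of `c₍₂₎` contributes to weight one. -/
theorem sProj_sCoder (t : S k E O →ₗ[k] E × O) (c : S k E O) :
    sProj k E O (sCoder t c) = t c := by
  rw [← comul_counit t c]
  simp only [sCoder, LinearMap.comp_apply]
  generalize comul k E O c = z
  induction z with
  | zero => simp
  | tmul x y => simp [sProj_ι_mul]
  | add x y hx hy => simp only [map_add, hx, hy]

theorem sCounit_sCoder (t : S k E O →ₗ[k] E × O) (c : S k E O) :
    sCounit k E O (sCoder t c) = 0 := by
  simp only [sCoder, LinearMap.comp_apply]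
  generalize comul k E O c = z
  induction z with
  | zero => simp
  | tmul x y => simp [sCounit, sLift_ι]
  | add x y hx hy => simp only [map_add, hx, hy, add_zero]

/-- Constant vector fields: this exhibits multiplication by an element of `U` as a coderivation,
which drives the Maurer–Cartan computation. -/
theorem sCoder_const (u : E × O) :
    sCoder ((sCounit k E O).toLinearMap.smulRight u) = LinearMap.mulLeft k (sι k E O u) := by
  ext1 c
  have := counit_comul (LinearMap.mulLeft k (sι k E O u)) c
  simp only [LinearMap.mulLeft_apply] at this ⊢
  rw [← this, sCoder, LinearMap.comp_apply, LinearMap.comp_apply]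
  generalize comul k E O c = z
  induction z with
  | zero => simp
  | tmul x y => simp
  | add x y hx hy => simp only [map_add, hx, hy]

/-! ### Weights -/

variable (k E O) in
/-- The `n`-th symmetric power of `E × O`. -/
abbrev weightSpace (n : ℕ) : Submodule k (S k E O) := LinearMap.range (sι k E O) ^ n

theorem one_mem_weightSpace : (1 : S k E O) ∈ weightSpace k E O 0 := by
  simp [weightSpace, Submodule.one_le.mp]

theorem ι_mul_mem_weightSpace {n : ℕ} (u : E × O) {c : S k E O} (hc : c ∈ weightSpace k E O n) :
    sι k E O u * c ∈ weightSpace k E O (n + 1) := by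
  rw [weightSpace, pow_succ']
  exact Submodule.mul_mem_mul ⟨u, rfl⟩ hc

theorem weightSpace_zero {c : S k E O} (hc : c ∈ weightSpace k E O 0) :
    c = algebraMap k _ (sCounit k E O c) := by
  rw [weightSpace, pow_zero, Submodule.mem_one] at hc
  obtain ⟨r, rfl⟩ := hc
  simp

theorem weightSpace_induction {n : ℕ} {P : S k E O → Prop}
    (add : ∀ x y, P x → P y → P (x + y))
    (mul : ∀ u, ∀ x ∈ weightSpace k E O n, P (sι k E O u * x)) {c : S k E O}
    (hc : c ∈ weightSpace k E O (n + 1)) : P c := by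
  rw [weightSpace, pow_succ'] at hc
  refine Submodule.mul_induction_on hc ?_ add
  rintro _ ⟨u, rfl⟩ y hy
  exact mul u y hy

/-- The span of the weight spaces contains `1` and is stable under multiplication by letters. That
the sum is direct is not needed. -/
theorem S_le_of_weightSpace {N : Submodule k (S k E O)} (h : ∀ n, weightSpace k E O n ≤ N)
    (c : S k E O) : c ∈ N := by
  suffices c ∈ ⨆ n, weightSpace k E O n from (iSup_le h) this
  have hmul : ∀ u, ∀ x ∈ ⨆ n, weightSpace k E O n, sι k E O u * x ∈ ⨆ n, weightSpace k E O n := by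
    intro u x hx
    induction hx using Submodule.iSup_induction' with
    | mem i x hx => exact Submodule.mem_iSup_of_mem (i + 1) (ι_mul_mem_weightSpace u hx)
    | zero => simp
    | add x y _ _ hx hy => rw [mul_add]; exact Submodule.add_mem _ hx hy
  induction c using S_induction with
  | one => exact Submodule.mem_iSup_of_mem 0 one_mem_weightSpace
  | add x y hx hy => exact Submodule.add_mem _ hx hy
  | smul r x hx => exact Submodule.smul_mem _ _ hx
  | even a x hx => exact hmul _ _ hx
  | odd b x hx => exact hmul _ _ hx

theorem sProj_weightSpace {n : ℕ} (hn : n ≠ 1) {c : S k E O} (hc : c ∈ weightSpace k E O n) :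
    sProj k E O c = 0 := by
  obtain _ | n := n
  · rw [weightSpace_zero hc, Algebra.algebraMap_eq_smul_one, map_smul, sProj_one, smul_zero]
  · refine weightSpace_induction (P := fun c => sProj k E O c = 0) (fun x y hx hy => by simp [hx, hy])
      (fun u x hx => ?_) hc
    obtain _ | n := n
    · exact absurd rfl hn
    rw [sProj_ι_mul]
    have : sCounit k E O x = 0 :=
      weightSpace_induction (P := fun x => sCounit k E O x = 0)
        (fun x y hx hy => by simp [hx, hy]) (fun u x _ => sCounit_ι_mul u x) hx
    rw [this, zero_smul]

variable (k E O) in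
/-- The subspace of `S U ⊗ S U` of total weight `n`. -/
def totalWeight (n : ℕ) : Submodule k (S k E O ⊗[k] S k E O) :=
  Submodule.span k {z | ∃ i j, i + j = n ∧ ∃ x ∈ weightSpace k E O i, ∃ y ∈ weightSpace k E O j,
    x ⊗ₜ[k] y = z}

theorem sPar_mem_weightSpace {n : ℕ} {c : S k E O} (hc : c ∈ weightSpace k E O n) :
    sPar k E O c ∈ weightSpace k E O n := by
  induction n generalizing c with
  | zero => rw [weightSpace_zero hc, AlgHom.commutes, ← weightSpace_zero hc]; exact hc
  | succ n ih =>
    refine weightSpace_induction (P := fun c => sPar k E O c ∈ weightSpace k E O (n + 1))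
      (fun x y hx hy => ?_) (fun u x hx => ?_) hc
    · rw [map_add]; exact Submodule.add_mem _ hx hy
    · rw [map_mul, sPar_ι]; exact ι_mul_mem_weightSpace _ (ih hx)

theorem comulStep_mem_totalWeight {n : ℕ} (u : E × O) {z : S k E O ⊗[k] S k E O}
    (hz : z ∈ totalWeight k E O n) : comulStep k E O u z ∈ totalWeight k E O (n + 1) := by
  rw [totalWeight] at hz
  induction hz using Submodule.span_induction with
  | mem z h =>
    obtain ⟨i, j, rfl, x, hx, y, hy, rfl⟩ := h
    rw [split_eq E O u, map_add, LinearMap.add_apply, comulStep_even, comulStep_odd]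
    have mem : ∀ i' j', i' + j' = i + j + 1 → ∀ x ∈ weightSpace k E O i',
        ∀ y ∈ weightSpace k E O j', x ⊗ₜ[k] y ∈ totalWeight k E O (i + j + 1) :=
      fun i' j' h x hx y hy => Submodule.subset_span ⟨i', j', h, x, hx, y, hy, rfl⟩
    refine Submodule.add_mem _ (Submodule.add_mem _ ?_ ?_) (Submodule.add_mem _ ?_ ?_)
    · exact mem (i + 1) j (by omega) _ (ι_mul_mem_weightSpace _ hx) _ hy
    · exact mem i (j + 1) (by omega) _ hx _ (ι_mul_mem_weightSpace _ hy)
    · exact mem (i + 1) j (by omega) _ (ι_mul_mem_weightSpace _ hx) _ hy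
    · exact mem i (j + 1) (by omega) _ (sPar_mem_weightSpace hx) _ (ι_mul_mem_weightSpace _ hy)
  | zero => simp
  | add x y _ _ hx hy => rw [map_add]; exact Submodule.add_mem _ hx hy
  | smul r x _ hx => rw [map_smul]; exact Submodule.smul_mem _ _ hx

theorem comul_mem_totalWeight {n : ℕ} {c : S k E O} (hc : c ∈ weightSpace k E O n) :
    comul k E O c ∈ totalWeight k E O n := by
  induction n generalizing c with
  | zero =>
    rw [weightSpace_zero hc, Algebra.algebraMap_eq_smul_one, map_smul, comul_one]
    exact Submodule.smul_mem _ _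
      (Submodule.subset_span ⟨0, 0, rfl, 1, one_mem_weightSpace, 1, one_mem_weightSpace, rfl⟩)
  | succ n ih =>
    refine weightSpace_induction (P := fun c => comul k E O c ∈ totalWeight k E O (n + 1))
      (fun x y hx hy => ?_) (fun u x hx => ?_) hc
    · rw [map_add]; exact Submodule.add_mem _ hx hy
    · rw [comul_ι_mul]; exact comulStep_mem_totalWeight _ (ih hx)

/-- The coproduct preserves total weight, so a map on `S U ⊗ S U` need only be tested on the tensors
`x ⊗ y` whose weights add up to `n`. -/
theorem apply_comul_eq_zero {M : Type*} [AddCommGroup M] [Module k M] {n : ℕ}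
    (f : S k E O ⊗[k] S k E O →ₗ[k] M)
    (hf : ∀ i j, i + j = n → ∀ x ∈ weightSpace k E O i, ∀ y ∈ weightSpace k E O j, f (x ⊗ₜ y) = 0)
    {c : S k E O} (hc : c ∈ weightSpace k E O n) : f (comul k E O c) = 0 := by
  have : totalWeight k E O n ≤ LinearMap.ker f := Submodule.span_le.mpr (by
    rintro _ ⟨i, j, hij, x, hx, y, hy, rfl⟩
    exact hf i j hij x hx y hy)
  exact this (comul_mem_totalWeight hc)

/-- The coderivation cogenerated by the projection multiplies by the weight. -/
theorem sCoder_sProj {n : ℕ} {c : S k E O} (hc : c ∈ weightSpace k E O n) :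
    sCoder (sProj k E O) c = (n : k) • c := by
  have hp : HasParity (sPar k E O).toLinearMap (par k E O) 0 (sProj k E O) := fun c => by
    simp [sProj_sPar, sgn_zero]
  have hcomp : ∀ u, sProj k E O ∘ₗ LinearMap.mulLeft k (sι k E O u)
      = (sCounit k E O).toLinearMap.smulRight u := fun u => by
    ext1 c; simp [sProj_ι_mul]
  induction n generalizing c with
  | zero =>
    rw [weightSpace_zero hc, Algebra.algebraMap_eq_smul_one, map_smul, sCoder_one, sProj_one]
    simp
  | succ n ih =>
    refine weightSpace_induction (P := fun c => sCoder (sProj k E O) c = ((n + 1 : ℕ) : k) • c)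
      (fun x y hx hy => by simp only [map_add, smul_add, hx, hy]) (fun u x hx => ?_) hc
    have h : sι k E O u = sι k E O (u.1, 0) + sι k E O (0, u.2) := by
      rw [← map_add, ← split_eq]
    rw [h, add_mul, map_add, sCoder_even_mul, sCoder_odd_mul hp, hcomp, hcomp, sCoder_const,
      sCoder_const, ih hx]
    simp only [LinearMap.mulLeft_apply, sgn_zero, one_smul, Nat.cast_succ, add_smul, smul_add,
      mul_smul_comm]
    abel

/-- The Euler operator has eigenvalue `n` on weight `n`, nonzero for positive `n` in characteristic
zero. By independence of eigenspaces its kernel is the weight zero part, and the counit detects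
that. -/
theorem eq_zero_of_sCoder_sProj [CharZero k] {c : S k E O} (h : sCoder (sProj k E O) c = 0)
    (hε : sCounit k E O c = 0) : c = 0 := by
  set N := sCoder (sProj k E O)
  have hc : c ∈ weightSpace k E O 0 ⊔ ⨆ μ : k, ⨆ _ : μ ≠ 0, N.eigenspace μ := by
    refine S_le_of_weightSpace (fun n => ?_) c
    obtain _ | n := n
    · exact le_sup_left
    · refine le_sup_of_le_right (fun x hx => ?_)
      refine Submodule.mem_iSup_of_mem ((n + 1 : ℕ) : k) (Submodule.mem_iSup_of_mem ?_ ?_)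
      · exact Nat.cast_ne_zero.mpr n.succ_ne_zero
      · exact Module.End.mem_eigenspace_iff.mpr (sCoder_sProj hx)
  obtain ⟨a, ha, b, hb, rfl⟩ := Submodule.mem_sup.mp hc
  have hb0 : b ∈ N.eigenspace 0 := by
    rw [Module.End.mem_eigenspace_iff, zero_smul]
    rw [map_add, sCoder_sProj ha] at h
    simpa using h
  have hb' : b = 0 := by
    have := (Module.End.eigenspaces_iSupIndep N 0).le_bot ⟨hb0, hb⟩
    simpa using this
  subst hb'
  rw [add_zero] at hε ⊢
  rw [weightSpace_zero ha, hε, map_zero]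

theorem sProj_coder {i : ZMod 2} {X : Module.End k (S k E O)}
    (hX : IsCoder (comul k E O) (sPar k E O).toLinearMap i X) (c : S k E O) :
    sCoder (sProj k E O) (X c) = sCoder (sProj k E O ∘ₗ X) c
      + LinearMap.mul' k _ (TensorProduct.map
          (sι k E O ∘ₗ sProj k E O ∘ₗ parPow (sPar k E O).toLinearMap i) X (comul k E O c)) := by
  rw [sCoder, LinearMap.comp_apply, LinearMap.comp_apply, hX.coleibniz, map_add, map_add,
    TensorProduct.map_map, TensorProduct.map_map]
  rfl

/-- Applying the counit to both factors of the co-Leibniz rule gives `ε X = ε X + ε X`. -/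
theorem sCounit_coder {i : ZMod 2} {X : Module.End k (S k E O)}
    (hX : IsCoder (comul k E O) (sPar k E O).toLinearMap i X) (c : S k E O) :
    sCounit k E O (X c) = 0 := by
  have h := counit_comul (sCounit k E O).toLinearMap (X c)
  rw [hX.coleibniz, map_add, map_add, TensorProduct.map_map, TensorProduct.map_map] at h
  have h1 := comul_counit ((sCounit k E O).toLinearMap ∘ₗ X) c
  have h2 := counit_comul ((sCounit k E O).toLinearMap ∘ₗ X) c
  have h3 : (sCounit k E O).toLinearMap ∘ₗ parPow (sPar k E O).toLinearMap i
      = (sCounit k E O).toLinearMap := by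
    ext c
    rcases zmod_two_cases i with rfl | rfl <;> simp [parPow, sCounit_sPar]
  rw [h3, h2] at h
  have h4 : ∀ z : k ⊗[k] k, TensorProduct.lid k k z = TensorProduct.rid k k z := by
    intro z; induction z with
    | zero => simp
    | tmul x y => simp [mul_comm]
    | add x y hx hy => simp [hx, hy]
  rw [h4] at h
  rw [LinearMap.comp_id, h1] at h
  simpa using h

/-- A coderivation is determined by its corestriction. -/
theorem coder_eq_zero [CharZero k] {i : ZMod 2} {X : Module.End k (S k E O)}
    (hX : IsCoder (comul k E O) (sPar k E O).toLinearMap i X)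
    (h : ∀ c, sProj k E O (X c) = 0) : X = 0 := by
  have hpX : sProj k E O ∘ₗ X = 0 := LinearMap.ext h
  -- The Euler operator applied to `X c` reads one letter off the first factor. As `p X = 0`, that
  -- letter must come from `c` itself, so `X` is only evaluated on an element of smaller weight.
  have key : ∀ n, ∀ c ∈ weightSpace k E O n, X c = 0 := by
    intro n
    induction n using Nat.strong_induction_on with
    | _ n ih =>
      intro c hc
      refine eq_zero_of_sCoder_sProj ?_ (sCounit_coder hX c)
      rw [sProj_coder hX, hpX]
      have h0 : sCoder (0 : S k E O →ₗ[k] E × O) = 0 := by simp [sCoder]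
      rw [h0, LinearMap.zero_apply, zero_add, ← LinearMap.comp_apply]
      refine apply_comul_eq_zero _ (fun a b hab x hx y hy => ?_) hc
      have hx' : parPow (sPar k E O).toLinearMap i x ∈ weightSpace k E O a := by
        rcases zmod_two_cases i with rfl | rfl
        · simpa [parPow] using hx
        · simpa [parPow] using sPar_mem_weightSpace hx
      simp only [LinearMap.comp_apply, TensorProduct.map_tmul, LinearMap.mul'_apply]
      rcases eq_or_ne a 1 with rfl | ha
      · rw [ih b (by omega) y hy, mul_zero]
      · rw [sProj_weightSpace ha hx', map_zero, zero_mul]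
  ext1 c
  exact S_le_of_weightSpace (N := LinearMap.ker X) (fun n c hc => key n c hc) c

end SymmetricCoder

/-! ### The map of coalgebras with given component -/

section Exponential

variable {k E O E' O' : Type*} [Field k] [AddCommGroup E] [Module k E] [AddCommGroup O]
  [Module k O] [AddCommGroup E'] [Module k E'] [AddCommGroup O'] [Module k O']

/-- The convolution product `c ↦ ∑ f(c₍₁₎) g(c₍₂₎)`. -/
def convolution (f g : S k E O →ₗ[k] S k E' O') : S k E O →ₗ[k] S k E' O' :=
  LinearMap.mul' k _ ∘ₗ TensorProduct.map f g ∘ₗ comul k E O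

/-- The convolution exponential `∑ₙ χⁿ / n!`, by weights. -/
def expMap (χ : S k E O →ₗ[k] E' × O') : ℕ → S k E O →ₗ[k] S k E' O'
  | 0 => (sCounit k E O).toLinearMap.smulRight 1
  | n + 1 => ((n : k) + 1)⁻¹ • convolution (sι k E' O' ∘ₗ χ) (expMap χ n)

theorem convolution_expMap [CharZero k] (χ : S k E O →ₗ[k] E' × O') (n : ℕ) :
    convolution (sι k E' O' ∘ₗ χ) (expMap χ n) = ((n : k) + 1) • expMap χ (n + 1) := by
  rw [expMap, smul_smul, mul_inv_cancel₀ (Nat.cast_add_one_ne_zero n), one_smul]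

theorem expMap_one (χ : S k E O →ₗ[k] E' × O') : expMap χ 1 = sι k E' O' ∘ₗ χ := by
  ext1 c
  have h := comul_counit (sι k E' O' ∘ₗ χ) c
  rw [← h]
  simp only [expMap, convolution, Nat.cast_zero, zero_add, inv_one, one_smul, LinearMap.comp_apply]
  generalize comul k E O c = z
  induction z with
  | zero => simp
  | tmul x y => simp
  | add x y hx hy => simp only [map_add, hx, hy]

theorem expMap_mem_weightSpace (χ : S k E O →ₗ[k] E' × O') (n : ℕ) (c : S k E O) :
    expMap χ n c ∈ weightSpace k E' O' n := by
  induction n generalizing c with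
  | zero => exact Submodule.smul_mem _ _ one_mem_weightSpace
  | succ n ih =>
    refine Submodule.smul_mem _ _ ?_
    simp only [convolution, LinearMap.comp_apply]
    generalize comul k E O c = z
    induction z with
    | zero => simp
    | tmul x y => exact ι_mul_mem_weightSpace _ (ih y)
    | add x y hx hy => rw [map_add, map_add]; exact Submodule.add_mem _ hx hy

theorem expMap_sPar {χ : S k E O →ₗ[k] E' × O'}
    (hχ : ∀ c, χ (sPar k E O c) = par k E' O' (χ c)) (n : ℕ) (c : S k E O) :
    expMap χ n (sPar k E O c) = sPar k E' O' (expMap χ n c) := by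
  induction n generalizing c with
  | zero => simp [expMap, sCounit_sPar]
  | succ n ih =>
    simp only [expMap, convolution, LinearMap.smul_apply, LinearMap.comp_apply, comul_sPar,
      map_smul]
    congr 1
    generalize comul k E O c = z
    induction z with
    | zero => simp
    | tmul x y => simp [hχ, ih, sPar_ι]
    | add x y hx hy => simp only [map_add, hx, hy]

theorem comulStep_tmul (u : E × O) (x y : S k E O) :
    comulStep k E O u (x ⊗ₜ y) = (sι k E O u * x) ⊗ₜ y
      + x ⊗ₜ (sι k E O (evenPart k E O u) * y)
      + sPar k E O x ⊗ₜ (sι k E O (oddPart k E O u) * y) := by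
  simp [comulStep]

theorem evenPart_eq_evProj [CharZero k] (u : E × O) : evenPart k E O u = evProj (par k E O) u := by
  have h : par k E O (0, u.2) = -(0, u.2) := by simp [par]
  conv_rhs => rw [split_eq E O u, map_add, evProj_of_odd h, evProj_of_even (by simp [par])]
  simp [evenPart]

theorem oddPart_eq_odProj [CharZero k] (u : E × O) : oddPart k E O u = odProj (par k E O) u := by
  have h : par k E O (0, u.2) = -(0, u.2) := by simp [par]
  conv_rhs => rw [split_eq E O u, map_add, odProj_of_odd h, odProj_of_even (by simp [par])]
  simp [oddPart]

/-- The exponential of a primitive element is group-like, in convolution form. Coassociativity and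
graded cocommutativity of `S U` regroup the arguments of `χ` on the two sides of the coproduct. -/
theorem comul_expMap [CharZero k] {χ : S k E O →ₗ[k] E' × O'}
    (hχ : ∀ c, χ (sPar k E O c) = par k E' O' (χ c)) (n : ℕ) (c : S k E O) :
    comul k E' O' (expMap χ n c) = ∑ p ∈ Finset.HasAntidiagonal.antidiagonal n,
      TensorProduct.map (expMap χ p.1) (expMap χ p.2) (comul k E O c) := by
  induction n generalizing c with
  | zero =>
    have h0 : expMap χ 0 c = sCounit k E O c • 1 := rfl
    have h := counit_comul (sCounit k E O).toLinearMap c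
    rw [Finset.Nat.antidiagonal_zero, Finset.sum_singleton, h0, map_smul, comul_one,
      ← AlgHom.toLinearMap_apply, ← h]
    generalize comul k E O c = z
    induction z with
    | zero => simp
    | tmul x y =>
      simp [expMap, TensorProduct.smul_tmul', TensorProduct.tmul_smul, smul_smul, mul_comm]
    | add x y hx hy => simp only [map_add, add_smul, hx, hy]
  | succ n ih =>
    set F := expMap χ with hF
    let A : S k E O →ₗ[k] S k E' O' := sι k E' O' ∘ₗ χ
    -- `A1` puts the new letter `χ(c₍₁₎)` in the first factor, `A2` in the second. For `A2` the
    -- argument `c₍₁₎` must be moved past `c₍₂₎`, which is the braiding.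
    let A1 (p : ℕ × ℕ) : S k E O ⊗[k] (S k E O ⊗[k] S k E O) →ₗ[k] S k E' O' ⊗[k] S k E' O' :=
      TensorProduct.map (LinearMap.mul' k _ ∘ₗ TensorProduct.map A (F p.1)) (F p.2)
        ∘ₗ (TensorProduct.assoc k _ _ _).symm.toLinearMap
    let A2 (p : ℕ × ℕ) : S k E O ⊗[k] (S k E O ⊗[k] S k E O) →ₗ[k] S k E' O' ⊗[k] S k E' O' :=
      TensorProduct.map (F p.1) (LinearMap.mul' k _ ∘ₗ TensorProduct.map A (F p.2))
        ∘ₗ (TensorProduct.assoc k _ _ _).toLinearMap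
        ∘ₗ TensorProduct.map (braid (sPar k E O).toLinearMap) LinearMap.id
        ∘ₗ (TensorProduct.assoc k _ _ _).symm.toLinearMap
    have step : ∀ z : S k E O ⊗[k] S k E O,
        comul k E' O' (LinearMap.mul' k _ (TensorProduct.map A (F n) z))
          = ∑ p ∈ Finset.HasAntidiagonal.antidiagonal n,
            (A1 p (TensorProduct.map LinearMap.id (comul k E O) z)
              + A2 p (TensorProduct.map LinearMap.id (comul k E O) z)) := by
      intro z
      induction z with
      | zero => simp
      | add x y hx hy =>
        simp only [map_add, hx, hy, ← Finset.sum_add_distrib]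
        exact Finset.sum_congr rfl fun p _ => by abel
      | tmul x y =>
        rw [TensorProduct.map_tmul, LinearMap.mul'_apply, LinearMap.comp_apply, comul_ι_mul, ih,
          map_sum, TensorProduct.map_tmul]
        refine Finset.sum_congr rfl fun p _ => ?_
        generalize comul k E O y = w
        induction w with
        | zero => simp
        | add x y hx hy =>
          simp only [map_add, TensorProduct.tmul_add, hx, hy]; abel
        | tmul y z =>
          have he : χ (evProj (sPar k E O).toLinearMap x) = evenPart k E' O' (χ x) := by
            rw [evenPart_eq_evProj]; simp [evProj_apply, hχ]
          have ho : χ (odProj (sPar k E O).toLinearMap x) = oddPart k E' O' (χ x) := by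
            rw [oddPart_eq_odProj]; simp [odProj_apply, hχ]
          simp [A, A1, A2, braid_tmul, comulStep_tmul, he, ho, TensorProduct.add_tmul, hF,
            expMap_sPar hχ, add_assoc]
    have hA1 : ∀ p : ℕ × ℕ, A1 p (TensorProduct.map LinearMap.id (comul k E O) (comul k E O c))
        = ((p.1 : k) + 1) • TensorProduct.map (F (p.1 + 1)) (F p.2) (comul k E O c) := by
      intro p
      rw [← comul_coassoc, ← LinearMap.smul_apply, ← TensorProduct.map_smul_left,
        ← convolution_expMap]
      simp only [A1, LinearMap.comp_apply, LinearEquiv.coe_coe, LinearEquiv.symm_apply_apply,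
        TensorProduct.map_map, LinearMap.comp_assoc, LinearMap.comp_id]
      rfl
    have hA2 : ∀ p : ℕ × ℕ, A2 p (TensorProduct.map LinearMap.id (comul k E O) (comul k E O c))
        = ((p.2 : k) + 1) • TensorProduct.map (F p.1) (F (p.2 + 1)) (comul k E O c) := by
      intro p
      have hb : braid (sPar k E O).toLinearMap ∘ₗ comul k E O = comul k E O :=
        LinearMap.ext braid_comul
      rw [← comul_coassoc, ← LinearMap.smul_apply, ← TensorProduct.map_smul_right,
        ← convolution_expMap]
      simp only [A2, LinearMap.comp_apply, LinearEquiv.coe_coe, LinearEquiv.symm_apply_apply,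
        TensorProduct.map_map, LinearMap.comp_id, hb]
      rw [comul_coassoc, TensorProduct.map_map, LinearMap.comp_assoc, LinearMap.comp_id]
      rfl
    -- On the antidiagonal `n + 1 = p.1 + p.2`. The share `p.1` is supplied by `A1` and the share
    -- `p.2` by `A2`; the terms missing from each sum have coefficient zero.
    have main : ((n : k) + 1) • comul k E' O' (F (n + 1) c)
        = ((n : k) + 1) • ∑ p ∈ Finset.HasAntidiagonal.antidiagonal (n + 1),
          TensorProduct.map (F p.1) (F p.2) (comul k E O c) := by
      have h1 : ((n : k) + 1) • comul k E' O' (F (n + 1) c)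
          = comul k E' O' (convolution A (F n) c) := by
        rw [convolution_expMap, LinearMap.smul_apply, map_smul]
      have h2 : ∀ p ∈ Finset.HasAntidiagonal.antidiagonal (n + 1),
          ((n : k) + 1) • TensorProduct.map (F p.1) (F p.2) (comul k E O c)
            = (p.1 : k) • TensorProduct.map (F p.1) (F p.2) (comul k E O c)
              + (p.2 : k) • TensorProduct.map (F p.1) (F p.2) (comul k E O c) := by
        intro p hp
        rw [← add_smul, ← Nat.cast_add, Finset.HasAntidiagonal.mem_antidiagonal.mp hp, Nat.cast_succ]
      rw [h1, convolution, LinearMap.comp_apply, LinearMap.comp_apply, step, Finset.smul_sum,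
        Finset.sum_congr rfl h2, Finset.sum_add_distrib, Finset.sum_add_distrib,
        Finset.Nat.sum_antidiagonal_succ, Finset.Nat.sum_antidiagonal_succ']
      simp only [hA1, hA2, Nat.cast_zero, zero_smul, zero_add, Nat.cast_succ]
    exact smul_right_injective _ (Nat.cast_add_one_ne_zero n) main

theorem expMap_isCoalgMap [CharZero k] {χ : S k E O →ₗ[k] E' × O'}
    (hχ : ∀ c, χ (sPar k E O c) = par k E' O' (χ c)) : IsCoalgMap (expMap χ) where
  weight := expMap_mem_weightSpace χ
  even := expMap_sPar hχ
  counit c := by simp [expMap]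
  comul := comul_expMap hχ

theorem sProj_expMap_one (χ : S k E O →ₗ[k] E' × O') : sProj k E' O' ∘ₗ expMap χ 1 = χ := by
  ext1 c
  simp [expMap_one, sProj_ι]

/-- A map of coalgebras is the exponential of its component. -/
theorem IsCoalgMap.eq_expMap [CharZero k] {G : ℕ → S k E O →ₗ[k] S k E' O'} (hG : IsCoalgMap G) :
    G = expMap (sProj k E' O' ∘ₗ G 1) := by
  funext n
  induction n with
  | zero =>
    ext1 c
    rw [weightSpace_zero (hG.weight 0 c), hG.counit, Algebra.algebraMap_eq_smul_one]
    rfl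
  | succ n ih =>
    ext1 c
    refine smul_right_injective _ (Nat.cast_add_one_ne_zero (R := k) n) ?_
    dsimp only
    -- The Euler operator computes `(n + 1) G (n + 1) c` from the coproduct. Only the term with
    -- first factor of weight one survives, and that is the recursion of the exponential.
    rw [← LinearMap.smul_apply _ (expMap _ _), ← convolution_expMap, ← ih, ← Nat.cast_succ,
      ← sCoder_sProj (hG.weight (n + 1) c), sCoder, LinearMap.comp_apply, LinearMap.comp_apply,
      hG.comul, map_sum, Finset.sum_eq_single (1, n), TensorProduct.map_map]
    · rfl
    · intro p hp hne
      rw [TensorProduct.map_map]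
      have h0 : sProj k E' O' ∘ₗ G p.1 = 0 := by
        ext1 c
        refine sProj_weightSpace (fun h => hne ?_) (hG.weight _ c)
        have := Finset.HasAntidiagonal.mem_antidiagonal.mp hp
        ext
        · exact h
        · simp; omega
      rw [LinearMap.comp_assoc, h0, LinearMap.comp_zero, TensorProduct.map_zero_left,
        LinearMap.zero_apply]
    · intro h
      exact absurd (Finset.HasAntidiagonal.mem_antidiagonal.mpr (by simp only; omega)) h

/-- A derivation along a map of coalgebras with vanishing component is zero. -/
theorem derivation_eq_zero [CharZero k] {F G : ℕ → S k E O →ₗ[k] S k E' O'}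
    (hF : IsCoalgMap F) (hw : ∀ n c, G n c ∈ weightSpace k E' O' n) (h0 : G 0 = 0)
    (h1 : ∀ c, sProj k E' O' (G 1 c) = 0)
    (hG : ∀ n c, comul k E' O' (G n c) = ∑ p ∈ Finset.HasAntidiagonal.antidiagonal n,
      (TensorProduct.map (G p.1) (F p.2) (comul k E O c)
        + TensorProduct.map ((sPar k E' O').toLinearMap ∘ₗ F p.1) (G p.2) (comul k E O c)))
    (n : ℕ) : G n = 0 := by
  induction n with
  | zero => exact h0
  | succ n ih =>
    ext1 c
    refine smul_right_injective _ (Nat.cast_ne_zero (R := k).mpr n.succ_ne_zero) ?_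
    dsimp only
    -- Again through the Euler operator: a surviving term has first factor of weight one, so it
    -- involves either the component of `G 1` or `G n`, both zero.
    rw [← sCoder_sProj (hw (n + 1) c), sCoder, LinearMap.comp_apply, LinearMap.comp_apply, hG,
      map_sum, LinearMap.zero_apply, smul_zero, map_sum]
    refine Finset.sum_eq_zero fun p hp => ?_
    rw [map_add, TensorProduct.map_map, TensorProduct.map_map]
    have hG0 : (sι k E' O' ∘ₗ sProj k E' O') ∘ₗ G p.1 = 0 := by
      ext1 c
      rcases eq_or_ne p.1 1 with h | h
      · simp [h, h1]
      · simp [sProj_weightSpace h (hw _ c)]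
    rw [hG0, TensorProduct.map_zero_left, LinearMap.zero_apply, zero_add]
    rcases eq_or_ne p.1 1 with h | h
    · have : p.2 = n := by have := Finset.HasAntidiagonal.mem_antidiagonal.mp hp; omega
      rw [this, ih, LinearMap.comp_zero, TensorProduct.map_zero_right, LinearMap.zero_apply,
        map_zero]
    · have : (sι k E' O' ∘ₗ sProj k E' O') ∘ₗ (sPar k E' O').toLinearMap ∘ₗ F p.1 = 0 := by
        ext1 c
        simp [sProj_weightSpace h (sPar_mem_weightSpace (hF.weight _ c))]
      rw [this, TensorProduct.map_zero_left, LinearMap.zero_apply, map_zero]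

/-- The coderivation cogenerated by a map supported in weight two lowers the weight by one. -/
theorem sCoder_mem_weightSpace {q : S k E O →ₗ[k] E × O}
    (hq : ∀ n ≠ 2, ∀ c ∈ weightSpace k E O n, q c = 0) {n : ℕ} {c : S k E O}
    (hc : c ∈ weightSpace k E O (n + 1)) : sCoder q c ∈ weightSpace k E O n := by
  rw [← Submodule.Quotient.mk_eq_zero, ← Submodule.mkQ_apply, sCoder, LinearMap.comp_apply,
    ← LinearMap.comp_apply (Submodule.mkQ _), ← LinearMap.comp_apply, LinearMap.comp_apply]
  change ((Submodule.mkQ (weightSpace k E O n)) ∘ₗ (LinearMap.mul' k (S k E O)) ∘ₗ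
    (TensorProduct.map (sι k E O ∘ₗ q) LinearMap.id)) (comul k E O c) = 0
  refine apply_comul_eq_zero _ (fun i j hij x hx y hy => ?_) hc
  simp only [LinearMap.comp_apply, TensorProduct.map_tmul, LinearMap.mul'_apply,
    LinearMap.id_apply, Submodule.mkQ_apply, Submodule.Quotient.mk_eq_zero]
  rcases eq_or_ne i 2 with rfl | hi
  · obtain rfl : n = j + 1 := by omega
    exact ι_mul_mem_weightSpace _ hy
  · rw [hq i hi x hx, map_zero, zero_mul]; exact Submodule.zero_mem _

end Exponential

/-! ### The Chevalley–Eilenberg complex of a graded Lie algebra -/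

section SquareZero

variable {k C : Type*} [Field k] [AddCommGroup C] [Module k C]

/-- The two mixed terms of the squared co-Leibniz rule cancel because `X` anticommutes with `γ`. -/
theorem IsCoder.sq {Δ : C →ₗ[k] C ⊗[k] C} {γ : C →ₗ[k] C} (hγ : ∀ c, γ (γ c) = c)
    {X : Module.End k C} (hX : IsCoder Δ γ 1 X) : IsCoder Δ γ 0 (X * X) where
  parity c := by
    have h : ∀ c, X (γ c) = sgn k 1 • γ (X c) := hX.parity
    simp [h, sgn_one, sgn_zero]
  coleibniz c := by
    have h : ∀ c, X (γ c) = sgn k 1 • γ (X c) := hX.parity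
    rw [Module.End.mul_apply, hX.coleibniz, hX.coleibniz]
    generalize Δ c = z
    induction z with
    | zero => simp
    | tmul x y =>
      simp [parPow, h, hγ, sgn_one, TensorProduct.neg_tmul]
    | add x y hx hy =>
      simp only [map_add] at hx hy ⊢
      linear_combination (norm := module) hx + hy

end SquareZero

section TensorSub

variable {k M N P Q : Type*} [Field k] [AddCommGroup M] [Module k M] [AddCommGroup N] [Module k N]
  [AddCommGroup P] [Module k P] [AddCommGroup Q] [Module k Q]

theorem map_sub_left (f f' : M →ₗ[k] P) (g : N →ₗ[k] Q) :
    TensorProduct.map (f - f') g = TensorProduct.map f g - TensorProduct.map f' g := by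
  rw [eq_sub_iff_add_eq, ← TensorProduct.map_add_left, sub_add_cancel]

theorem map_sub_right (f : M →ₗ[k] P) (g g' : N →ₗ[k] Q) :
    TensorProduct.map f (g - g') = TensorProduct.map f g - TensorProduct.map f g' := by
  rw [eq_sub_iff_add_eq, ← TensorProduct.map_add_right, sub_add_cancel]

end TensorSub

section LieAlgebra

variable {k A : Type*} [Field k] [Ring A] [Algebra k A] {K₀ K₁ : Submodule k A}

/-- The corestriction of the Chevalley–Eilenberg differential. -/
def ceQuadratic (h : IsLieSubalgebra K₀ K₁) : S k K₁ K₀ →ₗ[k] (K₁ × K₀) :=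
  (2⁻¹ : k) • (TensorProduct.lift (ceBracket h) ∘ₗ
    TensorProduct.map (sProj k K₁ K₀) (sProj k K₁ K₀) ∘ₗ comul k K₁ K₀)

theorem ceDiff_eq (h : IsLieSubalgebra K₀ K₁) : ceDiff h = sCoder (ceQuadratic h) := rfl

theorem ceBracket_fst (h : IsLieSubalgebra K₀ K₁) (x y : K₁ × K₀) :
    ((ceBracket h x y).1 : A)
      = ((x.1 : A) * y.2 - y.2 * x.1) - (x.2 * y.1 - y.1 * x.2) := rfl

theorem ceBracket_snd (h : IsLieSubalgebra K₀ K₁) (x y : K₁ × K₀) :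
    ((ceBracket h x y).2 : A)
      = ((x.1 : A) * y.1 + y.1 * x.1) - (x.2 * y.2 - y.2 * x.2) := rfl

theorem ceBracket_par (h : IsLieSubalgebra K₀ K₁) (x y : K₁ × K₀) :
    ceBracket h (par k K₁ K₀ x) (par k K₁ K₀ y) = -par k K₁ K₀ (ceBracket h x y) := by
  obtain ⟨x1, x0⟩ := x
  obtain ⟨y1, y0⟩ := y
  ext <;> simp [ceBracket_fst, ceBracket_snd, par_apply]
  abel

/-- Graded symmetry of the shifted bracket, with `x` split by parity exactly as in `comul_ι_mul_ι`.
-/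
theorem ceBracket_symm (h : IsLieSubalgebra K₀ K₁) (x y : K₁ × K₀) :
    ceBracket h y (evenPart k K₁ K₀ x) + ceBracket h (par k K₁ K₀ y) (oddPart k K₁ K₀ x)
      = ceBracket h x y := by
  obtain ⟨x1, x0⟩ := x
  obtain ⟨y1, y0⟩ := y
  ext <;> simp [ceBracket_fst, ceBracket_snd, par_mk, evenPart, oddPart] <;> abel

/-- The Jacobi identity in the arrangement in which the squared differential of a product `x y z`
produces it. It holds by expanding the commutators in the associative algebra. -/
theorem ceBracket_jacobi (h : IsLieSubalgebra K₀ K₁) (x y z : K₁ × K₀) :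
    ceBracket h (ceBracket h x z) (evenPart k K₁ K₀ y)
      + ceBracket h (ceBracket h x (par k K₁ K₀ z)) (oddPart k K₁ K₀ y)
      + ceBracket h (ceBracket h x y) z + ceBracket h (par k K₁ K₀ x) (ceBracket h y z) = 0 := by
  obtain ⟨x1, x0⟩ := x
  obtain ⟨y1, y0⟩ := y
  obtain ⟨z1, z0⟩ := z
  ext <;> simp [ceBracket_fst, ceBracket_snd, par_mk, evenPart, oddPart] <;> noncomm_ring

theorem comul_ι (u : K₁ × K₀) : comul k K₁ K₀ (sι k K₁ K₀ u)
    = sι k K₁ K₀ u ⊗ₜ 1 + 1 ⊗ₜ sι k K₁ K₀ u := by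
  have h := comul_ι_mul k K₁ K₀ u 1
  have h' : sι k K₁ K₀ (evenPart k K₁ K₀ u) + sι k K₁ K₀ (oddPart k K₁ K₀ u)
      = sι k K₁ K₀ u := by
    rw [← map_add]; simp [evenPart, oddPart]
  rw [mul_one, comul_one, comulStep_tmul, mul_one, mul_one, mul_one, map_one, add_assoc,
    ← TensorProduct.tmul_add, h'] at h
  exact h

theorem comul_ι_mul_ι (u v : K₁ × K₀) : comul k K₁ K₀ (sι k K₁ K₀ u * sι k K₁ K₀ v)
    = (sι k K₁ K₀ u * sι k K₁ K₀ v) ⊗ₜ 1 + 1 ⊗ₜ (sι k K₁ K₀ u * sι k K₁ K₀ v)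
      + sι k K₁ K₀ u ⊗ₜ sι k K₁ K₀ v + sι k K₁ K₀ v ⊗ₜ sι k K₁ K₀ (evenPart k K₁ K₀ u)
      + sι k K₁ K₀ (par k K₁ K₀ v) ⊗ₜ sι k K₁ K₀ (oddPart k K₁ K₀ u) := by
  have h : (1 : S k K₁ K₀) ⊗ₜ[k] (sι k K₁ K₀ (evenPart k K₁ K₀ u) * sι k K₁ K₀ v)
        + 1 ⊗ₜ[k] (sι k K₁ K₀ (oddPart k K₁ K₀ u) * sι k K₁ K₀ v)
      = 1 ⊗ₜ[k] (sι k K₁ K₀ u * sι k K₁ K₀ v) := by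
    rw [← TensorProduct.tmul_add, ← add_mul, ← map_add]; simp [evenPart, oddPart]
  rw [comul_ι_mul, comul_ι, map_add, comulStep_tmul, comulStep_tmul, sPar_ι, ← h, mul_one, mul_one,
    mul_one, map_one]
  abel

/-- The coproduct of `x y` contributes the pair in both orders, with equal values by
`ceBracket_symm`. This is why `ceDiff` carries the factor `2⁻¹`. -/
theorem ceQuadratic_ι_mul_ι [CharZero k] (h : IsLieSubalgebra K₀ K₁) (x y : K₁ × K₀) :
    ceQuadratic h (sι k K₁ K₀ x * sι k K₁ K₀ y) = ceBracket h x y := by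
  have h0 : sProj k K₁ K₀ (sι k K₁ K₀ x * sι k K₁ K₀ y) = 0 := by
    rw [sProj_ι_mul]
    simpa using congrArg (· • x) (sCounit_ι_mul y (1 : S k K₁ K₀))
  simp only [ceQuadratic, LinearMap.smul_apply, LinearMap.comp_apply, comul_ι_mul_ι, map_add,
    TensorProduct.map_tmul, TensorProduct.lift.tmul, sProj_ι, sProj_one, map_zero, h0]
  rw [add_assoc, ceBracket_symm, zero_add, zero_add, ← two_smul k, smul_smul,
    inv_mul_cancel₀ two_ne_zero, one_smul]

theorem ceQuadratic_weightSpace (h : IsLieSubalgebra K₀ K₁) {n : ℕ} (hn : n ≠ 2)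
    {c : S k K₁ K₀} (hc : c ∈ weightSpace k K₁ K₀ n) : ceQuadratic h c = 0 := by
  rw [ceQuadratic, LinearMap.smul_apply, ← LinearMap.comp_assoc, LinearMap.comp_apply]
  rw [apply_comul_eq_zero _ (fun i j hij x hx y hy => ?_) hc, smul_zero]
  rw [LinearMap.comp_apply, TensorProduct.map_tmul, TensorProduct.lift.tmul]
  rcases eq_or_ne i 1 with rfl | hi
  · rw [sProj_weightSpace (by omega) hy, map_zero]
  · rw [sProj_weightSpace hi hx, map_zero, LinearMap.zero_apply]

theorem ceQuadratic_parity (h : IsLieSubalgebra K₀ K₁) :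
    HasParity (sPar k K₁ K₀).toLinearMap (par k K₁ K₀) 1 (ceQuadratic h) := by
  intro c
  simp only [ceQuadratic, AlgHom.toLinearMap_apply, LinearMap.smul_apply, LinearMap.comp_apply,
    comul_sPar, map_smul]
  rw [smul_comm]
  congr 1
  generalize comul k K₁ K₀ c = z
  induction z with
  | zero => simp
  | tmul x y => simp [sProj_sPar, ceBracket_par, sgn_one]
  | add x y hx hy => simp only [map_add, smul_add, hx, hy]

theorem ceDiff_isCoder (h : IsLieSubalgebra K₀ K₁) :
    IsCoder (comul k K₁ K₀) (sPar k K₁ K₀).toLinearMap 1 (ceDiff h) :=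
  sCoder_isCoder (ceQuadratic_parity h)

theorem ceQuadratic_one (h : IsLieSubalgebra K₀ K₁) : ceQuadratic h 1 = 0 :=
  ceQuadratic_weightSpace h (by decide) one_mem_weightSpace

theorem ceQuadratic_ι (h : IsLieSubalgebra K₀ K₁) (u : K₁ × K₀) :
    ceQuadratic h (sι k K₁ K₀ u) = 0 := by
  exact ceQuadratic_weightSpace h (n := 1) (by decide) (by simp)

theorem ceDiff_ι (h : IsLieSubalgebra K₀ K₁) (u : K₁ × K₀) : ceDiff h (sι k K₁ K₀ u) = 0 := by
  simp [ceDiff_eq, sCoder, comul_ι, ceQuadratic_one, ceQuadratic_ι]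

theorem ceDiff_ι_mul_ι [CharZero k] (h : IsLieSubalgebra K₀ K₁) (u v : K₁ × K₀) :
    ceDiff h (sι k K₁ K₀ u * sι k K₁ K₀ v) = sι k K₁ K₀ (ceBracket h u v) := by
  simp [ceDiff_eq, sCoder, comul_ι_mul_ι, ceQuadratic_one, ceQuadratic_ι, ceQuadratic_ι_mul_ι]

theorem ceDiff_ι_mul (h : IsLieSubalgebra K₀ K₁) (u : K₁ × K₀) (c : S k K₁ K₀) :
    ceDiff h (sι k K₁ K₀ u * c)
      = sCoder (ceQuadratic h ∘ₗ LinearMap.mulLeft k (sι k K₁ K₀ u)) c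
        + sι k K₁ K₀ (par k K₁ K₀ u) * ceDiff h c := by
  obtain ⟨a, b⟩ := u
  have hL : LinearMap.mulLeft k (sι k K₁ K₀ (a, b))
      = LinearMap.mulLeft k (sι k K₁ K₀ (a, 0)) + LinearMap.mulLeft k (sι k K₁ K₀ (0, b)) := by
    ext c; simp [← add_mul, ← map_add]
  have hι : sι k K₁ K₀ (a, b) = sι k K₁ K₀ (a, 0) + sι k K₁ K₀ (0, b) := by
    rw [← map_add]; simp
  have hι' : sι k K₁ K₀ (par k K₁ K₀ (a, b)) = sι k K₁ K₀ (a, 0) - sι k K₁ K₀ (0, b) := by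
    rw [← map_sub]; simp [par_mk]
  rw [hL, LinearMap.comp_add, sCoder_add, hι, hι', add_mul, map_add, ceDiff_eq, sCoder_even_mul,
    sCoder_odd_mul (ceQuadratic_parity h), sgn_one, LinearMap.add_apply]
  simp only [sub_mul, neg_smul, one_smul]
  abel

/-- The differential lowers weight by one and `ceQuadratic` sees only weight two, so everything is
decided on products of three letters, by the Jacobi identity. -/
theorem ceQuadratic_ceDiff [CharZero k] (h : IsLieSubalgebra K₀ K₁) (c : S k K₁ K₀) :
    ceQuadratic h (ceDiff h c) = 0 := by
  refine S_le_of_weightSpace (N := LinearMap.ker (ceQuadratic h ∘ₗ ceDiff h)) (fun n c hc => ?_) c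
  rw [LinearMap.mem_ker, LinearMap.comp_apply]
  obtain _ | n := n
  · rw [weightSpace_zero hc, Algebra.algebraMap_eq_smul_one, map_smul, ceDiff_eq, sCoder_one,
      ceQuadratic_one, map_zero, smul_zero, map_zero]
  -- Here `c` has weight `n + 1`, so `n = 2` is the case of three letters.
  rcases eq_or_ne n 2 with rfl | hn
  swap
  · exact ceQuadratic_weightSpace h hn
      (sCoder_mem_weightSpace (fun n hn c hc => ceQuadratic_weightSpace h hn hc) hc)
  refine weightSpace_induction (P := fun c => ceQuadratic h (ceDiff h c) = 0)
    (fun x y hx hy => by rw [map_add, map_add, hx, hy, add_zero]) (fun x c hc => ?_) hc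
  refine weightSpace_induction (P := fun c => ceQuadratic h (ceDiff h (sι k K₁ K₀ x * c)) = 0)
    (fun x y hx hy => by rw [mul_add, map_add, map_add, hx, hy, add_zero]) (fun y c hc => ?_) hc
  refine weightSpace_induction
    (P := fun c => ceQuadratic h (ceDiff h (sι k K₁ K₀ x * (sι k K₁ K₀ y * c))) = 0)
    (fun x y hx hy => by rw [mul_add, mul_add, map_add, map_add, hx, hy, add_zero])
    (fun z c hc => ?_) hc
  rw [weightSpace_zero hc, Algebra.algebraMap_eq_smul_one, mul_smul_comm, mul_smul_comm,
    mul_smul_comm, map_smul, map_smul, mul_one]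
  have h3 : ceQuadratic h (sι k K₁ K₀ x * (sι k K₁ K₀ y * sι k K₁ K₀ z)) = 0 := by
    refine ceQuadratic_weightSpace h (n := 3) (by decide) (ι_mul_mem_weightSpace _
      (ι_mul_mem_weightSpace _ ?_))
    simp
  rw [ceDiff_ι_mul, ceDiff_ι_mul_ι, sCoder, LinearMap.comp_apply, LinearMap.comp_apply,
    comul_ι_mul_ι]
  simp only [map_add, TensorProduct.map_tmul, LinearMap.mul'_apply, LinearMap.comp_apply,
    LinearMap.mulLeft_apply, LinearMap.id_apply, mul_one, h3, ceQuadratic_ι, map_zero, zero_mul,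
    ceQuadratic_ι_mul_ι, zero_add]
  refine smul_eq_zero_of_right _ (Eq.trans ?_ (ceBracket_jacobi h x y z))
  abel

/-- The square of the odd coderivation `ceDiff h` is an even coderivation with zero corestriction.
-/
theorem ceDiff_ceDiff [CharZero k] (h : IsLieSubalgebra K₀ K₁) (c : S k K₁ K₀) :
    ceDiff h (ceDiff h c) = 0 := by
  have := coder_eq_zero ((ceDiff_isCoder h).sq sPar_sPar) (fun c => by
    rw [Module.End.mul_apply, ceDiff_eq, sProj_sCoder, ← ceDiff_eq, ceQuadratic_ceDiff])
  exact LinearMap.congr_fun this c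

theorem ceDiff_mem_weightSpace (h : IsLieSubalgebra K₀ K₁) {n : ℕ} {c : S k K₁ K₀}
    (hc : c ∈ weightSpace k K₁ K₀ (n + 1)) : ceDiff h c ∈ weightSpace k K₁ K₀ n :=
  sCoder_mem_weightSpace (fun _ hn _ hc => ceQuadratic_weightSpace h hn hc) hc

theorem ceDiffCompleted_mem (h : IsLieSubalgebra K₀ K₁) {f : ℕ → S k K₁ K₀}
    (hf : f ∈ ceCompleted (k := k) K₀ K₁) : ceDiffCompleted h f ∈ ceCompleted (k := k) K₀ K₁ :=
  fun n => ceDiff_mem_weightSpace h (hf (n + 1))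

theorem ceDiffCompleted_ceDiffCompleted [CharZero k] (h : IsLieSubalgebra K₀ K₁) (f : ℕ → S k K₁ K₀) :
    ceDiffCompleted h (ceDiffCompleted h f) = 0 := by
  funext n
  exact ceDiff_ceDiff h (f (n + 1 + 1))

/-! ### Maps into the Chevalley–Eilenberg complex -/

variable {E O : Type*} [AddCommGroup E] [Module k E] [AddCommGroup O] [Module k O]

/-- The difference `G` of the two sides is a derivation along the coalgebra map `expMap χ`. Its
component is the difference of the two sides of the Maurer–Cartan equation `mc`, so
`derivation_eq_zero` applies. -/
theorem expMap_comm_diff [CharZero k] (h : IsLieSubalgebra K₀ K₁) {d : Module.End k (S k E O)}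
    (hd : IsCoder (comul k E O) (sPar k E O).toLinearMap 1 d) {χ : S k E O →ₗ[k] K₁ × K₀}
    (hχ : ∀ c, χ (sPar k E O c) = par k K₁ K₀ (χ c))
    (mc : ∀ c, χ (d c)
      = (2⁻¹ : k) • TensorProduct.lift (ceBracket h) (TensorProduct.map χ χ (comul k E O c)))
    (n : ℕ) (c : S k E O) : expMap χ n (d c) = ceDiff h (expMap χ (n + 1) c) := by
  let G (n : ℕ) : S k E O →ₗ[k] S k K₁ K₀ := expMap χ n ∘ₗ d - ceDiff h ∘ₗ expMap χ (n + 1)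
  have hF := expMap_isCoalgMap hχ
  have hG0 : G 0 = 0 := by
    ext1 c
    simp only [G, LinearMap.sub_apply, LinearMap.comp_apply, zero_add, expMap_one, ceDiff_ι]
    simp [expMap, sCounit_coder hd]
  suffices G n = 0 from sub_eq_zero.mp (LinearMap.congr_fun this c)
  refine derivation_eq_zero hF (fun n c => ?_) hG0 (fun c => ?_) (fun n c => ?_) n
  · exact Submodule.sub_mem _ (hF.weight _ _) (ceDiff_mem_weightSpace h (hF.weight _ _))
  · simp only [G, LinearMap.sub_apply, LinearMap.comp_apply, map_sub]
    rw [expMap_one, LinearMap.comp_apply, sProj_ι, mc, ceDiff_eq, sProj_sCoder, ceQuadratic,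
      LinearMap.smul_apply, LinearMap.comp_apply, LinearMap.comp_apply, hF.comul, sub_eq_zero]
    congr 2
    have h0 : ∀ n ≠ 1, sProj k K₁ K₀ ∘ₗ expMap χ n = 0 := fun n hn => by
      ext1 c; exact sProj_weightSpace hn (hF.weight n c)
    -- The projection to `Πg` sees weight one only, so of all splittings of weight two only `(1, 1)`
    -- contributes.
    rw [map_sum, Finset.sum_eq_single (1, 1)]
    · rw [TensorProduct.map_map, sProj_expMap_one]
    · intro p hp hne
      have hp' := Finset.HasAntidiagonal.mem_antidiagonal.mp hp
      have : p.1 ≠ 1 := fun h => hne (by ext <;> simp only <;> omega)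
      rw [TensorProduct.map_map, h0 p.1 this, TensorProduct.map_zero_left, LinearMap.zero_apply]
    · intro h; exact absurd (Finset.HasAntidiagonal.mem_antidiagonal.mpr (by simp)) h
  · have h1 : ∀ p : ℕ × ℕ, ∀ z : S k E O ⊗[k] S k E O,
        TensorProduct.map (expMap χ p.1) (expMap χ p.2) (TensorProduct.map d LinearMap.id z
            + TensorProduct.map (parPow (sPar k E O).toLinearMap 1) d z)
          = TensorProduct.map (expMap χ p.1 ∘ₗ d) (expMap χ p.2) z
            + TensorProduct.map ((sPar k K₁ K₀).toLinearMap ∘ₗ expMap χ p.1)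
              (expMap χ p.2 ∘ₗ d) z := by
      intro p z
      rw [map_add, TensorProduct.map_map, TensorProduct.map_map, LinearMap.comp_id]
      congr 3
      ext1 c
      simp [parPow, expMap_sPar hχ]
    have h2 : ∀ p : ℕ × ℕ, ∀ z : S k E O ⊗[k] S k E O,
        TensorProduct.map (ceDiff h) LinearMap.id
            (TensorProduct.map (expMap χ p.1) (expMap χ p.2) z)
          + TensorProduct.map (parPow (sPar k K₁ K₀).toLinearMap 1) (ceDiff h)
            (TensorProduct.map (expMap χ p.1) (expMap χ p.2) z)
          = TensorProduct.map (ceDiff h ∘ₗ expMap χ p.1) (expMap χ p.2) z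
            + TensorProduct.map ((sPar k K₁ K₀).toLinearMap ∘ₗ expMap χ p.1)
              (ceDiff h ∘ₗ expMap χ p.2) z := by
      intro p z
      rw [TensorProduct.map_map, TensorProduct.map_map, LinearMap.id_comp, parPow_one]
    -- The differential kills weight zero. This drops the end term in which it meets `expMap χ 0`
    -- from each of the two sums over the antidiagonal of `n + 1`, and both become sums over that of
    -- `n`.
    have h3 : ceDiff h ∘ₗ expMap χ 0 = 0 := by
      ext1 c
      simp [expMap, ceDiff_eq, sCoder_one, ceQuadratic_one]
    simp only [G, LinearMap.sub_apply, LinearMap.comp_apply, map_sub]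
    rw [hF.comul, hd.coleibniz, (ceDiff_isCoder h).coleibniz, hF.comul, map_sum, map_sum,
      ← Finset.sum_add_distrib, Finset.sum_congr rfl fun p _ => h1 p _,
      Finset.sum_congr rfl fun p _ => h2 p _, Finset.sum_add_distrib, Finset.sum_add_distrib,
      Finset.Nat.sum_antidiagonal_succ, Finset.Nat.sum_antidiagonal_succ' (n := n)
        (f := fun p => TensorProduct.map ((sPar k K₁ K₀).toLinearMap ∘ₗ expMap χ p.1)
              (ceDiff h ∘ₗ expMap χ p.2) (comul k E O c))]
    simp only [h3, TensorProduct.map_zero_left, TensorProduct.map_zero_right,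
      LinearMap.zero_apply, zero_add]
    rw [add_sub_add_comm, ← Finset.sum_sub_distrib, ← Finset.sum_sub_distrib,
      ← Finset.sum_add_distrib]
    refine Finset.sum_congr rfl fun p _ => ?_
    rw [map_sub_left, map_sub_right, LinearMap.sub_apply,
      LinearMap.sub_apply]

/-- An even map to `Πg` that satisfies the Maurer–Cartan equation is the component of a map of dg
coalgebras. -/
theorem hasCEMap_of_maurerCartan [CharZero k] (h : IsLieSubalgebra K₀ K₁) {d : Module.End k (S k E O)}
    (hd : IsCoder (comul k E O) (sPar k E O).toLinearMap 1 d) (hdd : ∀ c, d (d c) = 0)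
    {χ : S k E O →ₗ[k] K₁ × K₀} (hχ : ∀ c, χ (sPar k E O c) = par k K₁ K₀ (χ c))
    (mc : ∀ c, χ (d c)
      = (2⁻¹ : k) • TensorProduct.lift (ceBracket h) (TensorProduct.map χ χ (comul k E O c)))
    {value : (S k E O →ₗ[k] (K₁ × K₀)) → Prop} (hv : value χ) (hu : ∀ ψ, value ψ → ψ = χ) :
    HasCEMap d K₀ K₁ value := by
  have hF := expMap_isCoalgMap hχ
  have hdF : ∀ c, (fun n => expMap χ n (d c)) = ceDiffCompleted h (fun n => expMap χ n c) :=
    fun c => funext fun n => expMap_comm_diff h hd hχ mc n c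
  refine ⟨h, hdd, fun f hf => ⟨ceDiffCompleted_mem h hf, ceDiffCompleted_ceDiffCompleted h f⟩,
    expMap χ, hF, hdF, ?_, fun G hG hGv => ?_, ?_⟩
  · rwa [sProj_expMap_one]
  · rw [hG.eq_expMap, hu _ hGv]
  · let Φ : S k E O →ₗ[k] (ℕ → S k K₁ K₀) := LinearMap.pi (expMap χ)
    have hΦ : ∀ z : ↥((⊤ : Submodule k (S k E O)) ⊓ LinearMap.ker d),
        Φ z ∈ ceCompleted (k := k) K₀ K₁ ⊓ LinearMap.ker (ceDiffCompleted h) := by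
      intro z
      refine ⟨fun n => hF.weight n z, ?_⟩
      have := hdF z
      rw [LinearMap.mem_ker.mp z.2.2] at this
      refine LinearMap.mem_ker.mpr (this.symm.trans ?_)
      funext n; simp
    let φ : ↥((⊤ : Submodule k (S k E O)) ⊓ LinearMap.ker d) →ₗ[k]
        ↥(ceCompleted (k := k) K₀ K₁ ⊓ LinearMap.ker (ceDiffCompleted h)) :=
      (Φ ∘ₗ Submodule.subtype _).codRestrict _ hΦ
    refine ⟨Submodule.mapQ _ _ φ ?_, fun z => ⟨φ z, rfl, rfl⟩⟩
    rintro z ⟨c, -, hc⟩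
    refine ⟨Φ c, fun n => hF.weight n c, ?_⟩
    rw [show ((Submodule.subtype _) (φ z) : ℕ → S k K₁ K₀) = Φ z from rfl]
    have : (z : S k E O) = d c := hc.symm
    rw [this]
    exact (hdF c).symm

end LieAlgebra

/-! ### Vector fields and coderivations -/

section Coderivations

variable {k C : Type*} [Field k] [AddCommGroup C] [Module k C] {Δ : C →ₗ[k] C ⊗[k] C}
  {γ : C →ₗ[k] C} {i j : ZMod 2} {X Y : Module.End k C}

theorem HasParity.apply {M N : Type*} [AddCommGroup M] [Module k M] [AddCommGroup N] [Module k N]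
    {γ : M →ₗ[k] M} {σ : N →ₗ[k] N} {f : M →ₗ[k] N} (h : HasParity γ σ i f) (c : M) :
    f (γ c) = sgn k i • σ (f c) := h c

theorem IsCoder.sub (hX : IsCoder Δ γ i X) (hY : IsCoder Δ γ i Y) : IsCoder Δ γ i (X - Y) where
  parity c := by simp [hX.parity.apply, hY.parity.apply, smul_sub]
  coleibniz c := by
    simp only [LinearMap.sub_apply, map_sub, hX.coleibniz, hY.coleibniz, map_sub_left,
      map_sub_right]
    abel

/-- The graded commutator of coderivations is a coderivation. -/
theorem IsCoder.commutator (hγ : ∀ c, γ (γ c) = c) (hX : IsCoder Δ γ i X)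
    (hY : IsCoder Δ γ j Y) : IsCoder Δ γ (i + j) (X * Y - sgn k (i * j) • (Y * X)) where
  parity c := by
    simp only [LinearMap.sub_apply, Module.End.mul_apply, LinearMap.smul_apply, hX.parity.apply,
      hY.parity.apply, map_smul, map_sub, sgn_add, smul_sub, smul_smul]
    congr 2 <;> ring
  coleibniz c := by
    have e1 : Δ ((X * Y) c) = _ := (hX.coleibniz (Y c)).trans (by rw [hY.coleibniz])
    have e2 : Δ ((Y * X) c) = _ := (hY.coleibniz (X c)).trans (by rw [hX.coleibniz])
    rw [LinearMap.sub_apply, map_sub, LinearMap.smul_apply, map_smul, e1, e2]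
    generalize Δ c = z
    induction z with
    | zero => simp
    | tmul x y =>
      rcases zmod_two_cases i with rfl | rfl <;> rcases zmod_two_cases j with rfl | rfl <;>
        simp [parPow, hX.parity.apply, hY.parity.apply, hγ, sgn_zero, sgn_one,
          zmod_two_one_add_one, TensorProduct.neg_tmul, TensorProduct.add_tmul,
          TensorProduct.sub_tmul, TensorProduct.tmul_add, TensorProduct.tmul_sub] <;> abel
    | add x y hx hy =>
      simp only [map_add] at hx hy ⊢
      linear_combination (norm := module) hx + hy

/-- The vector field of parity `i` that corresponds to the coderivation `X`. -/
def dualField (γ : C →ₗ[k] C) (i : ZMod 2) (X : Module.End k C) :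
    Module.End k (Module.Dual k C) :=
  (parPow γ i ∘ₗ X).dualMap

theorem dualField_apply (γ : C →ₗ[k] C) (i : ZMod 2) (X : Module.End k C) (f : Module.Dual k C)
    (c : C) : dualField γ i X f c = f (parPow γ i (X c)) := rfl

theorem dualField_add (γ : C →ₗ[k] C) (i : ZMod 2) (X Y : Module.End k C) :
    dualField γ i (X + Y) = dualField γ i X + dualField γ i Y := by
  ext f c; simp [dualField_apply]

theorem dualField_sub (γ : C →ₗ[k] C) (i : ZMod 2) (X Y : Module.End k C) :
    dualField γ i (X - Y) = dualField γ i X - dualField γ i Y := by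
  ext f c; simp [dualField_apply]

theorem dualField_smul (γ : C →ₗ[k] C) (i : ZMod 2) (r : k) (X : Module.End k C) :
    dualField γ i (r • X) = r • dualField γ i X := by
  ext f c; simp [dualField_apply]

theorem dualField_zero (γ : C →ₗ[k] C) (i : ZMod 2) : dualField γ i 0 = 0 := by
  ext f c; simp [dualField_apply]

theorem parPow_parPow (hγ : ∀ c, γ (γ c) = c) (i : ZMod 2) (c : C) :
    parPow γ i (parPow γ i c) = c := by
  rcases zmod_two_cases i with rfl | rfl <;> simp [parPow, hγ]

/-- Transposing reverses the order of composition, and the sign comes from moving the power of `γ`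
that belongs to `X` past `Y`. -/
theorem dualField_mul (hγ : ∀ c, γ (γ c) = c) (hY : HasParity γ γ j Y) :
    dualField γ i X * dualField γ j Y = sgn k (i * j) • dualField γ (i + j) (Y * X) := by
  ext f c
  rcases zmod_two_cases i with rfl | rfl <;> rcases zmod_two_cases j with rfl | rfl <;>
    simp [dualField_apply, parPow, hY.apply, hγ, sgn_zero, sgn_one, zmod_two_one_add_one]

theorem dualField_injective (hγ : ∀ c, γ (γ c) = c) (h : dualField γ i X = dualField γ i Y) :
    X = Y := by
  ext1 c
  have : parPow γ i (X c) = parPow γ i (Y c) := by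
    rw [← sub_eq_zero, ← Module.forall_dual_apply_eq_zero_iff k]
    intro f
    have := LinearMap.congr_fun (LinearMap.congr_fun h f) c
    rw [dualField_apply, dualField_apply] at this
    rw [map_sub, this, sub_self]
  rw [← parPow_parPow hγ i (X c), this, parPow_parPow hγ]

end Coderivations

/-! ### Continuous derivations as duals of coderivations -/

section Correspondence

variable {k C : Type*} [Field k] [Ring C] [Algebra k C] {Δ : C →ₗ[k] C ⊗[k] C}
  {γ : C →ₗ[k] C} {i : ZMod 2} {X : Module.End k C}

theorem fmul_apply (f g : Module.Dual k C) (c : C) :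
    fmul Δ f g c = LinearMap.mul' k k (TensorProduct.map g f (Δ c)) := rfl

theorem dualField_isVectorField (hγ : ∀ c, γ (γ c) = c)
    (hΔ : ∀ c, Δ (γ c) = TensorProduct.map γ γ (Δ c)) (hX : IsCoder Δ γ i X) (h1 : X 1 = 0) :
    IsVectorField Δ γ i (dualField γ i X) where
  parity f := by
    ext c
    rcases zmod_two_cases i with rfl | rfl <;>
      simp [dualField_apply, hX.parity.apply, sgn_zero, sgn_one, parPow]
  leibniz f g := by
    ext c
    have hΔ' : Δ (parPow γ i (X c)) = TensorProduct.map (parPow γ i) (parPow γ i) (Δ (X c)) := by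
      rcases zmod_two_cases i with rfl | rfl <;> simp [parPow, hΔ]
    rw [dualField_apply, LinearMap.add_apply, fmul_apply, fmul_apply, fmul_apply, hΔ',
      hX.coleibniz]
    generalize Δ c = z
    induction z with
    | zero => simp
    | tmul x y =>
      rcases zmod_two_cases i with rfl | rfl <;>
        simp [dualField_apply, parPow, twist, hγ] <;> ring
    | add x y hx hy =>
      simp only [map_add] at hx hy ⊢
      linear_combination hx + hy
  continuous c := ⟨{parPow γ i (X c)}, fun f hf => hf _ (Finset.mem_singleton_self _)⟩
  vanishing f := by simp [dualField_apply, h1]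

/-- Products of functionals separate points of a tensor product: coordinates in a product of bases
are of this form. -/
theorem tensor_eq_of_dual {M N : Type*} [AddCommGroup M] [Module k M] [AddCommGroup N]
    [Module k N] {z w : M ⊗[k] N}
    (h : ∀ (f : Module.Dual k M) (g : Module.Dual k N),
      LinearMap.mul' k k (TensorProduct.map f g z) = LinearMap.mul' k k (TensorProduct.map f g w)) :
    z = w := by
  let b := Module.Free.chooseBasis k M
  let b' := Module.Free.chooseBasis k N
  refine (b.tensorProduct b').repr.injective (Finsupp.ext fun p => ?_)
  have hp : ∀ z : M ⊗[k] N, (b.tensorProduct b').repr z p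
      = LinearMap.mul' k k (TensorProduct.map (b.coord p.1) (b'.coord p.2) z) := by
    intro z
    induction z with
    | zero => simp
    | tmul x y => obtain ⟨p, q⟩ := p; simp [mul_comm]
    | add x y hx hy => simp only [map_add, Finsupp.add_apply, hx, hy]
  rw [hp, hp, h]

/-- By continuity the functional `f ↦ δ f c` vanishes wherever finitely many evaluations do. It is
therefore a linear combination of these, that is, evaluation at a single element of `C`. -/
theorem IsVectorField.exists_dualMap {δ : Module.End k (Module.Dual k C)}
    (hδ : IsVectorField Δ γ i δ) : ∃ D : Module.End k C, ∀ f c, δ f c = f (D c) := by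
  have key : ∀ c, ∃ d, ∀ f, δ f c = f d := by
    intro c
    obtain ⟨s, hs⟩ := hδ.continuous c
    let K : Module.Dual k (Module.Dual k C) := Module.Dual.eval k C c ∘ₗ δ
    have hK : K ∈ Submodule.span k (Set.range fun x : s => Module.Dual.eval k C (x : C)) := by
      refine mem_span_of_iInf_ker_le_ker (fun f hf => ?_)
      refine hs f fun x hx => ?_
      exact LinearMap.mem_ker.mp ((Submodule.mem_iInf _).mp hf ⟨x, hx⟩)
    have hle : Submodule.span k (Set.range fun x : s => Module.Dual.eval k C (x : C))
        ≤ LinearMap.range (Module.Dual.eval k C) := by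
      rw [Submodule.span_le]
      rintro _ ⟨x, rfl⟩
      exact ⟨_, rfl⟩
    obtain ⟨d, hd⟩ := hle hK
    exact ⟨d, fun f => (LinearMap.congr_fun hd f).symm⟩
  choose D hD using key
  have hext : ∀ x y : C, (∀ f : Module.Dual k C, f x = f y) → x = y := fun x y h => by
    rw [← sub_eq_zero, ← Module.forall_dual_apply_eq_zero_iff k]
    intro f
    rw [map_sub, h, sub_self]
  exact ⟨{ toFun := D
           map_add' := fun x y => hext _ _ fun f => by simp [← hD]
           map_smul' := fun r x => hext _ _ fun f => by simp [← hD] }, fun f c => hD c f⟩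

/-- Every vector field is the dual of a coderivation. -/
theorem IsVectorField.exists_coder (hγ : ∀ c, γ (γ c) = c)
    (hΔ : ∀ c, Δ (γ c) = TensorProduct.map γ γ (Δ c))
    {δ : Module.End k (Module.Dual k C)} (hδ : IsVectorField Δ γ i δ) :
    ∃ X, IsCoder Δ γ i X ∧ X 1 = 0 ∧ δ = dualField γ i X := by
  obtain ⟨D, hD⟩ := hδ.exists_dualMap
  have hext : ∀ x y : C, (∀ f : Module.Dual k C, f x = f y) → x = y := fun x y h => by
    rw [← sub_eq_zero, ← Module.forall_dual_apply_eq_zero_iff k]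
    intro f
    rw [map_sub, h, sub_self]
  have hpar : ∀ c, γ (D c) = sgn k i • D (γ c) := fun c => hext _ _ fun f => by
    have := LinearMap.congr_fun (hδ.parity f) c
    simpa [hD] using this
  have hpar' : ∀ c, D (γ c) = sgn k i • γ (D c) := fun c => by
    rw [hpar, smul_smul, sgn_mul_self, one_smul]
  have hone : D 1 = 0 := hext _ _ fun f => by rw [← hD, hδ.vanishing, map_zero]
  have hΔD : ∀ c, Δ (D c) = TensorProduct.map LinearMap.id D (Δ c)
      + TensorProduct.map D (parPow γ i) (Δ c) := fun c => tensor_eq_of_dual fun g f => by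
    have := LinearMap.congr_fun (hδ.leibniz f g) c
    rw [hD, fmul_apply, LinearMap.add_apply, fmul_apply, fmul_apply] at this
    rw [this, map_add, map_add, TensorProduct.map_map, TensorProduct.map_map]
    congr 4
    · ext x; exact hD f x
    · ext x; exact hD g x
    · rcases zmod_two_cases i with rfl | rfl <;> simp [twist, parPow]
  -- `D` is the plain pre-transpose of `δ`; the power of `γ` compensates the one built into
  -- `dualField` and turns the Leibniz rule for `D` into the co-Leibniz rule.
  refine ⟨parPow γ i ∘ₗ D, ⟨fun c => ?_, fun c => ?_⟩, by simp [hone], ?_⟩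
  · rcases zmod_two_cases i with rfl | rfl <;> simp [parPow, hpar', sgn_zero, sgn_one]
  · have hΔ' : ∀ x, Δ (parPow γ i x) = TensorProduct.map (parPow γ i) (parPow γ i) (Δ x) := by
      rcases zmod_two_cases i with rfl | rfl <;> simp [parPow, hΔ]
    rw [LinearMap.comp_apply, hΔ', hΔD]
    generalize Δ c = z
    induction z with
    | zero => simp
    | tmul x y => simp [parPow_parPow hγ, add_comm]
    | add x y hx hy =>
      simp only [map_add] at hx hy ⊢
      linear_combination (norm := module) hx + hy
  · ext f c
    rw [hD, dualField_apply, LinearMap.comp_apply, parPow_parPow hγ]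

/-- The Koszul sign in `taylor` cancels the power of `γ` in `dualField`, so components of the field
are exactly the corestriction of the coderivation. -/
theorem taylor_dualField {U : Type*} [AddCommGroup U] [Module k U] [FiniteDimensional k U]
    {p : C →ₗ[k] U} {σ : U →ₗ[k] U} (hγ : ∀ c, γ (γ c) = c) (hp : ∀ c, p (γ c) = σ (p c)) :
    taylor p σ i (dualField γ i X) = p ∘ₗ X := by
  ext1 c
  refine (Module.evalEquiv k U).injective (LinearMap.ext fun f => ?_)
  simp only [taylor, Module.evalEquiv_apply, Module.Dual.eval_apply, apply_dualRestrict,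
    dualField_apply]
  rcases zmod_two_cases i with rfl | rfl
  · simp [parPow]
  · simp [parPow, ← hp, hγ]

end Correspondence

/-! ### Graded commutators of vector fields -/

section LieSubalgebra

variable {k : Type*} [Field k]

theorem isLieSubalgebra_of_commutator {A : Type*} [Ring A] [Algebra k A]
    {K : ZMod 2 → Submodule k A}
    (h : ∀ i j, ∀ x ∈ K i, ∀ y ∈ K j, x * y - sgn k (i * j) • (y * x) ∈ K (i + j)) :
    IsLieSubalgebra (K 0) (K 1) where
  even_even x hx y hy := by simpa [sgn_zero] using h 0 0 x hx y hy
  even_odd x hx y hy := by simpa [sgn_zero] using h 0 1 x hx y hy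
  odd_odd x hx y hy := by
    simpa [sgn_one, zmod_two_one_add_one] using h 1 1 x hx y hy

variable {C : Type*} [Ring C] [Algebra k C] {Δ : C →ₗ[k] C ⊗[k] C}
  {γ : C →ₗ[k] C} {i j : ZMod 2} {X Y : Module.End k C}

/-- The factor `-1` is the reversal of products under transposition: duality is an anti-isomorphism
for the graded bracket. -/
theorem dualField_commutator (hγ : ∀ c, γ (γ c) = c) (hX : HasParity γ γ i X)
    (hY : HasParity γ γ j Y) :
    dualField γ i X * dualField γ j Y - sgn k (i * j) • (dualField γ j Y * dualField γ i X)
      = (-1 : k) • dualField γ (i + j) (X * Y - sgn k (i * j) • (Y * X)) := by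
  rw [dualField_mul hγ hX, dualField_mul hγ hY, dualField_sub, dualField_smul, mul_comm j i,
    add_comm j i, smul_smul, sgn_mul_self, one_smul]
  module

theorem vectorFields_commutator (hγ : ∀ c, γ (γ c) = c)
    (hΔ : ∀ c, Δ (γ c) = TensorProduct.map γ γ (Δ c)) (i j : ZMod 2)
    (x : Module.End k (Module.Dual k C)) (hx : x ∈ vectorFields Δ γ i)
    (y : Module.End k (Module.Dual k C)) (hy : y ∈ vectorFields Δ γ j) :
    x * y - sgn k (i * j) • (y * x) ∈ vectorFields Δ γ (i + j) := by
  obtain ⟨X, hX, hX1, rfl⟩ := IsVectorField.exists_coder hγ hΔ hx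
  obtain ⟨Y, hY, hY1, rfl⟩ := IsVectorField.exists_coder hγ hΔ hy
  rw [dualField_commutator hγ hX.parity hY.parity]
  have h1 : (X * Y - sgn k (i * j) • (Y * X)) 1 = 0 := by simp [hX1, hY1]
  have h2 : dualField γ (i + j) (X * Y - sgn k (i * j) • (Y * X)) ∈ vectorFields Δ γ (i + j) :=
    dualField_isVectorField hγ hΔ (hX.commutator hγ hY) h1
  exact Submodule.smul_mem _ _ h2

theorem vectorFields_isLieSubalgebra (hγ : ∀ c, γ (γ c) = c)
    (hΔ : ∀ c, Δ (γ c) = TensorProduct.map γ γ (Δ c)) :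
    IsLieSubalgebra (A := Module.End k (Module.Dual k C)) (vectorFields Δ γ 0)
      (vectorFields Δ γ 1) :=
  isLieSubalgebra_of_commutator (A := Module.End k (Module.Dual k C)) (K := vectorFields Δ γ)
    (vectorFields_commutator hγ hΔ)

end LieSubalgebra

/-! ### Coalgebras with an action of `S U` by shuffles -/

section ShuffleSystem

variable {k E O C : Type*} [Field k] [AddCommGroup E] [Module k E] [AddCommGroup O] [Module k O]
  [Ring C] [Algebra k C]

/-- `C` is a coalgebra, conilpotently cogenerated by `U = E × O`, in which every map `C → U`
cogenerates a coderivation, with an action of `S U` in which `U` acts by the coderivations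
cogenerated by constants. -/
structure IsShuffleSystem (Δ : C →ₗ[k] C ⊗[k] C) (γ : C →ₗ[k] C) (ι : (E × O) →ₗ[k] C)
    (p : C →ₗ[k] (E × O)) (ε : C →ₐ[k] k) (act : S k E O →ₐ[k] Module.End k C)
    (coder : (C →ₗ[k] (E × O)) →ₗ[k] Module.End k C) : Prop where
  par_par : ∀ c, γ (γ c) = c
  par_one : γ 1 = 1
  comul_par : ∀ c, Δ (γ c) = TensorProduct.map γ γ (Δ c)
  proj_par : ∀ c, p (γ c) = par k E O (p c)
  counit_par : ∀ c, ε (γ c) = ε c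
  eq_zero : ∀ i X, IsCoder Δ γ i X → (∀ c, p (X c) = 0) → X = 0
  coder_isCoder : ∀ i t, HasParity γ (par k E O) i t → IsCoder Δ γ i (coder t)
  proj_coder : ∀ t c, p (coder t c) = t c
  counit_coder : ∀ t c, ε (coder t c) = 0
  coder_one : ∀ t, coder t 1 = ι (t 1)
  coder_const : ∀ u, coder (ε.toLinearMap.smulRight u) = act (sι k E O u)
  par_act : ∀ a c, γ (act a c) = act (sPar k E O a) (γ c)

namespace IsShuffleSystem

variable {Δ : C →ₗ[k] C ⊗[k] C} {γ : C →ₗ[k] C} {ι : (E × O) →ₗ[k] C}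
  {p : C →ₗ[k] (E × O)} {ε : C →ₐ[k] k} {act : S k E O →ₐ[k] Module.End k C}
  {coder : (C →ₗ[k] (E × O)) →ₗ[k] Module.End k C} {i : ZMod 2} {t : C →ₗ[k] (E × O)}

section

variable (h : IsShuffleSystem Δ γ ι p ε act coder)

include h

theorem coder_eq {X : Module.End k C} (hX : IsCoder Δ γ i X) (hp : ∀ c, p (γ c) = par k E O (p c)) :
    coder (p ∘ₗ X) = X := by
  have ht : HasParity γ (par k E O) i (p ∘ₗ X) := fun c => by
    simp [hX.parity.apply, hp]
  rw [← sub_eq_zero]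
  refine h.eq_zero i _ ((h.coder_isCoder i _ ht).sub hX) fun c => ?_
  simp [h.proj_coder]

theorem act_isCoder {u : E × O} (hu : par k E O u = sgn k i • u) :
    IsCoder Δ γ i (act (sι k E O u)) := by
  rw [← h.coder_const]
  refine h.coder_isCoder i _ fun c => ?_
  simp only [LinearMap.smulRight_apply, AlgHom.toLinearMap_apply, h.counit_par, map_smul, hu,
    smul_smul]
  rw [mul_left_comm, sgn_mul_self, mul_one]

theorem proj_act_ι (u : E × O) (c : C) : p (act (sι k E O u) c) = ε c • u := by
  rw [← h.coder_const, h.proj_coder]; rfl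

/-- The graded commutator of `coder t` with `u` is a coderivation, so only its corestriction
matters. One term is `t (u · c)`; the other is the counit of `coder t c` times `u`, which vanishes.
-/
theorem coder_mul_act_ι (ht : HasParity γ (par k E O) i t) {j : ZMod 2} {u : E × O}
    (hu : par k E O u = sgn k j • u) :
    coder t * act (sι k E O u)
      = coder (t ∘ₗ act (sι k E O u)) + sgn k (i * j) • (act (sι k E O u) * coder t) := by
  have hc := (h.coder_isCoder i t ht).commutator h.par_par (h.act_isCoder hu)
  have hp : p ∘ₗ (coder t * act (sι k E O u) - sgn k (i * j) • (act (sι k E O u) * coder t))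
      = t ∘ₗ act (sι k E O u) := by
    ext1 c
    simp [h.proj_coder, h.proj_act_ι, h.counit_coder]
  rw [← hp, h.coder_eq hc h.proj_par, sub_add_cancel]

theorem hasParity_comp_even (ht : HasParity γ (par k E O) i t) (a : E) :
    HasParity γ (par k E O) i (t ∘ₗ act (sι k E O (a, 0))) := by
  intro c
  have := ht (act (sι k E O (a, 0)) c)
  rw [h.par_act, sPar_even] at this
  exact this

theorem hasParity_comp_odd (ht : HasParity γ (par k E O) i t) (b : O) :
    HasParity γ (par k E O) (i + 1) (t ∘ₗ act (sι k E O (0, b))) := by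
  intro c
  have := ht (act (sι k E O (0, b)) c)
  rw [h.par_act, sPar_odd, map_neg, LinearMap.neg_apply, map_neg] at this
  simp [sgn_add, sgn_one, ← this]

end

variable (act coder) in
/-- `a ↦ coder (t ∘ act a)`. -/
def coderAct (t : C →ₗ[k] (E × O)) : S k E O →ₗ[k] Module.End k C :=
  coder ∘ₗ LinearMap.compRight k t ∘ₗ act.toLinearMap

theorem coderAct_apply (t : C →ₗ[k] (E × O)) (a : S k E O) :
    coderAct act coder t a = coder (t ∘ₗ act a) := rfl

/-- `coder_mul_act_ι` iterated over the letters of `a`: each letter either passes `coder t` to the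
left or is fed into `t`, and the coproduct of `a` lists the possibilities. -/
theorem coder_mul_act (h : IsShuffleSystem Δ γ ι p ε act coder)
    (ht : HasParity γ (par k E O) i t) (a : S k E O) :
    coder t * act a = LinearMap.mul' k (Module.End k C) (TensorProduct.map
      (act.toLinearMap ∘ₗ parPow (sPar k E O).toLinearMap i) (coderAct act coder t)
      (comul k E O a)) := by
  induction a using S_induction generalizing t i with
  | one =>
    have h1 : parPow (sPar k E O).toLinearMap i 1 = 1 := by
      rcases zmod_two_cases i with rfl | rfl <;> simp [parPow]
    simp [comul_one, h1, coderAct_apply]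
    rfl
  | add x y hx hy => simp only [map_add, mul_add, hx ht, hy ht]
  | smul r x hx => simp only [map_smul, mul_smul_comm, hx ht]
  | even a x hx =>
    rw [map_mul, ← mul_assoc, h.coder_mul_act_ι ht (j := 0) (by simp [par_mk, sgn_zero]), add_mul,
      hx (h.hasParity_comp_even ht a), mul_zero, sgn_zero, one_smul, mul_assoc, hx ht, comul_even,
      map_add, map_add, add_comm]
    congr 1
    · generalize comul k E O x = z
      induction z with
      | zero => simp
      | tmul x y =>
        rcases zmod_two_cases i with rfl | rfl <;> simp [parPow, sPar_even, mul_assoc]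
      | add x y hx hy => simp only [map_add, mul_add, hx, hy]
    · rw [TensorProduct.map_map, LinearMap.comp_id]
      congr 3
      ext1 c
      simp [coderAct_apply, LinearMap.comp_assoc, Module.End.mul_eq_comp]
  | odd b x hx =>
    rw [map_mul, ← mul_assoc, h.coder_mul_act_ι ht (j := 1) (by simp [par_mk, sgn_one]), add_mul,
      hx (h.hasParity_comp_odd ht b), mul_one, smul_mul_assoc, mul_assoc, hx ht, comul_odd,
      map_add, map_add, add_comm]
    congr 1
    · generalize comul k E O x = z
      induction z with
      | zero => simp
      | tmul x y =>
        rcases zmod_two_cases i with rfl | rfl <;> ext1 c <;>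
          simp [parPow, sPar_odd, sgn_zero, sgn_one]
      | add x y hx hy => simp only [map_add, mul_add, smul_add, hx, hy]
    -- Feeding the odd letter into `t` raises its parity by one; the additional power of the parity
    -- involution is the one in `comul_odd`.
    · rw [TensorProduct.map_map]
      congr 3
      · rcases zmod_two_cases i with rfl | rfl <;> ext1 c <;>
          simp [parPow, sPar_sPar, zmod_two_one_add_one]
      · ext1 c
        simp [coderAct_apply, LinearMap.comp_assoc, Module.End.mul_eq_comp]

end IsShuffleSystem

/-- The system of the `L_∞`-cases: `S U` acting on itself by multiplication. It is also needed for a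
general system, to compute the differential of `CE_*(V)` in `coder_mul_act_eq`. -/
theorem S_isShuffleSystem [CharZero k] : IsShuffleSystem (comul k E O) (sPar k E O).toLinearMap
    (sι k E O) (sProj k E O) (sCounit k E O) (Algebra.lmul k (S k E O))
    { toFun := sCoder, map_add' := sCoder_add, map_smul' := sCoder_smul } where
  par_par := sPar_sPar
  par_one := map_one (sPar k E O)
  comul_par := comul_sPar
  proj_par := sProj_sPar
  counit_par := sCounit_sPar
  eq_zero _ _ := coder_eq_zero
  coder_isCoder _ _ := sCoder_isCoder
  proj_coder := sProj_sCoder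
  counit_coder := sCounit_sCoder
  coder_one := sCoder_one
  coder_const := sCoder_const
  par_act a c := map_mul (sPar k E O) a c

namespace IsShuffleSystem

variable {Δ : C →ₗ[k] C ⊗[k] C} {γ : C →ₗ[k] C} {ι : (E × O) →ₗ[k] C}
  {p : C →ₗ[k] (E × O)} {ε : C →ₐ[k] k} {act : S k E O →ₐ[k] Module.End k C}
  {coder : (C →ₗ[k] (E × O)) →ₗ[k] Module.End k C} {i : ZMod 2} {t : C →ₗ[k] (E × O)}

variable (act) in
/-- The components of the `L_∞`-structure associated to `t`. -/
def orbit (t : C →ₗ[k] (E × O)) : S k E O →ₗ[k] (E × O) :=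
  t ∘ₗ (LinearMap.applyₗ (1 : C)) ∘ₗ act.toLinearMap

theorem orbit_apply (t : C →ₗ[k] (E × O)) (a : S k E O) : orbit act t a = t (act a 1) := rfl

variable (act ε) in
/-- The map `c ↦ t(a · c)`, made to vanish at `1`. -/
def component (t : C →ₗ[k] (E × O)) : S k E O →ₗ[k] C →ₗ[k] (E × O) :=
  LinearMap.compRight k t ∘ₗ act.toLinearMap
    - LinearMap.smulRightₗ ε.toLinearMap ∘ₗ orbit act t

theorem component_apply (t : C →ₗ[k] (E × O)) (a : S k E O) (c : C) :
    component ε act t a c = t (act a c) - ε c • t (act a 1) := rfl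

theorem component_one (t : C →ₗ[k] (E × O)) (a : S k E O) : component ε act t a 1 = 0 := by
  simp [component_apply]

variable (act ε coder) in
/-- The coderivation with components `c ↦ t(a · c)` that vanishes at `1`. -/
def actCoder (t : C →ₗ[k] (E × O)) : S k E O →ₗ[k] Module.End k C :=
  coder ∘ₗ component ε act t

theorem actCoder_apply (t : C →ₗ[k] (E × O)) (a : S k E O) :
    actCoder ε act coder t a = coder (component ε act t a) := rfl

section

variable (h : IsShuffleSystem Δ γ ι p ε act coder)

include h

theorem hasParity_orbit (ht : HasParity γ (par k E O) i t) :
    HasParity (sPar k E O).toLinearMap (par k E O) i (orbit act t) := by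
  intro a
  have := ht (act a 1)
  rw [h.par_act, h.par_one] at this
  exact this

theorem hasParity_component (ht : HasParity γ (par k E O) i t) {j : ZMod 2} {a : S k E O}
    (ha : sPar k E O a = sgn k j • a) :
    HasParity γ (par k E O) (i + j) (component ε act t a) := by
  intro c
  have ha' : a = sgn k j • sPar k E O a := by rw [ha, smul_smul, sgn_mul_self, one_smul]
  have h1 : ∀ c, t (act a (γ c)) = sgn k (i + j) • par k E O (t (act a c)) := fun c => by
    have := ht (act a c)
    rw [h.par_act, ha, map_smul, LinearMap.smul_apply, map_smul] at this
    rw [sgn_add, mul_comm, mul_smul, ← this, smul_smul, sgn_mul_self, one_smul]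
  have h2 := h1 1
  rw [h.par_one] at h2
  rw [component_apply, component_apply, h1, h.counit_par, map_sub, map_smul, smul_sub, ← smul_comm,
    ← h2]

/-- The component `t (a · 1)` in weight zero is split off; it cogenerates the action of an element
of `U`. -/
theorem coderAct_eq (t : C →ₗ[k] (E × O)) (a : S k E O) : coderAct act coder t a
    = actCoder ε act coder t a + act (sι k E O (orbit act t a)) := by
  rw [← h.coder_const, coderAct_apply, actCoder_apply, ← map_add]
  congr 1
  ext1 c
  simp [component_apply, orbit_apply]

theorem actCoder_one (a : S k E O) : actCoder ε act coder t a 1 = 0 := by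
  rw [actCoder_apply, h.coder_one, component_one, map_zero]

/-- In `coder_mul_act` the constant parts give the action of `∑ γ(a₍₁₎) t(a₍₂₎ · 1)`. The same
formula for `S U` acting on itself, evaluated at `1`, identifies this sum with `sCoder (orbit act t)
a`. -/
theorem coder_mul_act_eq [CharZero k] (ht : HasParity γ (par k E O) 1 t) (a : S k E O) :
    coder t * act a = LinearMap.mul' k (Module.End k C) (TensorProduct.map
        (act.toLinearMap ∘ₗ (sPar k E O).toLinearMap) (actCoder ε act coder t) (comul k E O a))
      + act (sCoder (orbit act t) a) := by
  have hS := (S_isShuffleSystem (k := k) (E := E) (O := O)).coder_mul_act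
    (h.hasParity_orbit ht) a
  have hS1 := LinearMap.congr_fun hS 1
  simp only [parPow_one] at hS1
  rw [h.coder_mul_act ht, parPow_one]
  have e : sCoder (orbit act t) a = (sCoder (orbit act t)) (a * 1) := by rw [mul_one]
  have hS2 : sCoder (orbit act t) (a * 1) = _ := hS1
  rw [e, hS2]
  generalize comul k E O a = z
  induction z with
  | zero => simp
  | tmul x y =>
    simp [h.coderAct_eq, mul_add, coderAct_apply, sCoder_one]
  | add x y hx hy =>
    simp only [map_add, LinearMap.add_apply] at hx hy ⊢
    rw [hx, hy]; abel

/-- Evaluated at `1`, `coder_mul_act_eq` loses its first term, so the corestriction of the squared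
differential becomes `t (coder t (a · 1))`, which is zero by `hsq`. -/
theorem coder_coder_orbit [CharZero k] (ht : HasParity γ (par k E O) 1 t)
    (hsq : coder t * coder t = 0) (a : S k E O) :
    sCoder (orbit act t) (sCoder (orbit act t) a) = 0 := by
  have h0 : ∀ a, orbit act t (sCoder (orbit act t) a) = 0 := by
    intro a
    have h1 := LinearMap.congr_fun (h.coder_mul_act_eq ht a) 1
    have h2 : LinearMap.mul' k (Module.End k C) (TensorProduct.map
        (act.toLinearMap ∘ₗ (sPar k E O).toLinearMap) (actCoder ε act coder t) (comul k E O a)) 1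
        = 0 := by
      generalize comul k E O a = z
      induction z with
      | zero => simp
      | tmul x y => simp [h.actCoder_one]
      | add x y hx hy => rw [map_add, map_add, LinearMap.add_apply, hx, hy, add_zero]
    rw [LinearMap.add_apply, h2, zero_add] at h1
    rw [orbit_apply, ← h1, ← h.proj_coder, ← Module.End.mul_apply, ← mul_assoc, hsq]
    simp
  have hc := sCoder_isCoder (h.hasParity_orbit ht)
  exact LinearMap.congr_fun (coder_eq_zero (hc.sq sPar_sPar) fun c => by
    rw [Module.End.mul_apply, sProj_sCoder, h0]) a

/-- The Maurer–Cartan equation before symmetrization. It is `t` applied to `coder_mul_act_eq`, whose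
left side vanishes since `t ∘ coder t` is the corestriction of the square of `coder t`. -/
theorem component_sCoder [CharZero k] (ht : HasParity γ (par k E O) 1 t)
    (hsq : coder t * coder t = 0) (a : S k E O) (c : C) :
    component ε act t (sCoder (orbit act t) a) c
      = -p (LinearMap.mul' k (Module.End k C) (TensorProduct.map
        (actCoder ε act coder t ∘ₗ (sPar k E O).toLinearMap) (actCoder ε act coder t)
          (comul k E O a)) c) := by
  have key : ∀ c, t (act (sCoder (orbit act t) a) c)
      = -p (LinearMap.mul' k (Module.End k C) (TensorProduct.map
        (actCoder ε act coder t ∘ₗ (sPar k E O).toLinearMap) (actCoder ε act coder t)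
          (comul k E O a)) c) := by
    intro c
    have h1 := congrArg t (LinearMap.congr_fun (h.coder_mul_act_eq ht a) c)
    have h0 : t ((coder t * act a) c) = 0 := by
      rw [← h.proj_coder, ← Module.End.mul_apply, ← mul_assoc, hsq]; simp
    rw [h0, LinearMap.add_apply, map_add] at h1
    rw [eq_neg_iff_add_eq_zero, add_comm, ← h1.symm]
    congr 1
    generalize comul k E O a = z
    induction z with
    | zero => simp
    | tmul x y =>
      -- On values of a coderivation `component` agrees with `t (a · -)`: its correction term is
      -- multiplied by the counit.
      have : ε (actCoder ε act coder t y c) = 0 := h.counit_coder _ _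
      simp only [TensorProduct.map_tmul, LinearMap.mul'_apply, Module.End.mul_apply,
        LinearMap.comp_apply, AlgHom.toLinearMap_apply]
      rw [actCoder_apply t (sPar k E O x), h.proj_coder, component_apply, this, zero_smul,
        sub_zero]
    | add x y hx hy => simp only [map_add, LinearMap.add_apply, hx, hy]
  -- The correction of the left side is the value at `1`, and there the quadratic expression
  -- vanishes too.
  rw [component_apply, key, key 1]
  have : LinearMap.mul' k (Module.End k C) (TensorProduct.map
        (actCoder ε act coder t ∘ₗ (sPar k E O).toLinearMap) (actCoder ε act coder t)
          (comul k E O a)) 1 = 0 := by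
    generalize comul k E O a = z
    induction z with
    | zero => simp
    | tmul x y => simp [h.actCoder_one]
    | add x y hx hy => rw [map_add, map_add, LinearMap.add_apply, hx, hy, add_zero]
  rw [this, map_zero, neg_zero, smul_zero, sub_zero]

end

end IsShuffleSystem

end ShuffleSystem

/-! ### The Maurer–Cartan equation in terms of graded brackets -/

section

variable {k E O C : Type*} [Field k] [AddCommGroup E] [Module k E] [AddCommGroup O] [Module k O]
  [Ring C] [Algebra k C]

theorem sPar_evProj (a : S k E O) : sPar k E O (evProj (sPar k E O).toLinearMap a)
    = evProj (sPar k E O).toLinearMap a :=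
  par_evProj (γ := (sPar k E O).toLinearMap) sPar_sPar a

theorem sPar_odProj (a : S k E O) : sPar k E O (odProj (sPar k E O).toLinearMap a)
    = -odProj (sPar k E O).toLinearMap a :=
  par_odProj (γ := (sPar k E O).toLinearMap) sPar_sPar a

/-- The coproduct preserves parity, so only even-even and odd-odd terms occur for an even element.
-/
theorem comul_evProj [CharZero k] (a : S k E O) :
    comul k E O (evProj (sPar k E O).toLinearMap a)
      = TensorProduct.map (evProj (sPar k E O).toLinearMap) (evProj (sPar k E O).toLinearMap)
          (comul k E O a)
        + TensorProduct.map (odProj (sPar k E O).toLinearMap) (odProj (sPar k E O).toLinearMap)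
          (comul k E O a) := by
  rw [evProj_apply, AlgHom.toLinearMap_apply, map_smul, map_add, comul_sPar]
  generalize comul k E O a = z
  induction z with
  | zero => simp
  | tmul x y =>
    simp only [TensorProduct.map_tmul, AlgHom.toLinearMap_apply]
    conv_lhs => rw [← evProj_add_odProj (sPar k E O).toLinearMap x,
      ← evProj_add_odProj (sPar k E O).toLinearMap y]
    simp only [map_add, sPar_evProj, sPar_odProj,
      TensorProduct.add_tmul, TensorProduct.tmul_add, TensorProduct.neg_tmul,
      TensorProduct.tmul_neg]
    match_scalars <;> norm_num
  | add x y hx hy =>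
    simp only [map_add] at hx hy ⊢
    linear_combination (norm := module) hx + hy

theorem comul_odProj [CharZero k] (a : S k E O) :
    comul k E O (odProj (sPar k E O).toLinearMap a)
      = TensorProduct.map (evProj (sPar k E O).toLinearMap) (odProj (sPar k E O).toLinearMap)
          (comul k E O a)
        + TensorProduct.map (odProj (sPar k E O).toLinearMap) (evProj (sPar k E O).toLinearMap)
          (comul k E O a) := by
  rw [odProj_apply, AlgHom.toLinearMap_apply, map_smul, map_sub, comul_sPar]
  generalize comul k E O a = z
  induction z with
  | zero => simp
  | tmul x y =>
    simp only [TensorProduct.map_tmul, AlgHom.toLinearMap_apply]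
    conv_lhs => rw [← evProj_add_odProj (sPar k E O).toLinearMap x,
      ← evProj_add_odProj (sPar k E O).toLinearMap y]
    simp only [map_add, sPar_evProj, sPar_odProj,
      TensorProduct.add_tmul, TensorProduct.tmul_add, TensorProduct.neg_tmul,
      TensorProduct.tmul_neg]
    match_scalars <;> norm_num
  | add x y hx hy =>
    simp only [map_add] at hx hy ⊢
    linear_combination (norm := module) hx + hy

namespace IsShuffleSystem

variable {Δ : C →ₗ[k] C ⊗[k] C} {γ : C →ₗ[k] C} {ι : (E × O) →ₗ[k] C}
  {p : C →ₗ[k] (E × O)} {ε : C →ₐ[k] k} {act : S k E O →ₐ[k] Module.End k C}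
  {coder : (C →ₗ[k] (E × O)) →ₗ[k] Module.End k C} {i : ZMod 2} {t : C →ₗ[k] (E × O)}
  (h : IsShuffleSystem Δ γ ι p ε act coder)

include h

theorem isCoder_actCoder (ht : HasParity γ (par k E O) 1 t) {j : ZMod 2} {a : S k E O}
    (ha : sPar k E O a = sgn k j • a) : IsCoder Δ γ (1 + j) (actCoder ε act coder t a) :=
  h.coder_isCoder _ _ (h.hasParity_component ht ha)

theorem taylor_dualField_coder [FiniteDimensional k E] [FiniteDimensional k O]
    (s : C →ₗ[k] (E × O)) : taylor p (par k E O) i (dualField γ i (coder s)) = s := by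
  rw [taylor_dualField h.par_par h.proj_par]
  exact LinearMap.ext (h.proj_coder s)

/-- A vector field is determined by its components. -/
theorem exists_coder [FiniteDimensional k E] [FiniteDimensional k O]
    {δ : Module.End k (Module.Dual k C)} (hδ : δ ∈ vectorFields Δ γ i) :
    HasParity γ (par k E O) i (taylor p (par k E O) i δ)
      ∧ taylor p (par k E O) i δ 1 = 0
      ∧ δ = dualField γ i (coder (taylor p (par k E O) i δ)) := by
  obtain ⟨X, hX, hX1, rfl⟩ := IsVectorField.exists_coder h.par_par h.comul_par hδ
  rw [taylor_dualField h.par_par h.proj_par, h.coder_eq hX h.proj_par]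
  exact ⟨fun c => by simp [hX.parity.apply, h.proj_par], by simp [hX1], rfl⟩

theorem vectorField_ext [FiniteDimensional k E] [FiniteDimensional k O]
    {δ δ' : Module.End k (Module.Dual k C)} (hδ : δ ∈ vectorFields Δ γ i)
    (hδ' : δ' ∈ vectorFields Δ γ i)
    (he : taylor p (par k E O) i δ = taylor p (par k E O) i δ') : δ = δ' := by
  rw [(h.exists_coder hδ).2.2, (h.exists_coder hδ').2.2, he]

omit h in
/-- The component of the map of coalgebras that `t` induces. -/
def chi {K : ZMod 2 → Submodule k (Module.End k (Module.Dual k C))}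
    (h1 : ∀ a, dualField γ 1 (actCoder ε act coder t (evProj (sPar k E O).toLinearMap a)) ∈ K 1)
    (h0 : ∀ a, dualField γ 0 (actCoder ε act coder t (odProj (sPar k E O).toLinearMap a)) ∈ K 0) :
    S k E O →ₗ[k] (K 1 × K 0) where
  toFun a := (⟨_, h1 a⟩, ⟨_, h0 a⟩)
  map_add' a b := by ext1 <;> ext1 <;> simp [dualField_add]
  map_smul' r a := by ext1 <;> ext1 <;> simp [dualField_smul]

omit h in
/-- The even part of the quadratic expression in the Maurer–Cartan equation. -/
def bracketEven (A : S k E O →ₗ[k] Module.End k C) : S k E O ⊗[k] S k E O →ₗ[k] Module.End k C :=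
  LinearMap.mul' k _ ∘ₗ TensorProduct.map (A ∘ₗ odProj (sPar k E O).toLinearMap)
      (A ∘ₗ evProj (sPar k E O).toLinearMap)
    - LinearMap.mul' k _ ∘ₗ TensorProduct.map (A ∘ₗ evProj (sPar k E O).toLinearMap)
      (A ∘ₗ odProj (sPar k E O).toLinearMap)

omit h in
/-- The odd part of the quadratic expression in the Maurer–Cartan equation. -/
def bracketOdd (A : S k E O →ₗ[k] Module.End k C) : S k E O ⊗[k] S k E O →ₗ[k] Module.End k C :=
  LinearMap.mul' k _ ∘ₗ TensorProduct.map (A ∘ₗ odProj (sPar k E O).toLinearMap)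
      (A ∘ₗ odProj (sPar k E O).toLinearMap)
    - LinearMap.mul' k _ ∘ₗ TensorProduct.map (A ∘ₗ evProj (sPar k E O).toLinearMap)
      (A ∘ₗ evProj (sPar k E O).toLinearMap)

-- A graded commutator contains both orders of its factors. Added to the value on `x ⊗ y`, the value
-- on the exchanged tensor completes the products to commutators.
omit h in
theorem braid_bracketEven [CharZero k] (A : S k E O →ₗ[k] Module.End k C) (x y : S k E O) :
    bracketEven A (braid (sPar k E O).toLinearMap (x ⊗ₜ y))
      = A (odProj (sPar k E O).toLinearMap y) * A (evProj (sPar k E O).toLinearMap x)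
        - A (evProj (sPar k E O).toLinearMap y) * A (odProj (sPar k E O).toLinearMap x) := by
  have h1 := evProj_of_even (γ := (sPar k E O).toLinearMap) (sPar_evProj (k := k) x)
  have h2 := odProj_of_even (γ := (sPar k E O).toLinearMap) (sPar_evProj (k := k) x)
  have h3 := evProj_of_odd (γ := (sPar k E O).toLinearMap) (sPar_odProj (k := k) x)
  have h4 := odProj_of_odd (γ := (sPar k E O).toLinearMap) (sPar_odProj (k := k) x)
  have h5 : evProj (sPar k E O).toLinearMap (sPar k E O y)
        = evProj (sPar k E O).toLinearMap y := by
      simp [evProj_apply, sPar_sPar, add_comm]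
  rw [braid_tmul]
  simp only [bracketEven, LinearMap.comp_apply, LinearMap.sub_apply, map_add,
    TensorProduct.map_tmul, AlgHom.toLinearMap_apply, h1, h2, h3, h4, h5, map_zero,
    TensorProduct.tmul_zero, LinearMap.mul'_apply]
  abel

omit h in
theorem braid_bracketOdd [CharZero k] (A : S k E O →ₗ[k] Module.End k C) (x y : S k E O) :
    bracketOdd A (braid (sPar k E O).toLinearMap (x ⊗ₜ y))
      = -(A (odProj (sPar k E O).toLinearMap y) * A (odProj (sPar k E O).toLinearMap x))
        - A (evProj (sPar k E O).toLinearMap y) * A (evProj (sPar k E O).toLinearMap x) := by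
  have h1 := evProj_of_even (γ := (sPar k E O).toLinearMap) (sPar_evProj (k := k) x)
  have h2 := odProj_of_even (γ := (sPar k E O).toLinearMap) (sPar_evProj (k := k) x)
  have h3 := evProj_of_odd (γ := (sPar k E O).toLinearMap) (sPar_odProj (k := k) x)
  have h4 := odProj_of_odd (γ := (sPar k E O).toLinearMap) (sPar_odProj (k := k) x)
  have h5 : odProj (sPar k E O).toLinearMap (sPar k E O y)
        = -odProj (sPar k E O).toLinearMap y := by
      simp [odProj_apply, sPar_sPar, ← smul_neg]
  rw [braid_tmul]
  simp only [bracketOdd, LinearMap.comp_apply, LinearMap.sub_apply, map_add,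
    TensorProduct.map_tmul, AlgHom.toLinearMap_apply, h1, h2, h3, h4, h5, map_zero,
    TensorProduct.tmul_zero, LinearMap.mul'_apply, map_neg]
  refine LinearMap.ext fun c => ?_
  simp
  abel

/-- On a tensor `z` the bracket of `χ` with itself is dual to `bracketEven` on `z + braid z`. The
coproduct is fixed by `braid`, so the two summands agree there and `2⁻¹` cancels the factor two. -/
theorem dualField_bracketEven [CharZero k] (ht : HasParity γ (par k E O) 1 t)
    {K : ZMod 2 → Submodule k (Module.End k (Module.Dual k C))}
    (h1 : ∀ a, dualField γ 1 (actCoder ε act coder t (evProj (sPar k E O).toLinearMap a)) ∈ K 1)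
    (h0 : ∀ a, dualField γ 0 (actCoder ε act coder t (odProj (sPar k E O).toLinearMap a)) ∈ K 0)
    (hL : IsLieSubalgebra (A := Module.End k (Module.Dual k C)) (K 0) (K 1)) (a : S k E O) :
    (((2⁻¹ : k) • TensorProduct.lift (ceBracket hL)
        (TensorProduct.map (chi h1 h0) (chi h1 h0) (comul k E O a))).1 :
        Module.End k (Module.Dual k C))
      = dualField γ 1 (bracketEven (actCoder ε act coder t) (comul k E O a)) := by
  have hev : ∀ a, HasParity γ γ 1
      (actCoder ε act coder t (evProj (sPar k E O).toLinearMap a)) := fun a => by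
    simpa using (h.isCoder_actCoder ht (j := 0) (by rw [sgn_zero, one_smul, sPar_evProj])).parity
  have hod : ∀ a, HasParity γ γ 0
      (actCoder ε act coder t (odProj (sPar k E O).toLinearMap a)) := fun a => by
    simpa [zmod_two_one_add_one] using
      (h.isCoder_actCoder ht (j := 1) (by rw [sgn_one, neg_one_smul, sPar_odProj])).parity
  have key : ∀ z, ((TensorProduct.lift (ceBracket hL)
        (TensorProduct.map (chi h1 h0) (chi h1 h0) z)).1 : Module.End k (Module.Dual k C))
      = dualField γ 1 (bracketEven (actCoder ε act coder t)
          (z + braid (sPar k E O).toLinearMap z)) := by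
    intro z
    induction z with
    | zero => simp [dualField_zero]
    | add x y hx hy =>
      rw [map_add, map_add, Prod.fst_add, Submodule.coe_add, hx, hy, ← dualField_add, ← map_add,
        map_add (braid _), add_add_add_comm]
    | tmul x y =>
      rw [map_add, braid_bracketEven, TensorProduct.map_tmul, TensorProduct.lift.tmul,
        ceBracket_fst]
      simp only [chi, LinearMap.coe_mk, AddHom.coe_mk]
      rw [dualField_mul h.par_par (hod y), dualField_mul h.par_par (hev x),
        dualField_mul h.par_par (hev y), dualField_mul h.par_par (hod x)]
      simp only [zero_mul, mul_zero, sgn_zero, one_smul, add_zero, zero_add, ← dualField_sub,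
        bracketEven, LinearMap.comp_apply, LinearMap.sub_apply, TensorProduct.map_tmul,
        LinearMap.mul'_apply]
      congr 1
      abel
  rw [Prod.smul_fst, Submodule.coe_smul, key, braid_comul, ← two_smul k, map_smul, dualField_smul,
    smul_smul, inv_mul_cancel₀ two_ne_zero, one_smul]

theorem dualField_bracketOdd [CharZero k] (ht : HasParity γ (par k E O) 1 t)
    {K : ZMod 2 → Submodule k (Module.End k (Module.Dual k C))}
    (h1 : ∀ a, dualField γ 1 (actCoder ε act coder t (evProj (sPar k E O).toLinearMap a)) ∈ K 1)
    (h0 : ∀ a, dualField γ 0 (actCoder ε act coder t (odProj (sPar k E O).toLinearMap a)) ∈ K 0)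
    (hL : IsLieSubalgebra (A := Module.End k (Module.Dual k C)) (K 0) (K 1)) (a : S k E O) :
    (((2⁻¹ : k) • TensorProduct.lift (ceBracket hL)
        (TensorProduct.map (chi h1 h0) (chi h1 h0) (comul k E O a))).2 :
        Module.End k (Module.Dual k C))
      = dualField γ 0 (bracketOdd (actCoder ε act coder t) (comul k E O a)) := by
  have hev : ∀ a, HasParity γ γ 1
      (actCoder ε act coder t (evProj (sPar k E O).toLinearMap a)) := fun a => by
    simpa using (h.isCoder_actCoder ht (j := 0) (by rw [sgn_zero, one_smul, sPar_evProj])).parity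
  have hod : ∀ a, HasParity γ γ 0
      (actCoder ε act coder t (odProj (sPar k E O).toLinearMap a)) := fun a => by
    simpa [zmod_two_one_add_one] using
      (h.isCoder_actCoder ht (j := 1) (by rw [sgn_one, neg_one_smul, sPar_odProj])).parity
  have key : ∀ z, ((TensorProduct.lift (ceBracket hL)
        (TensorProduct.map (chi h1 h0) (chi h1 h0) z)).2 : Module.End k (Module.Dual k C))
      = dualField γ 0 (bracketOdd (actCoder ε act coder t)
          (z + braid (sPar k E O).toLinearMap z)) := by
    intro z
    induction z with
    | zero => simp [dualField_zero]
    | add x y hx hy =>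
      rw [map_add, map_add, Prod.snd_add, Submodule.coe_add, hx, hy, ← dualField_add, ← map_add,
        map_add (braid _), add_add_add_comm]
    | tmul x y =>
      rw [map_add, braid_bracketOdd, TensorProduct.map_tmul, TensorProduct.lift.tmul,
        ceBracket_snd]
      simp only [chi, LinearMap.coe_mk, AddHom.coe_mk]
      rw [dualField_mul h.par_par (hod y), dualField_mul h.par_par (hev x),
        dualField_mul h.par_par (hev y), dualField_mul h.par_par (hod x)]
      simp only [mul_zero, mul_one, sgn_zero, sgn_one, one_smul, add_zero, zmod_two_one_add_one,
        ← dualField_smul, ← dualField_sub, ← dualField_add,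
        bracketOdd, LinearMap.comp_apply, LinearMap.sub_apply, TensorProduct.map_tmul,
        LinearMap.mul'_apply]
      congr 1
      module
  rw [Prod.smul_snd, Submodule.coe_smul, key, braid_comul, ← two_smul k, map_smul, dualField_smul,
    smul_smul, inv_mul_cancel₀ two_ne_zero, one_smul]

/-- The differential is odd, so the even part of `d a` comes from the odd part of `a`. The parity
involution in `component_sCoder` then gives the two products in `bracketEven` opposite signs. -/
theorem component_even [CharZero k] (ht : HasParity γ (par k E O) 1 t)
    (hsq : coder t * coder t = 0) (a : S k E O) (c : C) :
    component ε act t (evProj (sPar k E O).toLinearMap (sCoder (orbit act t) a)) c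
      = p (bracketEven (actCoder ε act coder t) (comul k E O a) c) := by
  have hd : ∀ x, sCoder (orbit act t) (sPar k E O x) = -sPar k E O (sCoder (orbit act t) x) :=
    fun x => by simpa [sgn_one] using sCoder_parity (h.hasParity_orbit ht) x
  have e : evProj (sPar k E O).toLinearMap (sCoder (orbit act t) a)
      = sCoder (orbit act t) (odProj (sPar k E O).toLinearMap a) := by
    simp [evProj_apply, odProj_apply, hd]
  rw [e, h.component_sCoder ht hsq, comul_odProj, ← map_neg, ← LinearMap.neg_apply]
  congr 2
  generalize comul k E O a = z
  induction z with
  | zero => simp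
  | tmul x y =>
    refine LinearMap.ext fun c => ?_
    simp [bracketEven, sPar_evProj, sPar_odProj]
    abel
  | add x y hx hy =>
    simp only [map_add] at hx hy ⊢
    linear_combination (norm := module) hx + hy

theorem component_odd [CharZero k] (ht : HasParity γ (par k E O) 1 t)
    (hsq : coder t * coder t = 0) (a : S k E O) (c : C) :
    component ε act t (odProj (sPar k E O).toLinearMap (sCoder (orbit act t) a)) c
      = p (bracketOdd (actCoder ε act coder t) (comul k E O a) c) := by
  have hd : ∀ x, sCoder (orbit act t) (sPar k E O x) = -sPar k E O (sCoder (orbit act t) x) :=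
    fun x => by simpa [sgn_one] using sCoder_parity (h.hasParity_orbit ht) x
  have e : odProj (sPar k E O).toLinearMap (sCoder (orbit act t) a)
      = sCoder (orbit act t) (evProj (sPar k E O).toLinearMap a) := by
    simp [evProj_apply, odProj_apply, hd, sub_eq_add_neg]
  rw [e, h.component_sCoder ht hsq, comul_evProj, ← map_neg, ← LinearMap.neg_apply]
  congr 2
  generalize comul k E O a = z
  induction z with
  | zero => simp
  | tmul x y =>
    refine LinearMap.ext fun c => ?_
    simp [bracketOdd, sPar_evProj, sPar_odProj]
    abel
  | add x y hx hy =>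
    simp only [map_add] at hx hy ⊢
    linear_combination (norm := module) hx + hy

/-- Here `K` stands for all vector fields or for the symplectic ones. Equality in `K` may be tested
among all vector fields, so besides closure under the bracket only the values of `χ`, as in `hmem`,
need to lie in `K`. -/
theorem hasCEMap [CharZero k] [FiniteDimensional k E] [FiniteDimensional k O]
    {m : Module.End k (Module.Dual k C)} (hm : m ∈ vectorFields Δ γ 1) (hmm : m * m = 0)
    (ht : t = taylor p (par k E O) 1 m)
    {K : ZMod 2 → Submodule k (Module.End k (Module.Dual k C))}
    (hK : ∀ i, K i ≤ vectorFields Δ γ i)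
    (hL : IsLieSubalgebra (A := Module.End k (Module.Dual k C)) (K 0) (K 1))
    (hmem : ∀ j a, sPar k E O a = sgn k j • a →
      dualField γ (1 + j) (actCoder ε act coder t a) ∈ K (1 + j))
    {value : (S k E O →ₗ[k] (K 1 × K 0)) → Prop}
    (hval : ∀ ψ : S k E O →ₗ[k] (K 1 × K 0), value ψ ↔ ∀ a c,
      taylor p (par k E O) 1 ((ψ a).1 : Module.End k (Module.Dual k C)) c
        + taylor p (par k E O) 0 ((ψ a).2 : Module.End k (Module.Dual k C)) c
        = component ε act t a c) :
    HasCEMap (A := Module.End k (Module.Dual k C)) (sCoder (orbit act t)) (K 0) (K 1) value := by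
  obtain ⟨hpar, hone, hmt⟩ := h.exists_coder hm
  rw [← ht] at hpar hone hmt
  have hsq : coder t * coder t = 0 := by
    have hc := h.coder_isCoder 1 t hpar
    have : dualField γ (1 + 1) (coder t * coder t) = dualField γ (1 + 1) 0 := by
      have h2 := hmm
      rw [hmt, dualField_mul h.par_par hc.parity, mul_one, sgn_one] at h2
      rw [dualField_zero, ← smul_right_injective _ (neg_ne_zero.mpr (one_ne_zero (α := k))) |>.eq_iff,
        smul_zero]
      exact h2
    exact dualField_injective h.par_par this
  have h1 : ∀ a, dualField γ 1 (actCoder ε act coder t (evProj (sPar k E O).toLinearMap a))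
      ∈ K 1 := fun a => by simpa using hmem 0 _ (by rw [sgn_zero, one_smul, sPar_evProj])
  have h0 : ∀ a, dualField γ 0 (actCoder ε act coder t (odProj (sPar k E O).toLinearMap a))
      ∈ K 0 := fun a => by
    simpa [zmod_two_one_add_one] using hmem 1 _ (by rw [sgn_one, neg_one_smul, sPar_odProj])
  set χ := chi h1 h0 with hχ
  have hcomp : ∀ s : C →ₗ[k] (E × O), ∀ i, taylor p (par k E O) i (dualField γ i (coder s)) = s :=
    fun s i => h.taylor_dualField_coder s
  have hχ1 : ∀ a, taylor p (par k E O) 1 ((χ a).1 : Module.End k (Module.Dual k C))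
      = component ε act t (evProj (sPar k E O).toLinearMap a) := fun a => hcomp _ 1
  have hχ0 : ∀ a, taylor p (par k E O) 0 ((χ a).2 : Module.End k (Module.Dual k C))
      = component ε act t (odProj (sPar k E O).toLinearMap a) := fun a => hcomp _ 0
  have hvalχ : ∀ a c, taylor p (par k E O) 1 ((χ a).1 : Module.End k (Module.Dual k C)) c
        + taylor p (par k E O) 0 ((χ a).2 : Module.End k (Module.Dual k C)) c
        = component ε act t a c := fun a c => by
    rw [hχ1, hχ0, ← LinearMap.add_apply, ← map_add, evProj_add_odProj]
  have hdc := sCoder_isCoder (h.hasParity_orbit hpar)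
  refine hasCEMap_of_maurerCartan hL hdc (h.coder_coder_orbit hpar hsq) (χ := χ) (fun a => ?_)
    (fun a => ?_) ((hval χ).mpr hvalχ) (fun ψ hψ => ?_)
  · have he : evProj (sPar k E O).toLinearMap (sPar k E O a)
        = evProj (sPar k E O).toLinearMap a := by
      simp [evProj_apply, sPar_sPar, add_comm]
    have ho : odProj (sPar k E O).toLinearMap (sPar k E O a)
        = -odProj (sPar k E O).toLinearMap a := by
      simp [odProj_apply, sPar_sPar, ← smul_neg]
    ext1 <;> ext1
    · simp [hχ, chi, he, par_apply]
    · simp only [hχ, chi, ho, par_apply, LinearMap.coe_mk, AddHom.coe_mk, map_neg]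
      refine LinearMap.ext fun f => LinearMap.ext fun c => ?_
      simp [dualField_apply]
      rfl
  -- The two parities of the Maurer–Cartan equation, each tested on components, since these
  -- determine a vector field.
  · ext1 <;> ext1
    · refine h.vectorField_ext (hK 1 (χ _).1.2) (hK 1 (Prod.fst (_ : K 1 × K 0)).2) ?_
      rw [hχ1, h.dualField_bracketEven hpar h1 h0, taylor_dualField h.par_par h.proj_par]
      exact LinearMap.ext (h.component_even hpar hsq a)
    · refine h.vectorField_ext (hK 0 (χ _).2.2) (hK 0 (Prod.snd (_ : K 1 × K 0)).2) ?_
      rw [hχ0, h.dualField_bracketOdd hpar h1 h0, taylor_dualField h.par_par h.proj_par]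
      exact LinearMap.ext (h.component_odd hpar hsq a)
  · have hψ' := (hval ψ).mp hψ
    have hsplit : ∀ a, taylor p (par k E O) 1 ((ψ a).1 : Module.End k (Module.Dual k C))
          = taylor p (par k E O) 1 ((χ a).1 : Module.End k (Module.Dual k C))
        ∧ taylor p (par k E O) 0 ((ψ a).2 : Module.End k (Module.Dual k C))
          = taylor p (par k E O) 0 ((χ a).2 : Module.End k (Module.Dual k C)) := by
      intro a
      have p1 := (h.exists_coder (hK 1 (ψ a).1.2)).1
      have p1' := (h.exists_coder (hK 1 (χ a).1.2)).1
      have p0 := (h.exists_coder (hK 0 (ψ a).2.2)).1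
      have p0' := (h.exists_coder (hK 0 (χ a).2.2)).1
      have e : ∀ c, _ := fun c => (hψ' a c).trans (hvalχ a c).symm
      generalize taylor p (par k E O) 1 ((ψ a).1 : Module.End k (Module.Dual k C)) = s1 at *
      generalize taylor p (par k E O) 1 ((χ a).1 : Module.End k (Module.Dual k C)) = s1' at *
      generalize taylor p (par k E O) 0 ((ψ a).2 : Module.End k (Module.Dual k C)) = s0 at *
      generalize taylor p (par k E O) 0 ((χ a).2 : Module.End k (Module.Dual k C)) = s0' at *
      -- The formula prescribes only the sum of an odd and an even component. Evaluating at `γ c`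
      -- and applying the parity involution changes the sign of the odd one, which separates them.
      have e1 : ∀ c, s1 c = s1' c := by
        intro c
        have e2 := congrArg (par k E O) (e (γ c))
        simp only [p1.apply, p1'.apply, p0.apply, p0'.apply, sgn_one, sgn_zero, one_smul,
          neg_smul, map_add, map_neg, SuperCE.par_par] at e2
        have e3 := e c
        have : (2 : k) • s1 c = (2 : k) • s1' c := by
          linear_combination (norm := module) e3 - e2
        exact smul_right_injective _ two_ne_zero this
      exact ⟨LinearMap.ext e1, LinearMap.ext fun c => by simpa [e1] using e c⟩
    ext1 a
    ext1 <;> ext1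
    · exact h.vectorField_ext (hK 1 (ψ a).1.2) (hK 1 (χ a).1.2) (hsplit a).1
    · exact h.vectorField_ext (hK 0 (ψ a).2.2) (hK 0 (χ a).2.2) (hsplit a).2

end IsShuffleSystem

end

/-! ### The tensor coalgebra -/

section TensorCoalgebra

variable {k E O : Type*} [Field k] [AddCommGroup E] [Module k E] [AddCommGroup O] [Module k O]

variable (k E O) in
/-- The counit of `T U`. -/
abbrev tCounit : T k E O →ₐ[k] k := TensorAlgebra.algebraMapInv

theorem tCounit_ι_mul (u : E × O) (c : T k E O) : tCounit k E O (tι k E O u * c) = 0 := by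
  simp [TensorAlgebra.algebraMapInv]

theorem tProj_one : tProj k E O 1 = 0 := by
  let _ : Module kᵐᵒᵖ (E × O) := Module.compHom _ ((RingHom.id k).fromOpposite mul_comm)
  have : IsCentralScalar k (E × O) := ⟨fun r m => rfl⟩
  simp [TensorAlgebra.ιInv]

theorem tProj_ι_mul (u : E × O) (c : T k E O) :
    tProj k E O (tι k E O u * c) = tCounit k E O c • u := by
  let _ : Module kᵐᵒᵖ (E × O) := Module.compHom _ ((RingHom.id k).fromOpposite mul_comm)
  have : IsCentralScalar k (E × O) := ⟨fun r m => rfl⟩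
  have h : ∀ c : T k E O, (TensorAlgebra.toTrivSqZeroExt c).fst = tCounit k E O c := by
    intro c
    induction c using T_induction with
    | one => simp
    | add x y hx hy => simp [hx, hy]
    | smul r x hx => simp [hx]
    | ι_mul u x hx => simp [TensorAlgebra.toTrivSqZeroExt_ι, tCounit_ι_mul]
  have : tProj k E O (tι k E O u * c) = (TensorAlgebra.toTrivSqZeroExt (tι k E O u * c)).snd := rfl
  rw [this, map_mul, TensorAlgebra.toTrivSqZeroExt_ι]
  simp [h]

theorem tProj_ι (u : E × O) : tProj k E O (tι k E O u) = u := by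
  simpa using tProj_ι_mul (k := k) u 1

theorem tPar_even (a : E) : tPar k E O (tι k E O (a, 0)) = tι k E O (a, 0) := by
  simp [tPar_ι, par]

theorem tPar_odd (b : O) : tPar k E O (tι k E O (0, b)) = -tι k E O (0, b) := by
  rw [tPar_ι, ← map_neg]; simp [par]

theorem tPar_tPar (c : T k E O) : tPar k E O (tPar k E O c) = c := by
  induction c using T_induction with
  | one => simp
  | add x y hx hy => simp [hx, hy]
  | smul r x hx => simp [hx]
  | ι_mul u x hx => rw [map_mul, map_mul, hx, tPar_ι, tPar_ι, par_par]

theorem tCounit_tPar (c : T k E O) : tCounit k E O (tPar k E O c) = tCounit k E O c := by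
  induction c using T_induction with
  | one => simp
  | add x y hx hy => simp [hx, hy]
  | smul r x hx => simp [hx]
  | ι_mul u x hx => rw [map_mul, tPar_ι, tCounit_ι_mul, tCounit_ι_mul]

theorem tProj_tPar (c : T k E O) : tProj k E O (tPar k E O c) = par k E O (tProj k E O c) := by
  induction c using T_induction with
  | one => rw [map_one, tProj_one, map_zero]
  | add x y hx hy => simp only [map_add, hx, hy]
  | smul r x hx => simp only [map_smul, hx]
  | ι_mul u x hx => rw [map_mul, tPar_ι, tProj_ι_mul, tProj_ι_mul, tCounit_tPar, map_smul]

theorem deconc_tPar (c : T k E O) : deconc k E O (tPar k E O c)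
    = TensorProduct.map (tPar k E O).toLinearMap (tPar k E O).toLinearMap (deconc k E O c) := by
  induction c using T_induction with
  | one => simp [deconc_one]
  | add x y hx hy => simp only [map_add, hx, hy]
  | smul r x hx => simp only [map_smul, hx]
  | ι_mul u x hx =>
    rw [map_mul, tPar_ι, deconc_ι_mul, deconc_ι_mul, hx, map_add]
    congr 1
    · simp [tPar_ι]
    · generalize deconc k E O x = z
      induction z with
      | zero => simp
      | tmul x y => simp [tPar_ι]
      | add x y hx hy => simp only [map_add, mul_add, hx, hy]

theorem counit_deconc {M : Type*} [AddCommGroup M] [Module k M] (f : T k E O →ₗ[k] M)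
    (c : T k E O) : TensorProduct.lid k M
      (TensorProduct.map (tCounit k E O).toLinearMap f (deconc k E O c)) = f c := by
  induction c using T_induction with
  | one => simp [deconc_one]
  | add x y hx hy => simp only [map_add, hx, hy]
  | smul r x hx => simp only [map_smul, hx]
  | ι_mul u x hx =>
    rw [deconc_ι_mul, map_add, map_add]
    have h0 : ∀ z : T k E O ⊗[k] T k E O, TensorProduct.map (tCounit k E O).toLinearMap f
        ((tι k E O u ⊗ₜ 1) * z) = 0 := by
      intro z
      induction z with
      | zero => simp
      | tmul x y => simp [tCounit_ι_mul]
      | add x y hx hy => simp only [map_add, mul_add, hx, hy, add_zero]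
    simp [h0]

theorem deconc_counit {M : Type*} [AddCommGroup M] [Module k M] (f : T k E O →ₗ[k] M)
    (c : T k E O) : TensorProduct.rid k M
      (TensorProduct.map f (tCounit k E O).toLinearMap (deconc k E O c)) = f c := by
  induction c using T_induction generalizing f with
  | one => simp [deconc_one]
  | add x y hx hy => simp only [map_add, hx, hy]
  | smul r x hx => simp only [map_smul, hx]
  | ι_mul u x hx =>
    rw [deconc_ι_mul, map_add, map_add]
    have h0 : ∀ z : T k E O ⊗[k] T k E O, TensorProduct.map f (tCounit k E O).toLinearMap
        ((tι k E O u ⊗ₜ 1) * z) = TensorProduct.map (f ∘ₗ LinearMap.mulLeft k (tι k E O u))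
          (tCounit k E O).toLinearMap z := by
      intro z
      induction z with
      | zero => simp
      | tmul x y => simp
      | add x y hx hy => simp only [map_add, mul_add, hx, hy]
    rw [h0, hx]
    simp [tCounit_ι_mul]

/-- The map `c ↦ ∑ t(c₍₁₎) c₍₂₎` on `T U`. -/
def headMap : (T k E O →ₗ[k] (E × O)) →ₗ[k] Module.End k (T k E O) where
  toFun t := LinearMap.mul' k (T k E O) ∘ₗ TensorProduct.map (tι k E O ∘ₗ t) LinearMap.id ∘ₗ
    deconc k E O
  map_add' s t := by
    simp only [LinearMap.comp_add, TensorProduct.map_add_left, LinearMap.add_comp]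
  map_smul' r t := by
    simp only [LinearMap.comp_smul, TensorProduct.map_smul_left, LinearMap.smul_comp,
      RingHom.id_apply]

theorem headMap_apply (t : T k E O →ₗ[k] (E × O)) (c : T k E O) : headMap t c
    = LinearMap.mul' k _ (TensorProduct.map (tι k E O ∘ₗ t) LinearMap.id (deconc k E O c)) := rfl

theorem headMap_one (t : T k E O →ₗ[k] (E × O)) : headMap t 1 = tι k E O (t 1) := by
  simp [headMap_apply, deconc_one]

theorem headMap_ι_mul (t : T k E O →ₗ[k] (E × O)) (u : E × O) (c : T k E O) :
    headMap t (tι k E O u * c) = tι k E O (t 1) * (tι k E O u * c)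
      + headMap (t ∘ₗ LinearMap.mulLeft k (tι k E O u)) c := by
  rw [headMap_apply, deconc_ι_mul, map_add, map_add, headMap_apply]
  refine congrArg₂ (· + ·) ?_ ?_
  · simp
  · generalize deconc k E O c = z
    induction z with
    | zero => simp
    | tmul x y => simp
    | add x y hx hy => simp only [map_add, mul_add, hx, hy]

/-- The first letter of `t(c₍₁₎) c₍₂₎` is `t(c₍₁₎)`, so a cut lies either in front of it or behind
it, and in the latter case it is a cut of `c₍₂₎`. -/
theorem deconc_headMap (t : T k E O →ₗ[k] (E × O)) (c : T k E O) : deconc k E O (headMap t c)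
    = 1 ⊗ₜ headMap t c + TensorProduct.map (headMap t) LinearMap.id (deconc k E O c) := by
  induction c using T_induction generalizing t with
  | one =>
    have := deconc_ι_mul k E O (t 1) 1
    rw [mul_one] at this
    simp [headMap_one, deconc_one, this]
  | add x y hx hy => simp only [map_add, hx, hy, TensorProduct.tmul_add]; abel
  | smul r x hx => simp only [map_smul, hx, TensorProduct.tmul_smul, smul_add]
  | ι_mul u x hx =>
    rw [headMap_ι_mul, map_add, hx, deconc_ι_mul, deconc_ι_mul, map_add, TensorProduct.map_tmul,
      headMap_one, TensorProduct.tmul_add]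
    have : ∀ z : T k E O ⊗[k] T k E O,
        TensorProduct.map (headMap t) LinearMap.id ((tι k E O u ⊗ₜ 1) * z)
          = (tι k E O (t 1) ⊗ₜ 1) * ((tι k E O u ⊗ₜ 1) * z)
            + TensorProduct.map (headMap (t ∘ₗ LinearMap.mulLeft k (tι k E O u))) LinearMap.id z := by
      intro z
      induction z with
      | zero => simp
      | tmul x y => simp [headMap_ι_mul, TensorProduct.add_tmul]
      | add x y hx hy => simp only [map_add, mul_add, hx, hy]; abel
    rw [this]
    simp only [mul_add, Algebra.TensorProduct.tmul_mul_tmul, one_mul, mul_one, LinearMap.id_apply]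
    abel

theorem tCounit_headMap (t : T k E O →ₗ[k] (E × O)) (c : T k E O) :
    tCounit k E O (headMap t c) = 0 := by
  rw [headMap_apply]
  generalize deconc k E O c = z
  induction z with
  | zero => simp
  | tmul x y => simp only [TensorProduct.map_tmul, LinearMap.mul'_apply, LinearMap.comp_apply,
      tCounit_ι_mul]
  | add x y hx hy => simp only [map_add, hx, hy, add_zero]

theorem tProj_headMap (t : T k E O →ₗ[k] (E × O)) (c : T k E O) :
    tProj k E O (headMap t c) = t c := by
  rw [headMap_apply, ← deconc_counit t]
  generalize deconc k E O c = z
  induction z with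
  | zero => simp
  | tmul x y => simp only [TensorProduct.map_tmul, LinearMap.mul'_apply, LinearMap.comp_apply,
      tProj_ι_mul, TensorProduct.rid_tmul, LinearMap.id_apply, AlgHom.toLinearMap_apply]
  | add x y hx hy => simp only [map_add, hx, hy]

/-- Splitting off the first letter and multiplying it back. For `T U` this plays the role of the
Euler operator, with no denominators. -/
theorem headMap_tProj (c : T k E O) :
    headMap (tProj k E O) c = c - algebraMap k _ (tCounit k E O c) := by
  induction c using T_induction with
  | one => rw [headMap_one, tProj_one]; simp
  | add x y hx hy => simp only [map_add, hx, hy]; abel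
  | smul r x hx => simp only [map_smul, hx, smul_sub, Algebra.algebraMap_eq_smul_one, smul_assoc]
  | ι_mul u x hx =>
    rw [headMap_ι_mul, tProj_one, tCounit_ι_mul, map_zero, map_zero, zero_mul, zero_add, sub_zero,
      headMap_apply]
    have h := counit_deconc (LinearMap.mulLeft k (tι k E O u)) x
    rw [LinearMap.mulLeft_apply] at h
    rw [← h]
    generalize deconc k E O x = z
    induction z with
    | zero => simp
    | tmul x y =>
      simp [tProj_ι_mul]
    | add x y hx hy => simp only [map_add, hx, hy]

/-- The map `c ↦ ∑ γ^i(c₍₁₎) t(c₍₂₎) c₍₃₎` on `T U`. -/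
def tCoderOf (i : ZMod 2) : (T k E O →ₗ[k] (E × O)) →ₗ[k] Module.End k (T k E O) where
  toFun t := LinearMap.mul' k (T k E O) ∘ₗ
    TensorProduct.map (parPow (tPar k E O).toLinearMap i) (headMap t) ∘ₗ deconc k E O
  map_add' s t := by
    simp only [map_add, TensorProduct.map_add_right, LinearMap.add_comp, LinearMap.comp_add]
  map_smul' r t := by
    simp only [map_smul, TensorProduct.map_smul_right, LinearMap.smul_comp, LinearMap.comp_smul,
      RingHom.id_apply]

theorem tCoderOf_apply (i : ZMod 2) (t : T k E O →ₗ[k] (E × O)) (c : T k E O) : tCoderOf i t c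
    = LinearMap.mul' k _ (TensorProduct.map (parPow (tPar k E O).toLinearMap i) (headMap t)
      (deconc k E O c)) := rfl

theorem parPow_tPar_one (i : ZMod 2) : parPow (tPar k E O).toLinearMap i 1 = 1 := by
  rcases zmod_two_cases i with rfl | rfl <;> simp [parPow]

theorem parPow_tPar_mul (i : ZMod 2) (x y : T k E O) : parPow (tPar k E O).toLinearMap i (x * y)
    = parPow (tPar k E O).toLinearMap i x * parPow (tPar k E O).toLinearMap i y := by
  rcases zmod_two_cases i with rfl | rfl <;> simp [parPow]

theorem parPow_tPar_ι (i : ZMod 2) (u : E × O) : parPow (tPar k E O).toLinearMap i (tι k E O u)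
    = tι k E O (parPow (par k E O) i u) := by
  rcases zmod_two_cases i with rfl | rfl <;> simp [parPow, tPar_ι]

theorem tCoderOf_one (i : ZMod 2) (t : T k E O →ₗ[k] (E × O)) :
    tCoderOf i t 1 = tι k E O (t 1) := by
  simp [tCoderOf_apply, deconc_one, headMap_one, parPow_tPar_one]

theorem tCoderOf_ι_mul (i : ZMod 2) (t : T k E O →ₗ[k] (E × O)) (u : E × O) (c : T k E O) :
    tCoderOf i t (tι k E O u * c) = headMap t (tι k E O u * c)
      + tι k E O (parPow (par k E O) i u) * tCoderOf i t c := by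
  rw [tCoderOf_apply, deconc_ι_mul, map_add, map_add, tCoderOf_apply]
  congr 1
  · simp [parPow_tPar_one]
  · generalize deconc k E O c = z
    induction z with
    | zero => simp
    | tmul x y => simp [parPow_tPar_mul, parPow_tPar_ι, mul_assoc]
    | add x y hx hy => simp only [map_add, mul_add, hx, hy]

theorem headMap_parity {i : ZMod 2} {t : T k E O →ₗ[k] (E × O)}
    (ht : HasParity (tPar k E O).toLinearMap (par k E O) i t) :
    HasParity (tPar k E O).toLinearMap (tPar k E O).toLinearMap i (headMap t) := by
  intro c
  rw [headMap_apply, headMap_apply, AlgHom.toLinearMap_apply, deconc_tPar]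
  generalize deconc k E O c = z
  induction z with
  | zero => simp
  | tmul x y =>
    have := ht.apply x
    rw [AlgHom.toLinearMap_apply] at this
    simp [this, tPar_ι]
  | add x y hx hy => simp only [map_add, smul_add, hx, hy]

theorem tCoderOf_isCoder {i : ZMod 2} {t : T k E O →ₗ[k] (E × O)}
    (ht : HasParity (tPar k E O).toLinearMap (par k E O) i t) :
    IsCoder (deconc k E O) (tPar k E O).toLinearMap i (tCoderOf i t) where
  parity c := by
    rw [tCoderOf_apply, tCoderOf_apply, AlgHom.toLinearMap_apply, deconc_tPar]
    generalize deconc k E O c = z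
    induction z with
    | zero => simp
    | tmul x y =>
      have := (headMap_parity ht).apply y
      rw [AlgHom.toLinearMap_apply] at this
      rcases zmod_two_cases i with rfl | rfl <;> simp [this, parPow]
    | add x y hx hy => simp only [map_add, smul_add, hx, hy]
  coleibniz c := by
    induction c using T_induction with
    | one =>
      have := deconc_ι_mul k E O (t 1) 1
      rw [mul_one] at this
      simp [tCoderOf_one, deconc_one, this, parPow_tPar_one, add_comm]
    | add x y hx hy => simp only [map_add, hx, hy]; abel
    | smul r x hx => simp only [map_smul, hx, smul_add]
    | ι_mul u x hx =>
      have h1 : ∀ z : T k E O ⊗[k] T k E O,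
          TensorProduct.map (tCoderOf i t) LinearMap.id ((tι k E O u ⊗ₜ 1) * z)
            = TensorProduct.map (headMap t) LinearMap.id ((tι k E O u ⊗ₜ 1) * z)
              + (tι k E O (parPow (par k E O) i u) ⊗ₜ 1)
                * TensorProduct.map (tCoderOf i t) LinearMap.id z := by
        intro z
        induction z with
        | zero => simp
        | tmul x y => simp [tCoderOf_ι_mul, TensorProduct.add_tmul]
        | add x y hx hy => simp only [map_add, mul_add, hx, hy]; abel
      have h2 : ∀ z : T k E O ⊗[k] T k E O,
          TensorProduct.map (parPow (tPar k E O).toLinearMap i) (tCoderOf i t)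
              ((tι k E O u ⊗ₜ 1) * z)
            = (tι k E O (parPow (par k E O) i u) ⊗ₜ 1)
                * TensorProduct.map (parPow (tPar k E O).toLinearMap i) (tCoderOf i t) z := by
        intro z
        induction z with
        | zero => simp
        | tmul x y => simp [parPow_tPar_mul, parPow_tPar_ι]
        | add x y hx hy => simp only [map_add, mul_add, hx, hy]
      rw [tCoderOf_ι_mul, map_add, deconc_headMap, deconc_ι_mul, deconc_ι_mul, hx, map_add, map_add,
        map_add, h1, h2]
      simp only [TensorProduct.map_tmul, tCoderOf_one, headMap_one, parPow_tPar_one,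
        tCoderOf_ι_mul, TensorProduct.tmul_add, mul_add]
      abel

theorem tCounit_tCoderOf (i : ZMod 2) (t : T k E O →ₗ[k] (E × O)) (c : T k E O) :
    tCounit k E O (tCoderOf i t c) = 0 := by
  induction c using T_induction with
  | one => rw [tCoderOf_one, ← mul_one (tι k E O _), tCounit_ι_mul]
  | add x y hx hy => simp only [map_add, hx, hy, add_zero]
  | smul r x hx => simp only [map_smul, hx, smul_zero]
  | ι_mul u x hx => rw [tCoderOf_ι_mul, map_add, tCounit_headMap, tCounit_ι_mul, add_zero]

theorem tProj_tCoderOf (i : ZMod 2) (t : T k E O →ₗ[k] (E × O)) (c : T k E O) :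
    tProj k E O (tCoderOf i t c) = t c := by
  induction c using T_induction with
  | one => rw [tCoderOf_one, tProj_ι]
  | add x y hx hy => simp only [map_add, hx, hy]
  | smul r x hx => simp only [map_smul, hx]
  | ι_mul u x hx =>
    rw [tCoderOf_ι_mul, map_add, tProj_headMap, tProj_ι_mul, tCounit_tCoderOf, zero_smul, add_zero]

/-- A coderivation of `T U` is determined by its corestriction to `U`. -/
theorem tCoder_eq_zero {i : ZMod 2} {X : Module.End k (T k E O)}
    (hX : IsCoder (deconc k E O) (tPar k E O).toLinearMap i X)
    (hp : ∀ c, tProj k E O (X c) = 0) : X = 0 := by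
  have hε : ∀ c, tCounit k E O (X c) = 0 := by
    intro c
    have h1 := counit_deconc (tCounit k E O).toLinearMap (X c)
    have h2 := counit_deconc ((tCounit k E O).toLinearMap ∘ₗ X) c
    have h3 := deconc_counit ((tCounit k E O).toLinearMap ∘ₗ X) c
    rw [hX.coleibniz, map_add, map_add] at h1
    have h4 : (tCounit k E O).toLinearMap ∘ₗ parPow (tPar k E O).toLinearMap i
        = (tCounit k E O).toLinearMap := by
      ext1 c
      rcases zmod_two_cases i with rfl | rfl <;> simp [parPow, tCounit_tPar]
    rw [TensorProduct.map_map, TensorProduct.map_map, h4, h2, LinearMap.comp_id] at h1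
    have h5 : ∀ z : k ⊗[k] k, TensorProduct.lid k k z = TensorProduct.rid k k z := by
      intro z
      induction z with
      | zero => simp
      | tmul x y => simp [mul_comm]
      | add x y hx hy => simp only [map_add, hx, hy]
    rw [h5, h3] at h1
    simpa using h1
  -- `X c` is rebuilt from its first letter and the rest. By the co-Leibniz rule and `hp` the first
  -- letter comes from `c`.
  have key : ∀ c, X c = LinearMap.mul' k _ (TensorProduct.map
      (tι k E O ∘ₗ tProj k E O ∘ₗ parPow (tPar k E O).toLinearMap i) X (deconc k E O c)) := by
    intro c
    have h1 := headMap_tProj (X c)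
    rw [hε, map_zero, sub_zero, headMap_apply, hX.coleibniz, map_add, map_add] at h1
    have h0 : tProj k E O ∘ₗ X = 0 := LinearMap.ext hp
    rw [TensorProduct.map_map, TensorProduct.map_map, LinearMap.comp_assoc, h0, LinearMap.comp_zero,
      TensorProduct.map_zero_left, LinearMap.zero_apply, map_zero, zero_add] at h1
    exact h1.symm
  ext1 c
  induction c using T_induction with
  | one => rw [key, deconc_one]; simp [parPow_tPar_one, tProj_one]
  | add x y hx hy => simp only [map_add, hx, hy]
  | smul r x hx => simp only [map_smul, hx]
  | ι_mul u x hx =>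
    -- For the word `u x` the only remaining cut is the one behind `u`, and it leaves a letter times
    -- `X x`, which is zero by induction.
    have h1 := counit_deconc (LinearMap.mulLeft k (tι k E O (parPow (par k E O) i u)) ∘ₗ X) x
    rw [LinearMap.comp_apply, hx, LinearMap.zero_apply, map_zero] at h1
    rw [key, deconc_ι_mul, map_add, map_add]
    have h2 : LinearMap.mul' k _ (TensorProduct.map
        (tι k E O ∘ₗ tProj k E O ∘ₗ parPow (tPar k E O).toLinearMap i) X
          ((1 : T k E O) ⊗ₜ (tι k E O u * x))) = 0 := by
      simp [parPow_tPar_one, tProj_one]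
    rw [h2, zero_add, LinearMap.zero_apply, ← h1]
    have hc : ∀ c, tCounit k E O (parPow (tPar k E O).toLinearMap i c) = tCounit k E O c := by
      intro c
      rcases zmod_two_cases i with rfl | rfl <;> simp [parPow, tCounit_tPar]
    generalize deconc k E O x = z
    induction z with
    | zero => simp
    | tmul x y =>
      simp only [Algebra.TensorProduct.tmul_mul_tmul, one_mul, TensorProduct.map_tmul,
        LinearMap.mul'_apply, LinearMap.comp_apply, parPow_tPar_mul, parPow_tPar_ι, tProj_ι_mul,
        TensorProduct.lid_tmul, LinearMap.mulLeft_apply, AlgHom.toLinearMap_apply, hc,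
        map_smul, smul_mul_assoc]
    | add x y hx hy => simp only [map_add, mul_add, hx, hy]

variable (k E O) in
/-- The part of parity `i` of a map `T U → U`. -/
def homPart (i : ZMod 2) : (T k E O →ₗ[k] (E × O)) →ₗ[k] (T k E O →ₗ[k] (E × O)) where
  toFun t := (2⁻¹ : k) • (t + sgn k i • (par k E O ∘ₗ t ∘ₗ (tPar k E O).toLinearMap))
  map_add' s t := by
    ext1 c; simp; module
  map_smul' r t := by
    ext1 c; simp; module

theorem homPart_apply (i : ZMod 2) (t : T k E O →ₗ[k] (E × O)) (c : T k E O) :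
    homPart k E O i t c
      = (2⁻¹ : k) • (t c + sgn k i • par k E O (t (tPar k E O c))) := by
  simp [homPart]

theorem homPart_eq_self [CharZero k] {i : ZMod 2} {t : T k E O →ₗ[k] (E × O)}
    (ht : HasParity (tPar k E O).toLinearMap (par k E O) i t) : homPart k E O i t = t := by
  ext1 c
  have := ht.apply c
  rw [AlgHom.toLinearMap_apply] at this
  rw [homPart_apply, this, map_smul, par_par, smul_smul, sgn_mul_self, one_smul, ← two_smul k,
    smul_smul, inv_mul_cancel₀ two_ne_zero, one_smul]

theorem homPart_eq_zero {i j : ZMod 2} (hij : i ≠ j) {t : T k E O →ₗ[k] (E × O)}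
    (ht : HasParity (tPar k E O).toLinearMap (par k E O) j t) : homPart k E O i t = 0 := by
  ext1 c
  have := ht.apply c
  rw [AlgHom.toLinearMap_apply] at this
  rw [homPart_apply, this, map_smul, par_par]
  rcases zmod_two_cases i with rfl | rfl <;> rcases zmod_two_cases j with rfl | rfl <;>
    simp_all [sgn_zero, sgn_one]

variable (k E O) in
/-- The coderivation of `T U` cogenerated by `t : T U → U`. -/
def tCoder : (T k E O →ₗ[k] (E × O)) →ₗ[k] Module.End k (T k E O) :=
  tCoderOf 0 ∘ₗ homPart k E O 0 + tCoderOf 1 ∘ₗ homPart k E O 1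

/-- The sign in `tCoderOf` depends on the parity of `t`. `tCoder` is made linear in all `t` by
splitting into parts of both parities, one of which is zero for homogeneous `t`. -/
theorem tCoder_eq [CharZero k] {i : ZMod 2} {t : T k E O →ₗ[k] (E × O)}
    (ht : HasParity (tPar k E O).toLinearMap (par k E O) i t) : tCoder k E O t = tCoderOf i t := by
  rw [tCoder, LinearMap.add_apply, LinearMap.comp_apply, LinearMap.comp_apply]
  rcases zmod_two_cases i with rfl | rfl
  · rw [homPart_eq_self ht, homPart_eq_zero one_ne_zero ht, map_zero, add_zero]
  · rw [homPart_eq_self ht, homPart_eq_zero zero_ne_one ht, map_zero, zero_add]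

theorem homPart_add [CharZero k] (t : T k E O →ₗ[k] (E × O)) :
    homPart k E O 0 t + homPart k E O 1 t = t := by
  ext1 c
  rw [LinearMap.add_apply, homPart_apply, homPart_apply, sgn_zero, sgn_one]
  match_scalars <;> norm_num

theorem insertion_even (a : E) (c : T k E O) : insertion k E O (a, 0) c
    = LinearMap.mul' k _ (TensorProduct.map LinearMap.id
      (LinearMap.mulLeft k (tι k E O (a, 0))) (deconc k E O c)) := by
  simp [insertion, evenPart, oddPart, Prod.mk_zero_zero]

theorem insertion_odd (b : O) (c : T k E O) : insertion k E O (0, b) c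
    = LinearMap.mul' k _ (TensorProduct.map (tPar k E O).toLinearMap
      (LinearMap.mulLeft k (tι k E O (0, b))) (deconc k E O c)) := by
  simp [insertion, evenPart, oddPart, Prod.mk_zero_zero]

theorem headMap_const (u : E × O) :
    headMap ((tCounit k E O).toLinearMap.smulRight u) = LinearMap.mulLeft k (tι k E O u) := by
  ext1 c
  rw [← counit_deconc (LinearMap.mulLeft k (tι k E O u)), headMap_apply]
  generalize deconc k E O c = z
  induction z with
  | zero => simp
  | tmul x y => simp
  | add x y hx hy => simp only [map_add, hx, hy]

/-- `headMap` of a constant prefixes `u`, so its coderivation inserts `u` at every cut of the word,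
with the Koszul sign of passing the letters before the cut. -/
theorem tCoder_const [CharZero k] (u : E × O) :
    tCoder k E O ((tCounit k E O).toLinearMap.smulRight u) = insertion k E O u := by
  have hs : ∀ (i : ZMod 2) (u : E × O), par k E O u = sgn k i • u →
      HasParity (tPar k E O).toLinearMap (par k E O) i
        ((tCounit k E O).toLinearMap.smulRight u) := by
    intro i u hu c
    simp only [LinearMap.smulRight_apply, AlgHom.toLinearMap_apply, tCounit_tPar, map_smul, hu,
      smul_smul]
    rw [mul_left_comm, sgn_mul_self, mul_one]
  have h0 : tCoder k E O ((tCounit k E O).toLinearMap.smulRight (u.1, 0))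
      = insertion k E O (u.1, 0) := by
    ext1 c
    rw [tCoder_eq (hs 0 _ (by simp [par_mk, sgn_zero])), tCoderOf_apply, headMap_const,
      insertion_even, parPow_zero]
  have h1 : tCoder k E O ((tCounit k E O).toLinearMap.smulRight (0, u.2))
      = insertion k E O (0, u.2) := by
    ext1 c
    rw [tCoder_eq (hs 1 _ (by simp [par_mk, sgn_one])), tCoderOf_apply, headMap_const,
      insertion_odd, parPow_one]
  have e : (tCounit k E O).toLinearMap.smulRight u
      = (tCounit k E O).toLinearMap.smulRight (u.1, 0)
        + (tCounit k E O).toLinearMap.smulRight ((0, u.2) : E × O) := by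
    conv_lhs => rw [split_eq E O u]
    ext1 c
    simp only [LinearMap.add_apply, LinearMap.smulRight_apply, smul_add]
  rw [e, map_add, h0, h1, ← map_add, ← split_eq]

theorem shuffleAct_ι (u : E × O) : shuffleAct k E O (sι k E O u) = insertion k E O u := by
  simp [shuffleAct, sLift_ι]

theorem tPar_shuffleAct (a : S k E O) (c : T k E O) : tPar k E O (shuffleAct k E O a c)
    = shuffleAct k E O (sPar k E O a) (tPar k E O c) := by
  induction a using S_induction generalizing c with
  | one => simp
  | add x y hx hy => simp only [map_add, LinearMap.add_apply, hx, hy]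
  | smul r x hx => simp only [map_smul, LinearMap.smul_apply, hx]
  | even a x hx =>
    rw [map_mul, map_mul, map_mul, Module.End.mul_apply, Module.End.mul_apply, ← hx, sPar_even,
      shuffleAct_ι, insertion_even, insertion_even, deconc_tPar]
    generalize deconc k E O (shuffleAct k E O x c) = z
    induction z with
    | zero => simp
    | tmul x y => simp [tPar_even]
    | add x y hx hy => simp only [map_add, hx, hy]
  | odd b x hx =>
    rw [map_mul, map_mul, map_mul, Module.End.mul_apply, Module.End.mul_apply, ← hx, sPar_odd,
      map_neg, LinearMap.neg_apply, shuffleAct_ι, insertion_odd, insertion_odd, deconc_tPar]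
    generalize deconc k E O (shuffleAct k E O x c) = z
    induction z with
    | zero => simp
    | tmul x y => simp [tPar_odd]
    | add x y hx hy => simp only [map_add, neg_add, hx, hy]

/-- The system of the `A_∞`-cases: `S U` acting on `T U` by signed shuffles. -/
theorem T_isShuffleSystem [CharZero k] : IsShuffleSystem (deconc k E O) (tPar k E O).toLinearMap
    (tι k E O) (tProj k E O) (tCounit k E O) (shuffleAct k E O) (tCoder k E O) where
  par_par := tPar_tPar
  par_one := map_one (tPar k E O)
  comul_par := deconc_tPar
  proj_par := tProj_tPar
  counit_par := tCounit_tPar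
  eq_zero _ _ := tCoder_eq_zero
  coder_isCoder i t ht := by
    rw [tCoder_eq ht]
    exact tCoderOf_isCoder ht
  proj_coder t c := by
    simp only [tCoder, LinearMap.add_apply, LinearMap.comp_apply, map_add, tProj_tCoderOf]
    rw [← LinearMap.add_apply, homPart_add]
  counit_coder t c := by
    simp only [tCoder, LinearMap.add_apply, LinearMap.comp_apply, map_add, tCounit_tCoderOf,
      add_zero]
  coder_one t := by
    simp only [tCoder, LinearMap.add_apply, LinearMap.comp_apply, tCoderOf_one]
    rw [← map_add, ← LinearMap.add_apply, homPart_add]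
  coder_const u := by rw [tCoder_const, shuffleAct_ι]
  par_act := tPar_shuffleAct

end TensorCoalgebra

/-! ### Symplectic vector fields -/

section Cyclic

variable {k M : Type*} [Field k] [AddCommGroup M] [Module k M]

theorem homog_induction [CharZero k] {γ : M →ₗ[k] M} (hγ : ∀ x, γ (γ x) = x) {P : M → Prop}
    (add : ∀ x y, P x → P y → P (x + y)) (homog : ∀ l x, γ x = sgn k l • x → P x) (x : M) :
    P x := by
  rw [← evProj_add_odProj γ x]
  exact add _ _ (homog 0 _ (by rw [sgn_zero, one_smul, par_evProj hγ]))
    (homog 1 _ (by rw [sgn_one, neg_one_smul, par_odProj hγ]))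

theorem parPow_homog {γ : M →ₗ[k] M} {l : ZMod 2} {x : M} (hx : γ x = sgn k l • x) (i : ZMod 2) :
    parPow γ i x = sgn k (i * l) • x := by
  rcases zmod_two_cases i with rfl | rfl <;> simp [parPow, hx, sgn_zero]

theorem eq_zero_of_neg_eq (k : Type*) {M : Type*} [Field k] [AddCommGroup M] [Module k M]
    [CharZero k] {x : M} (hx : -x = x) : x = 0 := by
  have : (2 : k) • x = 0 := by rw [two_smul]; nth_rw 1 [← hx]; simp
  exact (smul_eq_zero.mp this).resolve_left two_ne_zero

/-- The signs collected in `IsCyclic.tmul`: rotating `t`, exchanging the arguments of `ω`, rotating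
`t'`. -/
theorem cyclic_sign (i j a b l m : ZMod 2) : i * j + i * l + a * (l + m + b)
    = (j + (a + l)) * (m + b) + ((i + (m + b)) * (j + (a + l)) + a * (l + (i + (m + b)))) := by
  revert i j a b l m
  decide

variable {E O C : Type*} [AddCommGroup E] [Module k E] [AddCommGroup O] [Module k O]
  [Ring C] [Algebra k C]

theorem isHomog_par_cases [CharZero k] {a : ZMod 2} {u : E × O} (hu : IsHomog (par k E O) a u) :
    (a = 0 ∧ ∃ e, u = (e, 0)) ∨ (a = 1 ∧ ∃ b, u = (0, b)) := by
  rw [IsHomog, par_apply] at hu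
  rcases zmod_two_cases a with rfl | rfl
  · refine Or.inl ⟨rfl, u.1, ?_⟩
    have := congrArg Prod.snd hu
    rw [sgn_zero, one_smul] at this
    exact Prod.ext rfl (eq_zero_of_neg_eq k this)
  · refine Or.inr ⟨rfl, u.2, ?_⟩
    have := congrArg Prod.fst hu
    rw [sgn_one, neg_one_smul] at this
    exact Prod.ext (eq_zero_of_neg_eq k this.symm) rfl

/-- `ω (t (x₁, …, xₙ), xₙ₊₁)` is invariant under cyclic permutations, with Koszul signs. -/
def IsCyclic (γ : C →ₐ[k] C) (ι : (E × O) →ₗ[k] C) (ω : (E × O) →ₗ[k] (E × O) →ₗ[k] k)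
    (t : C →ₗ[k] (E × O)) : Prop :=
  ∀ (a b l : ZMod 2) (u v : E × O) (c : C), IsHomog (par k E O) a u → IsHomog (par k E O) b v →
    IsHomog γ.toLinearMap l c → ω (t (ι u * c)) v = sgn k (a * (l + b)) * ω (t (c * ι v)) u

/-- The form `ω` is graded antisymmetric. -/
def IsGradedAntisymm (ω : (E × O) →ₗ[k] (E × O) →ₗ[k] k) : Prop :=
  ∀ (a b : ZMod 2) (u v : E × O), IsHomog (par k E O) a u → IsHomog (par k E O) b v →
    ω u v = -(sgn k (a * b) * ω v u)

variable {γ : C →ₐ[k] C} {ι : (E × O) →ₗ[k] C} {ω : (E × O) →ₗ[k] (E × O) →ₗ[k] k}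
  {t t' : C →ₗ[k] (E × O)} {i j : ZMod 2}

theorem isHomog_mul {l m : ZMod 2} {x y : C} (hx : IsHomog γ.toLinearMap l x)
    (hy : IsHomog γ.toLinearMap m y) : IsHomog γ.toLinearMap (l + m) (x * y) := by
  rw [IsHomog, AlgHom.toLinearMap_apply] at *
  rw [map_mul, hx, hy, smul_mul_smul_comm, sgn_add]

theorem isHomog_ι (hι : ∀ u, γ (ι u) = ι (par k E O u)) {a : ZMod 2} {u : E × O}
    (hu : IsHomog (par k E O) a u) : IsHomog γ.toLinearMap a (ι u) := by
  rw [IsHomog] at *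
  rw [AlgHom.toLinearMap_apply, hι, hu, map_smul]

theorem HasParity.isHomog {N : Type*} [AddCommGroup N] [Module k N] {δ : M →ₗ[k] M}
    {σ : N →ₗ[k] N} {f : M →ₗ[k] N} (hf : HasParity δ σ i f) {l : ZMod 2} {x : M}
    (hx : IsHomog δ l x) : IsHomog σ (i + l) (f x) := by
  have := hf x
  rw [IsHomog] at hx ⊢
  rw [hx, map_smul] at this
  rw [sgn_add, mul_smul, this, smul_smul, sgn_mul_self, one_smul]

theorem IsCyclic.neg (ht : IsCyclic γ ι ω t) : IsCyclic γ ι ω (-t) := by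
  intro a b l u v c hu hv hc
  simp [ht a b l u v c hu hv hc]

/-- Cyclicity of `t` moves the inner value `t' (u x)` into the second slot of `ω`; antisymmetry
exchanges the two slots; cyclicity of `t'` then moves `t (y v)` inside `t'`. -/
theorem IsCyclic.tmul (hι : ∀ u, γ (ι u) = ι (par k E O u)) (hω : IsGradedAntisymm ω)
    (ht : IsCyclic γ ι ω t) (ht' : IsCyclic γ ι ω t') (hi : HasParity γ.toLinearMap (par k E O) i t)
    (hj : HasParity γ.toLinearMap (par k E O) j t') {a b l m : ZMod 2} {u v : E × O} {x y : C}
    (hu : IsHomog (par k E O) a u) (hv : IsHomog (par k E O) b v)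
    (hx : IsHomog γ.toLinearMap l x) (hy : IsHomog γ.toLinearMap m y) :
    ω (t (ι (t' (ι u * x)) * y)) v
      = -(sgn k (i * j + i * l + a * (l + m + b)) * ω (t' (x * ι (t (y * ι v)))) u) := by
  have h1 := hj.isHomog (isHomog_mul (isHomog_ι hι hu) hx)
  have h2 := hi.isHomog (isHomog_mul hy (isHomog_ι hι hv))
  rw [ht _ _ _ _ _ _ h1 hv hy, hω _ _ _ _ h2 h1, ht' _ _ _ _ _ _ hu h2 hx]
  have : sgn k (i * j + i * l + a * (l + m + b))
      = sgn k ((j + (a + l)) * (m + b)) * (sgn k ((i + (m + b)) * (j + (a + l)))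
        * sgn k (a * (l + (i + (m + b))))) := by
    rw [← sgn_add, ← sgn_add, cyclic_sign]
  rw [this]
  ring

/-- In `Y (u c)` either `t'` takes in the letter `u` or `u` stays in front of `Y c`. By
`IsCyclic.tmul` the first terms turn into the terms of `X (c v)` in which `t` takes in `v`; the last
is rotated by cyclicity of `t`. -/
theorem IsCyclic.coder_formula [CharZero k] {Δ : C →ₗ[k] C ⊗[k] C} (hγ : ∀ c, γ (γ c) = c)
    (hΔ : ∀ c, Δ (γ c) = TensorProduct.map γ.toLinearMap γ.toLinearMap (Δ c))
    (hι : ∀ u, γ (ι u) = ι (par k E O u)) (hω : IsGradedAntisymm ω)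
    (ht : IsCyclic γ ι ω t) (ht' : IsCyclic γ ι ω t') (hi : HasParity γ.toLinearMap (par k E O) i t)
    (hj : HasParity γ.toLinearMap (par k E O) j t') {X Y : Module.End k C}
    (hY : HasParity γ.toLinearMap γ.toLinearMap j Y)
    {a b l : ZMod 2} {u v : E × O} {c : C}
    (hu : IsHomog (par k E O) a u) (hv : IsHomog (par k E O) b v)
    (hc : IsHomog γ.toLinearMap l c)
    (hYu : Y (ι u * c) = LinearMap.mul' k C (TensorProduct.map
      (ι ∘ₗ t' ∘ₗ LinearMap.mulLeft k (ι u)) LinearMap.id (Δ c)) + sgn k (j * a) • (ι u * Y c))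
    (hXv : X (c * ι v) = X c * ι v + LinearMap.mul' k C (TensorProduct.map
      (parPow γ.toLinearMap i) (ι ∘ₗ t ∘ₗ LinearMap.mulRight k (ι v)) (Δ c))) :
    ω (t (Y (ι u * c))) v = sgn k (a * (l + b)) * (ω (t (Y c * ι v)) u
      - sgn k (i * j) * (ω (t' (X (c * ι v))) u - ω (t' (X c * ι v)) u)) := by
  -- Stated for any tensor `z` in place of `Δ c`, so that it reduces to homogeneous `x ⊗ y`. The
  -- powers of `γ` record the sign of `u` passing `x` and `y`.
  have key : ∀ z : C ⊗[k] C, ω (t (LinearMap.mul' k C (TensorProduct.map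
        (ι ∘ₗ t' ∘ₗ LinearMap.mulLeft k (ι u)) LinearMap.id z))) v
      = -(sgn k (i * j + a * b) * ω (t' (LinearMap.mul' k C (TensorProduct.map
        (parPow γ.toLinearMap i) (ι ∘ₗ t ∘ₗ LinearMap.mulRight k (ι v))
        (TensorProduct.map (parPow γ.toLinearMap a) (parPow γ.toLinearMap a) z)))) u) := by
    intro z
    induction z with
    | zero => simp
    | add x y hx hy =>
      simp only [map_add, LinearMap.add_apply, hx, hy]
      ring
    | tmul x y =>
      refine homog_induction (γ := γ.toLinearMap) hγ (P := fun x => ω (t (LinearMap.mul' k C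
          (TensorProduct.map (ι ∘ₗ t' ∘ₗ LinearMap.mulLeft k (ι u)) LinearMap.id (x ⊗ₜ[k] y)))) v
        = -(sgn k (i * j + a * b) * ω (t' (LinearMap.mul' k C (TensorProduct.map
        (parPow γ.toLinearMap i) (ι ∘ₗ t ∘ₗ LinearMap.mulRight k (ι v))
        (TensorProduct.map (parPow γ.toLinearMap a) (parPow γ.toLinearMap a) (x ⊗ₜ[k] y))))) u))
        (fun x x' hx hx' => ?_) (fun l x hx => ?_) x
      · simp only [map_add, LinearMap.add_apply, hx, hx', TensorProduct.add_tmul]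
        ring
      refine homog_induction (γ := γ.toLinearMap) hγ (P := fun y => ω (t (LinearMap.mul' k C
          (TensorProduct.map (ι ∘ₗ t' ∘ₗ LinearMap.mulLeft k (ι u)) LinearMap.id (x ⊗ₜ[k] y)))) v
        = -(sgn k (i * j + a * b) * ω (t' (LinearMap.mul' k C (TensorProduct.map
        (parPow γ.toLinearMap i) (ι ∘ₗ t ∘ₗ LinearMap.mulRight k (ι v))
        (TensorProduct.map (parPow γ.toLinearMap a) (parPow γ.toLinearMap a) (x ⊗ₜ[k] y))))) u))
        (fun y y' hy hy' => ?_) (fun m y hy => ?_) y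
      · simp only [map_add, LinearMap.add_apply, hy, hy', TensorProduct.tmul_add]
        ring
      simp only [TensorProduct.map_tmul, LinearMap.mul'_apply, LinearMap.comp_apply,
        LinearMap.mulLeft_apply, LinearMap.mulRight_apply, LinearMap.id_apply]
      rw [ht.tmul hι hω ht' hi hj hu hv hx hy, parPow_homog hx, parPow_homog hy, map_smul,
        parPow_homog hx]
      simp only [smul_mul_assoc, mul_smul_comm, map_smul, LinearMap.smul_apply, smul_eq_mul,
        mul_add, sgn_add]
      ring
  -- `Δ c` has total parity `l`, so those powers of `γ` become a scalar.
  have hΔc : TensorProduct.map (parPow γ.toLinearMap a) (parPow γ.toLinearMap a) (Δ c)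
      = sgn k (a * l) • Δ c := by
    have h1 : γ c = sgn k l • c := hc
    rcases zmod_two_cases a with rfl | rfl
    · simp [parPow, sgn_zero]
    · rw [parPow_one, ← hΔ, h1, map_smul, one_mul]
  rw [hYu, map_add, map_add, LinearMap.add_apply, key, hΔc, hXv]
  simp only [ht _ _ _ _ _ _ hu hv (hY.isHomog hc), map_add, map_smul, LinearMap.add_apply, LinearMap.smul_apply, smul_eq_mul, mul_add,
    sgn_add, mul_comm j a]
  have := sgn_mul_self k (a * j)
  linear_combination (sgn k (a * l) * sgn k (a * b) * ω (t (Y c * ι v)) u) * this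

/-- How the coderivations cogenerated by `t` with `t 1 = 0` behave on products with elements
of `U`. -/
structure HasProductRule (Δ : C →ₗ[k] C ⊗[k] C) (γ : C →ₐ[k] C) (ι : (E × O) →ₗ[k] C)
    (coder : (C →ₗ[k] (E × O)) →ₗ[k] Module.End k C) : Prop where
  par_ι : ∀ u, γ (ι u) = ι (par k E O u)
  left : ∀ (i a : ZMod 2) (t : C →ₗ[k] (E × O)) (u : E × O) (c : C),
    HasParity γ.toLinearMap (par k E O) i t → t 1 = 0 → IsHomog (par k E O) a u →
    coder t (ι u * c) = LinearMap.mul' k C (TensorProduct.map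
      (ι ∘ₗ t ∘ₗ LinearMap.mulLeft k (ι u)) LinearMap.id (Δ c)) + sgn k (i * a) • (ι u * coder t c)
  right : ∀ (i b : ZMod 2) (t : C →ₗ[k] (E × O)) (v : E × O) (c : C),
    HasParity γ.toLinearMap (par k E O) i t → t 1 = 0 → IsHomog (par k E O) b v →
    coder t (c * ι v) = coder t c * ι v + LinearMap.mul' k C (TensorProduct.map
      (parPow γ.toLinearMap i) (ι ∘ₗ t ∘ₗ LinearMap.mulRight k (ι v)) (Δ c))

section

open IsShuffleSystem

variable {Δ : C →ₗ[k] C ⊗[k] C} {p : C →ₗ[k] (E × O)} {ε : C →ₐ[k] k}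
  {act : S k E O →ₐ[k] Module.End k C} {coder : (C →ₗ[k] (E × O)) →ₗ[k] Module.End k C}

/-- `IsCyclic.coder_formula` is used twice, with the roles of `t` and `t'` exchanged. The terms with
`Y c` and `X c` followed by `v` cancel in the graded commutator, and the cyclic rotation of it
remains. -/
theorem IsCyclic.commutator [CharZero k]
    (h : IsShuffleSystem Δ γ.toLinearMap ι p ε act coder) (hR : HasProductRule Δ γ ι coder)
    (hω : IsGradedAntisymm ω) (ht : IsCyclic γ ι ω t) (ht' : IsCyclic γ ι ω t')
    (hi : HasParity γ.toLinearMap (par k E O) i t) (hj : HasParity γ.toLinearMap (par k E O) j t')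
    (h1 : t 1 = 0) (h1' : t' 1 = 0) :
    IsCyclic γ ι ω (p ∘ₗ (coder t * coder t' - sgn k (i * j) • (coder t' * coder t))) := by
  intro a b l u v c hu hv hc
  have e1 := ht.coder_formula h.par_par h.comul_par hR.par_ι hω ht' hi hj
    (h.coder_isCoder j t' hj).parity hu hv hc (hR.left j a t' u c hj h1' hu)
    (hR.right i b t v c hi h1 hv)
  have e2 := ht'.coder_formula h.par_par h.comul_par hR.par_ι hω ht hj hi
    (h.coder_isCoder i t hi).parity hu hv hc (hR.left i a t u c hi h1 hu)
    (hR.right j b t' v c hj h1' hv)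
  simp only [LinearMap.comp_apply, LinearMap.sub_apply, LinearMap.smul_apply,
    Module.End.mul_apply, map_sub, map_smul, h.proj_coder, smul_eq_mul, e1, e2, mul_comm j i]
  have := sgn_mul_self k (i * j)
  linear_combination (sgn k (a * (l + b)) * (ω (t (coder t' (c * ι v))) u
    - ω (t (coder t' c * ι v)) u)) * this

theorem symplecticFields_isLieSubalgebra [CharZero k] [FiniteDimensional k E]
    [FiniteDimensional k O] (h : IsShuffleSystem Δ γ.toLinearMap ι p ε act coder)
    (hR : HasProductRule Δ γ ι coder) (hω : IsGradedAntisymm ω) :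
    IsLieSubalgebra (A := Module.End k (Module.Dual k C))
      (symplecticFields Δ γ.toLinearMap ι p (par k E O) ω 0)
      (symplecticFields Δ γ.toLinearMap ι p (par k E O) ω 1) := by
  refine isLieSubalgebra_of_commutator (A := Module.End k (Module.Dual k C))
    (K := symplecticFields Δ γ.toLinearMap ι p (par k E O) ω) fun i j x hx y hy => ?_
  refine ⟨vectorFields_commutator h.par_par h.comul_par i j x hx.1 y hy.1, ?_⟩
  obtain ⟨hxp, hx1, hxe⟩ := h.exists_coder hx.1
  obtain ⟨hyp, hy1, hye⟩ := h.exists_coder hy.1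
  have hc : IsCyclic γ ι ω _ := IsCyclic.commutator h hR hω hx.2 hy.2 hxp hyp hx1 hy1
  have e : taylor p (par k E O) (i + j) (x * y - sgn k (i * j) • (y * x))
      = -(p ∘ₗ (coder (taylor p (par k E O) i x) * coder (taylor p (par k E O) j y)
        - sgn k (i * j) • (coder (taylor p (par k E O) j y) * coder (taylor p (par k E O) i x)))) := by
    conv_lhs => rw [hxe, hye]
    rw [dualField_commutator h.par_par (h.coder_isCoder _ _ hxp).parity
      (h.coder_isCoder _ _ hyp).parity, ← dualField_smul, taylor_dualField h.par_par h.proj_par]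
    ext1 c
    simp
  rw [e]
  exact hc.neg

/-- An action of `S U` preserves cyclic maps as soon as `U` does. -/
theorem IsCyclic.comp_act
    (hact : ∀ (d : ZMod 2) (w : E × O) (t : C →ₗ[k] (E × O)), IsHomog (par k E O) d w →
      IsCyclic γ ι ω t → IsCyclic γ ι ω (t ∘ₗ act (sι k E O w)))
    (ht : IsCyclic γ ι ω t) (x : S k E O) : IsCyclic γ ι ω (t ∘ₗ act x) := by
  induction x using S_induction generalizing t with
  | one => rw [map_one]; exact ht
  | add x y hx hy =>
    intro a b l u v c hu hv hc
    have h1 := hx ht a b l u v c hu hv hc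
    have h2 := hy ht a b l u v c hu hv hc
    simp only [LinearMap.comp_apply, map_add, LinearMap.add_apply] at h1 h2 ⊢
    rw [h1, h2]; ring
  | smul r x hx =>
    intro a b l u v c hu hv hc
    have h1 := hx ht a b l u v c hu hv hc
    simp only [LinearMap.comp_apply, map_smul, LinearMap.smul_apply, smul_eq_mul] at h1 ⊢
    rw [h1]; ring
  | even e x hx =>
    rw [map_mul]
    exact hx (hact 0 (e, 0) t (by simp [IsHomog, par_mk, sgn_zero]) ht)
  | odd o x hx =>
    rw [map_mul]
    exact hx (hact 1 (0, o) t (by simp [IsHomog, par_mk, sgn_one]) ht)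

/-- Cyclicity concerns only arguments with a letter in front or behind. The counit kills these, so
the correction of `component` at `1` does no harm. -/
theorem dualField_actCoder_mem_symplecticFields [CharZero k] [FiniteDimensional k E]
    [FiniteDimensional k O] (h : IsShuffleSystem Δ γ.toLinearMap ι p ε act coder)
    (hε : ∀ u c, ε (ι u * c) = 0)
    (hact : ∀ (d : ZMod 2) (w : E × O) (t : C →ₗ[k] (E × O)), IsHomog (par k E O) d w →
      IsCyclic γ ι ω t → IsCyclic γ ι ω (t ∘ₗ act (sι k E O w)))
    (ht : IsCyclic γ ι ω t) (hp : HasParity γ.toLinearMap (par k E O) 1 t) (j : ZMod 2)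
    (x : S k E O) (hx : sPar k E O x = sgn k j • x) :
    dualField γ.toLinearMap (1 + j) (actCoder ε act coder t x)
      ∈ symplecticFields Δ γ.toLinearMap ι p (par k E O) ω (1 + j) := by
  refine ⟨dualField_isVectorField h.par_par h.comul_par (h.isCoder_actCoder hp hx)
    (h.actCoder_one x), ?_⟩
  intro a b l u v c hu hv hc
  rw [actCoder_apply, h.taylor_dualField_coder, component_apply, component_apply, hε]
  have hv0 : ε (c * ι v) = 0 := by
    have : ε (ι v) = 0 := by simpa using hε v 1
    rw [map_mul, this, mul_zero]
  simp only [hv0, zero_smul, sub_zero]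
  exact ht.comp_act hact x a b l u v c hu hv hc

end

end Cyclic

/-! ### Cyclicity in the symmetric and tensor coalgebras -/

section CyclicInstances

variable {k E O : Type*} [Field k] [AddCommGroup E] [Module k E] [AddCommGroup O] [Module k O]
  {ω : (E × O) →ₗ[k] (E × O) →ₗ[k] k}

/-- The last letter `v` either stays outside or is taken in by `t`. In the second case the result is
written behind `c₍₁₎`, and passing it costs the power of the parity involution. -/
theorem sCoder_mul_ι {i : ZMod 2} {t : S k E O →ₗ[k] E × O}
    (ht : HasParity (sPar k E O).toLinearMap (par k E O) i t) (v : E × O) (c : S k E O) :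
    sCoder t (c * sι k E O v) = sCoder t c * sι k E O v + LinearMap.mul' k _ (TensorProduct.map
      (parPow (sPar k E O).toLinearMap i) (sι k E O ∘ₗ t ∘ₗ LinearMap.mulRight k (sι k E O v))
      (comul k E O c)) := by
  induction c using S_induction generalizing t i with
  | one =>
    have h1 : parPow (sPar k E O).toLinearMap i 1 = 1 := by
      rcases zmod_two_cases i with rfl | rfl <;> simp [parPow]
    have h2 := comul_ι_mul k E O v 1
    have h3 : sι k E O (evenPart k E O v) + sι k E O (oddPart k E O v) = sι k E O v := by
      rw [← map_add]; simp [evenPart, oddPart]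
    rw [mul_one, comul_one] at h2
    simp only [sCoder, LinearMap.comp_apply, one_mul, h2, comul_one]
    simp [comulStep, h1, add_assoc, ← mul_add, h3, add_comm]
  | add x y hx hy => simp only [map_add, add_mul, hx ht, hy ht]; abel
  | smul r x hx => simp only [map_smul, smul_mul_assoc, hx ht, smul_add]
  | even a x hx =>
    rw [mul_assoc, sCoder_even_mul, sCoder_even_mul, hx ht, hx (ht.comp_even a), comul_even, map_add,
      map_add, mul_add, add_mul]
    have h1 : ∀ z, LinearMap.mul' k _ (TensorProduct.map (parPow (sPar k E O).toLinearMap i)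
        (sι k E O ∘ₗ t ∘ₗ LinearMap.mulRight k (sι k E O v))
        (TensorProduct.map (LinearMap.mulLeft k (sι k E O (a, 0))) LinearMap.id z))
        = sι k E O (a, 0) * LinearMap.mul' k _ (TensorProduct.map
          (parPow (sPar k E O).toLinearMap i)
          (sι k E O ∘ₗ t ∘ₗ LinearMap.mulRight k (sι k E O v)) z) := by
      intro z
      induction z with
      | zero => simp
      | tmul x y =>
        rcases zmod_two_cases i with rfl | rfl <;> simp [parPow, sPar_even, mul_assoc]
      | add x y hx hy => simp only [map_add, mul_add, hx, hy]
    have h2 : ∀ z, LinearMap.mul' k _ (TensorProduct.map (parPow (sPar k E O).toLinearMap i)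
        (sι k E O ∘ₗ t ∘ₗ LinearMap.mulRight k (sι k E O v))
        (TensorProduct.map LinearMap.id (LinearMap.mulLeft k (sι k E O (a, 0))) z))
        = LinearMap.mul' k _ (TensorProduct.map (parPow (sPar k E O).toLinearMap i)
          (sι k E O ∘ₗ (t ∘ₗ LinearMap.mulLeft k (sι k E O (a, 0)))
            ∘ₗ LinearMap.mulRight k (sι k E O v)) z) := by
      intro z
      induction z with
      | zero => simp
      | tmul x y => simp [mul_assoc]
      | add x y hx hy => simp only [map_add, hx, hy]
    rw [h1, h2, mul_assoc]
    abel
  | odd b x hx =>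
    rw [mul_assoc, sCoder_odd_mul ht, sCoder_odd_mul ht, hx ht, hx (ht.comp_odd b), comul_odd, map_add,
      map_add, mul_add, add_mul, smul_add, smul_mul_assoc]
    have h1 : ∀ z, LinearMap.mul' k _ (TensorProduct.map (parPow (sPar k E O).toLinearMap i)
        (sι k E O ∘ₗ t ∘ₗ LinearMap.mulRight k (sι k E O v))
        (TensorProduct.map (LinearMap.mulLeft k (sι k E O (0, b))) LinearMap.id z))
        = sgn k i • (sι k E O (0, b) * LinearMap.mul' k _ (TensorProduct.map
          (parPow (sPar k E O).toLinearMap i)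
          (sι k E O ∘ₗ t ∘ₗ LinearMap.mulRight k (sι k E O v)) z)) := by
      intro z
      induction z with
      | zero => simp
      | tmul x y =>
        rcases zmod_two_cases i with rfl | rfl <;>
          simp [parPow, sPar_odd, mul_assoc, sgn_zero, sgn_one]
      | add x y hx hy => simp only [map_add, mul_add, smul_add, hx, hy]
    have h2 : ∀ z, LinearMap.mul' k _ (TensorProduct.map (parPow (sPar k E O).toLinearMap i)
        (sι k E O ∘ₗ t ∘ₗ LinearMap.mulRight k (sι k E O v))
        (TensorProduct.map (sPar k E O).toLinearMap (LinearMap.mulLeft k (sι k E O (0, b))) z))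
        = LinearMap.mul' k _ (TensorProduct.map (parPow (sPar k E O).toLinearMap (i + 1))
          (sι k E O ∘ₗ (t ∘ₗ LinearMap.mulLeft k (sι k E O (0, b)))
            ∘ₗ LinearMap.mulRight k (sι k E O v)) z) := by
      intro z
      induction z with
      | zero => simp
      | tmul x y =>
        rcases zmod_two_cases i with rfl | rfl <;>
          simp [parPow, sPar_sPar, mul_assoc, zmod_two_one_add_one]
      | add x y hx hy => simp only [map_add, hx, hy]
    rw [h1, h2, mul_assoc]
    abel

theorem S_hasProductRule [CharZero k] : HasProductRule (comul k E O) (sPar k E O) (sι k E O)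
    { toFun := sCoder, map_add' := sCoder_add, map_smul' := sCoder_smul } where
  par_ι := sPar_ι k E O
  left i a t u c ht _ hu := by
    rcases isHomog_par_cases hu with ⟨rfl, e, rfl⟩ | ⟨rfl, b, rfl⟩
    · rw [mul_zero, sgn_zero, one_smul]
      exact sCoder_even_mul t e c
    · rw [mul_one]
      exact sCoder_odd_mul ht b c
  right _ _ _ v c ht _ _ := sCoder_mul_ι ht v c

/-- The algebra `S U` is graded commutative. -/
theorem sι_mul_comm {d a : ZMod 2} {w u : E × O} [CharZero k] (hw : IsHomog (par k E O) d w)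
    (hu : IsHomog (par k E O) a u) :
    sι k E O w * sι k E O u = sgn k (d * a) • (sι k E O u * sι k E O w) := by
  rcases isHomog_par_cases hw with ⟨rfl, e, rfl⟩ | ⟨rfl, b, rfl⟩
  · rw [zero_mul, sgn_zero, one_smul, sι_even_comm]
  · rcases isHomog_par_cases hu with ⟨rfl, e, rfl⟩ | ⟨rfl, b', rfl⟩
    · rw [mul_zero, sgn_zero, one_smul, sι_even_comm]
    · rw [mul_one, sgn_one, neg_one_smul, sι_odd_comm]

/-- In `S U` the letter `w` can be commuted past `u`, so this is cyclicity of `t` with the middle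
word `w c`. -/
theorem S_isCyclic_comp [CharZero k] (d : ZMod 2) (w : E × O) (t : S k E O →ₗ[k] (E × O))
    (hw : IsHomog (par k E O) d w) (ht : IsCyclic (sPar k E O) (sι k E O) ω t) :
    IsCyclic (sPar k E O) (sι k E O) ω (t ∘ₗ Algebra.lmul k (S k E O) (sι k E O w)) := by
  intro a b l u v c hu hv hc
  have h1 := ht a b (d + l) u v (sι k E O w * c) hu hv
    (isHomog_mul (isHomog_ι (sPar_ι k E O) hw) hc)
  simp only [LinearMap.comp_apply, Algebra.coe_lmul_eq_mul, LinearMap.mul_apply']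
  rw [← mul_assoc, sι_mul_comm hw hu, smul_mul_assoc, mul_assoc, map_smul, map_smul,
    LinearMap.smul_apply, h1, mul_assoc, smul_eq_mul, ← mul_assoc, ← sgn_add]
  congr 2
  rw [mul_comm d a, ← mul_add]
  congr 1
  rw [add_assoc d l b, ← add_assoc, CharTwo.add_self_eq_zero, zero_add]

theorem deconc_mul_ι (c : T k E O) (v : E × O) : deconc k E O (c * tι k E O v)
    = deconc k E O c * (1 ⊗ₜ tι k E O v) + (c * tι k E O v) ⊗ₜ 1 := by
  induction c using T_induction with
  | one =>
    have := deconc_ι_mul k E O v 1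
    rw [mul_one, deconc_one, Algebra.TensorProduct.tmul_mul_tmul] at this
    simp [this, deconc_one]
  | add x y hx hy => simp only [map_add, add_mul, hx, hy, TensorProduct.add_tmul]; abel
  | smul r x hx => simp only [map_smul, smul_mul_assoc, hx, smul_add, TensorProduct.smul_tmul']
  | ι_mul u x hx =>
    rw [mul_assoc, deconc_ι_mul, hx, deconc_ι_mul, mul_add, add_mul, mul_assoc,
      Algebra.TensorProduct.tmul_mul_tmul, Algebra.TensorProduct.tmul_mul_tmul]
    simp only [one_mul, mul_assoc]
    abel

theorem headMap_mul_ι (t : T k E O →ₗ[k] E × O) (c : T k E O) (v : E × O) :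
    headMap t (c * tι k E O v) = headMap t c * tι k E O v
      + tι k E O (t (c * tι k E O v)) := by
  rw [headMap_apply, deconc_mul_ι, map_add, map_add, headMap_apply]
  congr 1
  · generalize deconc k E O c = z
    induction z with
    | zero => simp
    | tmul x y => simp [mul_assoc]
    | add x y hx hy => simp only [map_add, add_mul, hx, hy]
  · simp

theorem tCoderOf_mul_ι (i : ZMod 2) {t : T k E O →ₗ[k] E × O} (ht : t 1 = 0) (c : T k E O)
    (v : E × O) : tCoderOf i t (c * tι k E O v) = tCoderOf i t c * tι k E O v
      + LinearMap.mul' k _ (TensorProduct.map (parPow (tPar k E O).toLinearMap i)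
        (tι k E O ∘ₗ t ∘ₗ LinearMap.mulRight k (tι k E O v)) (deconc k E O c)) := by
  rw [tCoderOf_apply, deconc_mul_ι, map_add, map_add, tCoderOf_apply]
  have : LinearMap.mul' k _ (TensorProduct.map (parPow (tPar k E O).toLinearMap i) (headMap t)
      ((c * tι k E O v) ⊗ₜ[k] (1 : T k E O))) = 0 := by
    rw [TensorProduct.map_tmul, headMap_one, ht, map_zero, TensorProduct.tmul_zero, map_zero]
  rw [this, add_zero]
  generalize deconc k E O c = z
  induction z with
  | zero => simp
  | tmul x y => simp [headMap_mul_ι, mul_add, mul_assoc]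
  | add x y hx hy => simp only [map_add, add_mul, hx, hy]; abel

theorem T_hasProductRule [CharZero k] :
    HasProductRule (deconc k E O) (tPar k E O) (tι k E O) (tCoder k E O) where
  par_ι := tPar_ι k E O
  left i a t u c ht h1 hu := by
    rw [tCoder_eq ht, tCoderOf_ι_mul, headMap_ι_mul, h1, map_zero, zero_mul, zero_add,
      parPow_homog hu, map_smul, smul_mul_assoc]
    rfl
  right i _ t v c ht h1 _ := by
    rw [tCoder_eq ht]
    exact tCoderOf_mul_ι i h1 c v

theorem insertion_homog [CharZero k] {d : ZMod 2} {w : E × O} (hw : IsHomog (par k E O) d w)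
    (c : T k E O) : insertion k E O w c = LinearMap.mul' k _ (TensorProduct.map
      (parPow (tPar k E O).toLinearMap d) (LinearMap.mulLeft k (tι k E O w))
      (deconc k E O c)) := by
  rcases isHomog_par_cases hw with ⟨rfl, e, rfl⟩ | ⟨rfl, b, rfl⟩
  · rw [insertion_even, parPow_zero]
  · rw [insertion_odd, parPow_one]

theorem insertion_ι_mul [CharZero k] {d a : ZMod 2} {w u : E × O}
    (hw : IsHomog (par k E O) d w) (hu : IsHomog (par k E O) a u) (c : T k E O) :
    insertion k E O w (tι k E O u * c) = tι k E O w * (tι k E O u * c)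
      + sgn k (d * a) • (tι k E O u * insertion k E O w c) := by
  rw [insertion_homog hw, insertion_homog hw, deconc_ι_mul, map_add, map_add]
  refine congrArg₂ (· + ·) ?_ ?_
  · simp [parPow_tPar_one]
  · generalize deconc k E O c = z
    induction z with
    | zero => simp
    | tmul x y => simp [parPow_tPar_mul, parPow_tPar_ι, parPow_homog hu, mul_assoc]
    | add x y hx hy => simp only [map_add, mul_add, smul_add, hx, hy]

theorem insertion_mul_ι [CharZero k] {d b l : ZMod 2} {w v : E × O} {c : T k E O}
    (hw : IsHomog (par k E O) d w) (hv : IsHomog (par k E O) b v)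
    (hc : IsHomog (tPar k E O).toLinearMap l c) :
    insertion k E O w (c * tι k E O v) = insertion k E O w c * tι k E O v
      + sgn k (d * (l + b)) • (c * tι k E O v * tι k E O w) := by
  rw [insertion_homog hw, insertion_homog hw, deconc_mul_ι, map_add, map_add]
  refine congrArg₂ (· + ·) ?_ ?_
  · generalize deconc k E O c = z
    induction z with
    | zero => simp
    | tmul x y => simp [mul_assoc]
    | add x y hx hy => simp only [map_add, add_mul, hx, hy]
  · have := parPow_homog (isHomog_mul hc (isHomog_ι (tPar_ι k E O) hv)) d
    simp [this]

/-- Inserting `w` into `u c` puts it in front of `u` or into `c`; inserting it into `c v` puts it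
into `c` or behind `v`. The insertions into `c` correspond under one rotation, and `w u c` becomes
`c v w` under two. -/
theorem T_isCyclic_comp [CharZero k] (d : ZMod 2) (w : E × O) (t : T k E O →ₗ[k] (E × O))
    (hw : IsHomog (par k E O) d w) (ht : IsCyclic (tPar k E O) (tι k E O) ω t) :
    IsCyclic (tPar k E O) (tι k E O) ω (t ∘ₗ shuffleAct k E O (sι k E O w)) := by
  intro a b l u v c hu hv hc
  have hι : ∀ u, tPar k E O (tι k E O u) = tι k E O (par k E O u) := tPar_ι k E O
  have hs : IsHomog (tPar k E O).toLinearMap (d + l) (insertion k E O w c) := by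
    have h1 := tPar_shuffleAct (sι k E O w) c
    rw [IsHomog] at *
    rw [AlgHom.toLinearMap_apply] at *
    rw [shuffleAct_ι, sPar_ι, hw, hc, map_smul, map_smul, map_smul, LinearMap.smul_apply,
      shuffleAct_ι, smul_smul] at h1
    rw [h1, sgn_add, mul_comm]
  -- `h1` and `h2` are the two successive rotations for `w u c`, and `h3` is the single one for `w`
  -- inside `c`.
  have h1 := ht d b (a + l) w v (tι k E O u * c) hw hv (isHomog_mul (isHomog_ι hι hu) hc)
  have h2 := ht a d (l + b) u w (c * tι k E O v) hu hw (isHomog_mul hc (isHomog_ι hι hv))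
  have h3 := ht a b (d + l) u v (insertion k E O w c) hu hv hs
  rw [LinearMap.comp_apply, LinearMap.comp_apply, shuffleAct_ι, insertion_ι_mul hw hu,
    insertion_mul_ι hw hv hc, map_add, map_add, map_smul, map_smul, LinearMap.add_apply,
    LinearMap.smul_apply, map_add, map_add, LinearMap.add_apply, map_smul, map_smul,
    LinearMap.smul_apply, h1, h3, mul_assoc, h2]
  have e1 : sgn k (d * (a + l + b)) * sgn k (a * (l + b + d))
      = sgn k (a * (l + b)) * sgn k (d * (l + b)) := by
    rw [← sgn_add, ← sgn_add]
    congr 1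
    clear h1 h2 h3 hs hw hu hv hc
    revert a b l d
    decide
  have e2 : sgn k (d * a) * sgn k (a * (d + l + b)) = sgn k (a * (l + b)) := by
    rw [← sgn_add]
    congr 1
    clear h1 h2 h3 hs hw hu hv hc e1
    revert a b l d
    decide
  simp only [smul_eq_mul]
  linear_combination ω (t (c * tι k E O v * tι k E O w)) u * e1
    + ω (t (insertion k E O w c * tι k E O v)) u * e2

end CyclicInstances

/-! ### Antisymmetry of the symplectic form -/

section SymplecticForm

variable {k V₀ V₁ : Type*} [Field k] [AddCommGroup V₀] [Module k V₀] [AddCommGroup V₁]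
  [Module k V₁]

/-- The exponents agree modulo two: for `a`, `b` the parities in `ΠV`, `(a + 1) + (a + 1)(b + 1)`
equals `1 + a b + (b + 1)`. -/
theorem IsInnerProduct.isGradedAntisymm [CharZero k] [FiniteDimensional k V₀]
    [FiniteDimensional k V₁] {π : ZMod 2} {B : (V₀ × V₁) →ₗ[k] (V₀ × V₁) →ₗ[k] k}
    (hB : IsInnerProduct π B) : IsGradedAntisymm (symplecticForm B) := by
  have hs : ∀ {a : ZMod 2} {u : V₁ × V₀}, IsHomog (par k V₁ V₀) a u →
      IsHomog (par k V₀ V₁) (a + 1) u.swap := by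
    intro a u hu
    rcases isHomog_par_cases hu with ⟨rfl, e, rfl⟩ | ⟨rfl, b, rfl⟩
    · simp [IsHomog, par_mk, sgn_one]
    · simp [IsHomog, par_mk, zmod_two_one_add_one, sgn_zero]
  have hω : ∀ u v, symplecticForm B u v = B (par k V₀ V₁ u.swap) v.swap := fun u v => rfl
  intro a b u v hu hv
  have h1 := hs hu
  have h2 := hs hv
  rw [hω, hω, h1, h2, map_smul, map_smul, LinearMap.smul_apply, LinearMap.smul_apply,
    hB.symmetric _ _ _ _ h1 h2, smul_eq_mul, smul_eq_mul]
  rcases zmod_two_cases a with rfl | rfl <;> rcases zmod_two_cases b with rfl | rfl <;>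
    simp [sgn_zero, sgn_one, zmod_two_one_add_one]

end SymplecticForm

/-! ### Shuffles of words -/

section Permutations

/-- The permutation that sends `s` to `0` and is `τ` on the remaining elements. -/
def insertPerm {n : ℕ} (s : Fin (n + 1)) (τ : Equiv.Perm (Fin n)) : Equiv.Perm (Fin (n + 1)) :=
  (finSuccEquiv' s).trans ((Equiv.optionCongr τ).trans (finSuccEquiv' 0).symm)

theorem insertPerm_self {n : ℕ} (s : Fin (n + 1)) (τ : Equiv.Perm (Fin n)) :
    insertPerm s τ s = 0 := by
  simp [insertPerm]

theorem insertPerm_succAbove {n : ℕ} (s : Fin (n + 1)) (τ : Equiv.Perm (Fin n)) (i : Fin n) :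
    insertPerm s τ (s.succAbove i) = (τ i).succ := by
  simp [insertPerm]

theorem insertPerm_symm_succ {n : ℕ} (s : Fin (n + 1)) (τ : Equiv.Perm (Fin n)) (i : Fin n) :
    (insertPerm s τ).symm i.succ = s.succAbove (τ.symm i) := by
  rw [Equiv.symm_apply_eq, insertPerm_succAbove, Equiv.apply_symm_apply]

/-- A rearrangement of `n + 1` letters is a position for the letter `0` together with a
rearrangement of the others. Injectivity suffices, as both sides have `(n + 1)!` elements. -/
theorem insertPerm_bijective (n : ℕ) : Function.Bijective
    (fun q : Fin (n + 1) × Equiv.Perm (Fin n) => insertPerm q.1 q.2) := by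
  rw [Fintype.bijective_iff_injective_and_card]
  refine ⟨?_, by simp [Fintype.card_perm, Nat.factorial_succ]⟩
  rintro ⟨s, τ⟩ ⟨s', τ'⟩ h
  have h1 : s = s' := by
    refine (insertPerm s' τ').injective ?_
    have := insertPerm_self s τ
    rw [insertPerm_self, ← this]
    exact (Equiv.congr_fun h s).symm
  subst h1
  refine Prod.ext rfl (Equiv.ext fun i => ?_)
  have := Equiv.congr_fun h (s.succAbove i)
  simp only [insertPerm_succAbove] at this
  exact Fin.succ_injective _ this

/-- The additional inversions are those of the letter `0` with the letters to the left of position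
`s`. -/
theorem koszul_insertPerm (k : Type*) [Field k] {n : ℕ} (p : Fin (n + 1) → ZMod 2)
    (s : Fin (n + 1)) (τ : Equiv.Perm (Fin n)) : koszul k p (insertPerm s τ)
      = koszul k (fun i => p i.succ) τ
        * ∏ i : Fin n, if i.castSucc < s then sgn k (p (τ i).succ * p 0) else 1 := by
  rw [koszul, Fin.prod_univ_succAbove _ s]
  have h0 : ∏ j, (if s < j ∧ insertPerm s τ j < insertPerm s τ s then
      sgn k (p (insertPerm s τ s) * p (insertPerm s τ j)) else 1) = 1 := by
    refine Finset.prod_eq_one fun j _ => if_neg ?_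
    rw [insertPerm_self]
    exact fun h => (Fin.not_lt_zero _ h.2)
  rw [h0, one_mul, koszul, ← Finset.prod_mul_distrib]
  refine Finset.prod_congr rfl fun i _ => ?_
  rw [Fin.prod_univ_succAbove _ s, mul_comm]
  simp only [insertPerm_self, insertPerm_succAbove, Fin.succAbove_lt_succAbove_iff,
    Fin.succ_lt_succ_iff, Fin.succAbove_lt_iff_castSucc_lt, Fin.succ_pos, and_true]

end Permutations

/-! ### Expansion of the shuffle action on words -/

section Words

variable {k E O : Type*} [Field k] [AddCommGroup E] [Module k E] [AddCommGroup O] [Module k O]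

theorem tProd_succ {n : ℕ} (x : Fin (n + 1) → E × O) :
    tProd (k := k) x = tι k E O (x 0) * tProd (k := k) fun i => x i.succ := by
  simp [tProd, List.ofFn_succ]

theorem insertNth_succ {n : ℕ} {α : Type*} (s : Fin (n + 1)) (u : α) (x : Fin (n + 1) → α) :
    s.succ.insertNth (α := fun _ => α) u x
      = Fin.cons (α := fun _ => α) (x 0) (s.insertNth (α := fun _ => α) u fun i => x i.succ) := by
  funext i
  refine Fin.succAboveCases s.succ ?_ (fun j => ?_) i
  · simp
  · rw [Fin.insertNth_apply_succAbove]
    refine Fin.cases ?_ (fun j => ?_) j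
    · rw [Fin.succ_succAbove_zero, Fin.cons_zero]
    · rw [Fin.succ_succAbove_succ, Fin.cons_succ, Fin.insertNth_apply_succAbove]

/-- The index `s` is the number of letters in front of `u`; each of these contributes its sign with
`u`. -/
theorem insertion_tProd [CharZero k] {n : ℕ} {d : ZMod 2} {u : E × O} (hu : IsHomog (par k E O) d u)
    (x : Fin n → E × O) (q : Fin n → ZMod 2) (hx : ∀ i, IsHomog (par k E O) (q i) (x i)) :
    insertion k E O u (tProd (k := k) x)
      = ∑ s : Fin (n + 1), (∏ i : Fin n, if i.castSucc < s then sgn k (q i * d) else 1)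
          • tProd (k := k) (s.insertNth (α := fun _ => E × O) u x) := by
  induction n with
  | zero =>
    have : tProd (k := k) x = 1 := by simp [tProd]
    rw [this, insertion_one]
    simp [tProd]
  | succ n ih =>
    rw [tProd_succ, insertion_ι_mul hu (hx 0), ih _ _ fun i => hx i.succ,
      Fin.sum_univ_succ (n := n + 1)]
    refine congrArg₂ (· + ·) ?_ ?_
    · simp [tProd_succ (Fin.cons u x), tProd_succ x, Fin.insertNth_zero']
    · rw [Finset.mul_sum, Finset.smul_sum]
      refine Finset.sum_congr rfl fun s _ => ?_
      rw [insertNth_succ, tProd_succ (Fin.cons _ _), Fin.prod_univ_succ]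
      simp only [Fin.cons_zero, Fin.cons_succ, Fin.castSucc_zero, Fin.succ_pos, if_true,
        mul_smul_comm, smul_smul, mul_comm (q 0) d, ← Fin.succ_castSucc, Fin.succ_lt_succ_iff]

/-- The letters `z_i` with `i < r` act by shuffles on the word in the other letters. -/
theorem shuffleAct_take_drop [CharZero k] (r : ℕ) {n : ℕ} (hr : r ≤ n) (z : Fin n → E × O)
    (p : Fin n → ZMod 2)
    (hz : ∀ i, IsHomog (par k E O) (p i) (z i)) :
    shuffleAct k E O (((List.ofFn z).take r).map (sι k E O)).prod
        (((List.ofFn z).drop r).map (tι k E O)).prod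
      = ∑ τ : Equiv.Perm (Fin n) with
          ∀ i j : Fin n, r ≤ i → i < j → τ.symm i < τ.symm j,
        koszul k p τ • tProd (k := k) fun i => z (τ i) := by
  induction r generalizing n with
  | zero =>
    -- With no letter to be moved, all letters keep their order and only the identity contributes.
    have hone : ∀ τ : Equiv.Perm (Fin n),
        (∀ i j : Fin n, 0 ≤ (i : ℕ) → i < j → τ.symm i < τ.symm j) ↔ τ = 1 := by
      intro τ
      refine ⟨fun h => ?_, fun h => by subst h; exact fun i j _ hij => hij⟩
      have hm : StrictMono τ.symm := fun i j hij => h i j (Nat.zero_le _) hij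
      have h2 : τ.symm = Equiv.refl _ := by
        ext i
        have := Subsingleton.elim (hm.orderIsoOfSurjective _ τ.symm.surjective)
          (OrderIso.refl (Fin n))
        exact congrArg Fin.val (congrArg (fun f : Fin n ≃o Fin n => f i) this)
      rw [← Equiv.symm_symm τ, h2]
      rfl
    simp only [hone, Finset.filter_eq', Finset.mem_univ, if_true, Finset.sum_singleton]
    have : koszul k p 1 = 1 := by
      refine Finset.prod_eq_one fun i _ => Finset.prod_eq_one fun j _ => if_neg ?_
      exact fun h => lt_asymm h.1 h.2
    simp [this, tProd, List.map_ofFn, Function.comp_def]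
  | succ r ih =>
    obtain ⟨n, rfl⟩ : ∃ m, n = m + 1 := ⟨n - 1, by omega⟩
    -- The first letter `z 0` is inserted last. The sum is reindexed by its position `s` and the
    -- order `τ` of the others, and the order condition concerns `τ` alone.
    rw [List.ofFn_succ, List.take_succ_cons, List.drop_succ_cons, List.map_cons, List.prod_cons,
      map_mul, Module.End.mul_apply, ih (Nat.le_of_succ_le_succ hr) _ (fun i => p i.succ)
      fun i => hz i.succ, shuffleAct_ι, map_sum, Finset.sum_filter, Finset.sum_filter,
      ← (insertPerm_bijective n).sum_comp, Fintype.sum_prod_type_right]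
    refine Finset.sum_congr rfl fun τ _ => ?_
    have hiff : ∀ s, (∀ i j : Fin (n + 1), r + 1 ≤ (i : ℕ) → i < j →
        (insertPerm s τ).symm i < (insertPerm s τ).symm j)
        ↔ (∀ i j : Fin n, r ≤ (i : ℕ) → i < j → τ.symm i < τ.symm j) := by
      intro s
      constructor
      · intro h i j hi hij
        have := h i.succ j.succ (by simpa using hi) (Fin.succ_lt_succ_iff.mpr hij)
        rwa [insertPerm_symm_succ, insertPerm_symm_succ, Fin.succAbove_lt_succAbove_iff] at this
      · intro h i j hi hij
        obtain ⟨i, rfl⟩ := Fin.exists_succ_eq.mpr (show i ≠ 0 by rintro rfl; simp at hi)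
        obtain ⟨j, rfl⟩ := Fin.exists_succ_eq.mpr (show j ≠ 0 by rintro rfl; simp at hij)
        rw [insertPerm_symm_succ, insertPerm_symm_succ, Fin.succAbove_lt_succAbove_iff]
        exact h i j (by simpa using hi) (Fin.succ_lt_succ_iff.mp hij)
    simp only [hiff]
    by_cases hτ : ∀ i j : Fin n, r ≤ (i : ℕ) → i < j → τ.symm i < τ.symm j
    · simp only [if_pos hτ]
      rw [map_smul, insertion_tProd (hz 0) _ (fun i => p (τ i).succ) fun i => hz (τ i).succ,
        Finset.smul_sum]
      refine Finset.sum_congr rfl fun s _ => ?_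
      rw [smul_smul, koszul_insertPerm]
      congr 2
      funext i
      refine Fin.succAboveCases s ?_ (fun j => ?_) i
      · simp [insertPerm_self]
      · simp [insertPerm_succAbove]
    · simp only [if_neg hτ, Finset.sum_const_zero]

theorem shuffleAct_sProd_tProd [CharZero k] {r n : ℕ} (w : Fin r → E × O) (x : Fin n → E × O)
    (a : Fin r → ZMod 2) (b : Fin n → ZMod 2) (hw : ∀ i, IsHomog (par k E O) (a i) (w i))
    (hx : ∀ i, IsHomog (par k E O) (b i) (x i)) :
    shuffleAct k E O (sProd (k := k) w) (tProd (k := k) x)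
      = ∑ τ : Equiv.Perm (Fin (r + n)) with
          ∀ i j : Fin n, i < j → τ.symm (Fin.natAdd r i) < τ.symm (Fin.natAdd r j),
        koszul k (Fin.append a b) τ • tProd (k := k) fun i => Fin.append w x (τ i) := by
  have h := shuffleAct_take_drop (k := k) r (Nat.le_add_right r n) (Fin.append w x) (Fin.append a b)
    (fun i => by refine Fin.addCases (fun i => ?_) (fun i => ?_) i <;> simp [hw, hx])
  have h1 : (List.ofFn (Fin.append w x)).take r = List.ofFn w := by
    rw [List.ofFn_fin_append, List.take_left' (by simp)]
  have h2 : (List.ofFn (Fin.append w x)).drop r = List.ofFn x := by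
    rw [List.ofFn_fin_append, List.drop_left' (by simp)]
  rw [h1, h2, List.map_ofFn, List.map_ofFn] at h
  have h3 : ∀ τ : Equiv.Perm (Fin (r + n)),
      (∀ i j : Fin (r + n), r ≤ (i : ℕ) → i < j → τ.symm i < τ.symm j)
        ↔ ∀ i j : Fin n, i < j → τ.symm (Fin.natAdd r i) < τ.symm (Fin.natAdd r j) := by
    intro τ
    constructor
    · intro h i j hij
      exact h _ _ (by simp) (by simpa using hij)
    · intro h i j hi hij
      obtain ⟨i, rfl⟩ : ∃ i', i = Fin.natAdd r i' := ⟨⟨i - r, by omega⟩, by ext; simp; omega⟩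
      obtain ⟨j, rfl⟩ : ∃ j', j = Fin.natAdd r j' :=
        ⟨⟨j - r, by omega⟩, by ext; simp at hij ⊢; omega⟩
      exact h i j (by simpa using hij)
  simp only [h3] at h
  exact h

/-- Words in homogeneous letters span; the formula of the `A_∞`-cases, with its Koszul signs, speaks
of these only. -/
theorem T_word_induction {P : T k E O → Prop} (add : ∀ x y, P x → P y → P (x + y))
    (smul : ∀ (r : k) x, P x → P (r • x))
    (word : ∀ (n : ℕ) (x : Fin n → E × O) (b : Fin n → ZMod 2),
      (∀ i, IsHomog (par k E O) (b i) (x i)) → P (tProd (k := k) x)) (c : T k E O) : P c := by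
  let W : Set (T k E O) := {y | ∃ (n : ℕ) (x : Fin n → E × O) (b : Fin n → ZMod 2),
    (∀ i, IsHomog (par k E O) (b i) (x i)) ∧ y = tProd (k := k) x}
  have hmul : ∀ (d : ZMod 2) (u : E × O), IsHomog (par k E O) d u → ∀ c ∈ Submodule.span k W,
      tι k E O u * c ∈ Submodule.span k W := by
    intro d u hu c hc
    induction hc using Submodule.span_induction with
    | mem y hy =>
      obtain ⟨n, x, b, h, rfl⟩ := hy
      refine Submodule.subset_span ⟨n + 1, Fin.cons (α := fun _ => E × O) u x,
        Fin.cons (α := fun _ => ZMod 2) d b, fun i => ?_, by simp [tProd_succ (Fin.cons u x)]⟩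
      refine Fin.cases ?_ (fun i => ?_) i
      · simpa using hu
      · simpa using h i
    | zero => rw [mul_zero]; exact Submodule.zero_mem _
    | add x y _ _ hx hy => rw [mul_add]; exact Submodule.add_mem _ hx hy
    | smul r x _ hx => rw [mul_smul_comm]; exact Submodule.smul_mem _ r hx
  have hc : c ∈ Submodule.span k W := by
    induction c using T_induction_homog with
    | one => exact Submodule.subset_span ⟨0, Fin.elim0, Fin.elim0, fun i => i.elim0, by simp [tProd]⟩
    | add x y hx hy => exact Submodule.add_mem _ hx hy
    | smul r x hx => exact Submodule.smul_mem _ r hx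
    | even a x hx => exact hmul 0 _ (by simp [IsHomog, par_mk, sgn_zero]) x hx
    | odd b x hx => exact hmul 1 _ (by simp [IsHomog, par_mk, sgn_one]) x hx
  induction hc using Submodule.span_induction with
  | mem y hy =>
    obtain ⟨n, x, b, h, rfl⟩ := hy
    exact word n x b h
  | zero => simpa using smul 0 _ (word 0 Fin.elim0 Fin.elim0 fun i => i.elim0)
  | add x y _ _ hx hy => exact add _ _ hx hy
  | smul r x _ hx => exact smul r x hx

theorem sMk_tProd {n : ℕ} (x : Fin n → E × O) :
    sMk k E O (tProd (k := k) x) = sProd (k := k) x := by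
  rw [tProd, sProd, map_list_prod, List.map_ofFn]
  rfl

theorem S_word_induction {P : S k E O → Prop} (add : ∀ x y, P x → P y → P (x + y))
    (smul : ∀ (r : k) x, P x → P (r • x))
    (word : ∀ (n : ℕ) (x : Fin n → E × O) (b : Fin n → ZMod 2),
      (∀ i, IsHomog (par k E O) (b i) (x i)) → P (sProd (k := k) x)) (c : S k E O) : P c := by
  obtain ⟨c, rfl⟩ := sMk_surjective c
  refine T_word_induction (P := fun c => P (sMk k E O c)) (fun x y hx hy => ?_)
    (fun r x hx => ?_) (fun n x b h => ?_) c
  · rw [map_add]; exact add _ _ hx hy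
  · rw [map_smul]; exact smul _ _ hx
  · rw [sMk_tProd]; exact word n x b h

theorem sCounit_sProd {n : ℕ} (hn : 1 ≤ n) (x : Fin n → E × O) :
    sCounit k E O (sProd (k := k) x) = 0 := by
  obtain ⟨n, rfl⟩ : ∃ m, n = m + 1 := ⟨n - 1, by omega⟩
  rw [sProd, List.ofFn_succ, List.prod_cons, sCounit_ι_mul]

theorem tCounit_tProd {n : ℕ} (hn : 1 ≤ n) (x : Fin n → E × O) :
    tCounit k E O (tProd (k := k) x) = 0 := by
  obtain ⟨n, rfl⟩ : ∃ m, n = m + 1 := ⟨n - 1, by omega⟩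
  rw [tProd_succ, tCounit_ι_mul]

end Words

/-! ### The explicit formulas for the component -/

section Formulas

open IsShuffleSystem

section

variable {k C U : Type*} [Field k] [Ring C] [Algebra k C] [AddCommGroup U] [Module k U]
  [FiniteDimensional k U]

theorem taylor_add (p : C →ₗ[k] U) (σ : U →ₗ[k] U) (i : ZMod 2)
    (δ δ' : Module.End k (Module.Dual k C)) :
    taylor p σ i (δ + δ') = taylor p σ i δ + taylor p σ i δ' :=
  dualRestrict_add _ δ δ'

theorem taylor_smul (p : C →ₗ[k] U) (σ : U →ₗ[k] U) (i : ZMod 2) (r : k)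
    (δ : Module.End k (Module.Dual k C)) : taylor p σ i (r • δ) = r • taylor p σ i δ :=
  dualRestrict_smul _ r δ

end

variable {k V₀ V₁ : Type*} [Field k] [CharZero k] [AddCommGroup V₀] [Module k V₀]
  [FiniteDimensional k V₀] [AddCommGroup V₁] [Module k V₁] [FiniteDimensional k V₁]

/-- Both sides are linear in `a` and `c`, so they may be compared on words. The words `x` with at
least one letter are covered by the formula, and there `component` needs no correction. -/
theorem lieFormula_iff (m : Module.End k (Module.Dual k (S k V₁ V₀)))
    {K : ZMod 2 → Submodule k (Module.End k (Module.Dual k (S k V₁ V₀)))}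
    (hK : ∀ i, K i ≤ lieFields k V₀ V₁ i) (ψ : S k V₁ V₀ →ₗ[k] (K 1 × K 0)) :
    LieFormula m ψ ↔ ∀ a c,
      taylor (sProj k V₁ V₀) (par k V₁ V₀) 1
          ((ψ a).1 : Module.End k (Module.Dual k (S k V₁ V₀))) c
        + taylor (sProj k V₁ V₀) (par k V₁ V₀) 0
          ((ψ a).2 : Module.End k (Module.Dual k (S k V₁ V₀))) c
        = component (sCounit k V₁ V₀) (Algebra.lmul k (S k V₁ V₀))
          (taylor (sProj k V₁ V₀) (par k V₁ V₀) 1 m) a c := by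
  constructor
  · intro h a c
    induction c using S_word_induction with
    | add x y hx hy => simp only [map_add, ← hx, ← hy]; abel
    | smul r x hx => simp only [map_smul, ← hx, smul_add]
    | word n x _ _ =>
      rcases Nat.eq_zero_or_pos n with rfl | hn
      -- The formula says nothing for the empty word. There both sides vanish: the fields in `K`
      -- vanish at zero, and `component` was corrected to vanish at `1`.
      · have h1 : sProd (k := k) x = 1 := by simp [sProd]
        rw [h1, component_one, (S_isShuffleSystem.exists_coder (hK 1 (ψ a).1.2)).2.1,
          (S_isShuffleSystem.exists_coder (hK 0 (ψ a).2.2)).2.1, add_zero]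
      · induction a using S_word_induction with
        | add a b ha hb =>
          simp only [map_add, LinearMap.add_apply, ← ha, ← hb, Prod.fst_add, Prod.snd_add,
            Submodule.coe_add, taylor_add]
          abel
        | smul r a ha =>
          simp only [map_smul, LinearMap.smul_apply, ← ha, Prod.smul_fst, Prod.smul_snd,
            Submodule.coe_smul, taylor_smul, smul_add]
        | word r w _ _ =>
          rw [component_apply, sCounit_sProd hn, zero_smul, sub_zero]
          exact h r n w x hn
  · intro h r n w x hn
    refine (h (sProd w) (sProd x)).trans ?_
    rw [component_apply, sCounit_sProd hn, zero_smul, sub_zero]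
    rfl

theorem assocFormula_iff (m : Module.End k (Module.Dual k (T k V₁ V₀)))
    {K : ZMod 2 → Submodule k (Module.End k (Module.Dual k (T k V₁ V₀)))}
    (hK : ∀ i, K i ≤ assocFields k V₀ V₁ i) (ψ : S k V₁ V₀ →ₗ[k] (K 1 × K 0)) :
    AssocFormula m ψ ↔ ∀ a c,
      taylor (tProj k V₁ V₀) (par k V₁ V₀) 1
          ((ψ a).1 : Module.End k (Module.Dual k (T k V₁ V₀))) c
        + taylor (tProj k V₁ V₀) (par k V₁ V₀) 0
          ((ψ a).2 : Module.End k (Module.Dual k (T k V₁ V₀))) c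
        = component (tCounit k V₁ V₀) (shuffleAct k V₁ V₀)
          (taylor (tProj k V₁ V₀) (par k V₁ V₀) 1 m) a c := by
  have hword : ∀ (r n : ℕ) (w : Fin r → V₁ × V₀) (x : Fin n → V₁ × V₀) (a : Fin r → ZMod 2)
      (b : Fin n → ZMod 2), 1 ≤ n → (∀ i, IsHomog (par k V₁ V₀) (a i) (w i)) →
      (∀ i, IsHomog (par k V₁ V₀) (b i) (x i)) →
      component (tCounit k V₁ V₀) (shuffleAct k V₁ V₀)
          (taylor (tProj k V₁ V₀) (par k V₁ V₀) 1 m) (sProd w) (tProd x)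
        = ∑ τ : Equiv.Perm (Fin (r + n)) with
          ∀ i j : Fin n, i < j → τ.symm (Fin.natAdd r i) < τ.symm (Fin.natAdd r j),
        koszul k (Fin.append a b) τ
          • assocComponents 1 m (tProd fun i => Fin.append w x (τ i)) := by
    intro r n w x a b hn hw hx
    rw [component_apply, tCounit_tProd hn, zero_smul, sub_zero,
      shuffleAct_sProd_tProd w x a b hw hx, map_sum]
    simp only [map_smul]
    rfl
  constructor
  · intro h a c
    induction c using T_word_induction with
    | add x y hx hy => simp only [map_add, ← hx, ← hy]; abel
    | smul r x hx => simp only [map_smul, ← hx, smul_add]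
    | word n x b hx =>
      rcases Nat.eq_zero_or_pos n with rfl | hn
      · have h1 : tProd (k := k) x = 1 := by simp [tProd]
        rw [h1, component_one, (T_isShuffleSystem.exists_coder (hK 1 (ψ a).1.2)).2.1,
          (T_isShuffleSystem.exists_coder (hK 0 (ψ a).2.2)).2.1, add_zero]
      · induction a using S_word_induction with
        | add a b ha hb =>
          simp only [map_add, LinearMap.add_apply, ← ha, ← hb, Prod.fst_add, Prod.snd_add,
            Submodule.coe_add, taylor_add]
          abel
        | smul r a ha =>
          simp only [map_smul, LinearMap.smul_apply, ← ha, Prod.smul_fst, Prod.smul_snd,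
            Submodule.coe_smul, taylor_smul, smul_add]
        | word r w a hw =>
          rw [hword r n w x a b hn hw hx]
          exact h r n w x a b hn hw hx
  · intro h r n w x a b hn hw hx
    exact (h (sProd w) (tProd x)).trans (hword r n w x a b hn hw hx)

theorem lie_hasCEMap {m : Module.End k (Module.Dual k (S k V₁ V₀))}
    {K : ZMod 2 → Submodule k (Module.End k (Module.Dual k (S k V₁ V₀)))}
    (hK : ∀ i, K i ≤ lieFields k V₀ V₁ i)
    (hL : IsLieSubalgebra (A := Module.End k (Module.Dual k (S k V₁ V₀))) (K 0) (K 1))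
    (hm : m ∈ K 1) (hmm : m * m = 0)
    (hmem : ∀ j a, sPar k V₁ V₀ a = sgn k j • a →
      dualField (sPar k V₁ V₀).toLinearMap (1 + j) (actCoder (sCounit k V₁ V₀)
        (Algebra.lmul k (S k V₁ V₀))
        { toFun := sCoder, map_add' := sCoder_add, map_smul' := sCoder_smul }
        (taylor (sProj k V₁ V₀) (par k V₁ V₀) 1 m) a) ∈ K (1 + j)) :
    HasCEMap (A := Module.End k (Module.Dual k (S k V₁ V₀))) (lieCE m) (K 0) (K 1)
      (LieFormula m) := by
  have e : lieCE m = sCoder (orbit (Algebra.lmul k (S k V₁ V₀))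
      (taylor (sProj k V₁ V₀) (par k V₁ V₀) 1 m)) := by
    rw [lieCE]
    congr 1
    ext1 a
    simp [orbit_apply, lieComponents]
  rw [e]
  exact S_isShuffleSystem.hasCEMap (hK 1 hm) hmm rfl hK hL hmem (lieFormula_iff m hK)

theorem assoc_hasCEMap {m : Module.End k (Module.Dual k (T k V₁ V₀))}
    {K : ZMod 2 → Submodule k (Module.End k (Module.Dual k (T k V₁ V₀)))}
    (hK : ∀ i, K i ≤ assocFields k V₀ V₁ i)
    (hL : IsLieSubalgebra (A := Module.End k (Module.Dual k (T k V₁ V₀))) (K 0) (K 1))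
    (hm : m ∈ K 1) (hmm : m * m = 0)
    (hmem : ∀ j a, sPar k V₁ V₀ a = sgn k j • a →
      dualField (tPar k V₁ V₀).toLinearMap (1 + j) (actCoder (tCounit k V₁ V₀)
        (shuffleAct k V₁ V₀) (tCoder k V₁ V₀)
        (taylor (tProj k V₁ V₀) (par k V₁ V₀) 1 m) a) ∈ K (1 + j)) :
    HasCEMap (A := Module.End k (Module.Dual k (T k V₁ V₀))) (assocCE m) (K 0) (K 1)
      (AssocFormula m) :=
  T_isShuffleSystem.hasCEMap (hK 1 hm) hmm rfl hK hL hmem (assocFormula_iff m hK)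

end Formulas

end SuperCE

end

/-! ### The four cases -/

theorem mainTheorem5 {k V₀ V₁ : Type*} [Field k] [CharZero k]
    [AddCommGroup V₀] [Module k V₀] [FiniteDimensional k V₀]
    [AddCommGroup V₁] [Module k V₁] [FiniteDimensional k V₁] :
    (∀ m ∈ SuperCE.lieFields k V₀ V₁ 1, m * m = 0 →
      SuperCE.HasCEMap (A := Module.End k (Module.Dual k (SuperCE.S k V₁ V₀)))
        (SuperCE.lieCE m) (SuperCE.lieFields k V₀ V₁ 0) (SuperCE.lieFields k V₀ V₁ 1)
        (SuperCE.LieFormula m)) ∧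
    (∀ m ∈ SuperCE.assocFields k V₀ V₁ 1, m * m = 0 →
      SuperCE.HasCEMap (A := Module.End k (Module.Dual k (SuperCE.T k V₁ V₀)))
        (SuperCE.assocCE m) (SuperCE.assocFields k V₀ V₁ 0) (SuperCE.assocFields k V₀ V₁ 1)
        (SuperCE.AssocFormula m)) ∧
    (∀ (π : ZMod 2) (B : (V₀ × V₁) →ₗ[k] (V₀ × V₁) →ₗ[k] k), SuperCE.IsInnerProduct π B →
      (∀ m ∈ SuperCE.cyclicLieFields B 1, m * m = 0 →
        SuperCE.HasCEMap (A := Module.End k (Module.Dual k (SuperCE.S k V₁ V₀)))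
          (SuperCE.lieCE m) (SuperCE.cyclicLieFields B 0) (SuperCE.cyclicLieFields B 1)
          (SuperCE.LieFormula m)) ∧
      (∀ m ∈ SuperCE.cyclicAssocFields B 1, m * m = 0 →
        SuperCE.HasCEMap (A := Module.End k (Module.Dual k (SuperCE.T k V₁ V₀)))
          (SuperCE.assocCE m) (SuperCE.cyclicAssocFields B 0) (SuperCE.cyclicAssocFields B 1)
          (SuperCE.AssocFormula m))) := by
  refine ⟨fun m hm hmm => ?_, fun m hm hmm => ?_, fun π B hB => ⟨fun m hm hmm => ?_,
    fun m hm hmm => ?_⟩⟩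
  · have h := SuperCE.S_isShuffleSystem (k := k) (E := V₁) (O := V₀)
    exact SuperCE.lie_hasCEMap (K := SuperCE.lieFields k V₀ V₁) (fun _ => le_rfl)
      (SuperCE.vectorFields_isLieSubalgebra h.par_par h.comul_par) hm hmm fun j a ha =>
        SuperCE.dualField_isVectorField h.par_par h.comul_par
          (h.isCoder_actCoder (h.exists_coder hm).1 ha) (h.actCoder_one a)
  · have h := SuperCE.T_isShuffleSystem (k := k) (E := V₁) (O := V₀)
    exact SuperCE.assoc_hasCEMap (K := SuperCE.assocFields k V₀ V₁) (fun _ => le_rfl)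
      (SuperCE.vectorFields_isLieSubalgebra h.par_par h.comul_par) hm hmm fun j a ha =>
        SuperCE.dualField_isVectorField h.par_par h.comul_par
          (h.isCoder_actCoder (h.exists_coder hm).1 ha) (h.actCoder_one a)
  · have h := SuperCE.S_isShuffleSystem (k := k) (E := V₁) (O := V₀)
    exact SuperCE.lie_hasCEMap (K := SuperCE.cyclicLieFields B) (fun _ _ hx => hx.1)
      (SuperCE.symplecticFields_isLieSubalgebra h SuperCE.S_hasProductRule hB.isGradedAntisymm)
      hm hmm fun j a ha => SuperCE.dualField_actCoder_mem_symplecticFields h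
        SuperCE.sCounit_ι_mul SuperCE.S_isCyclic_comp hm.2 (h.exists_coder hm.1).1 j a ha
  · have h := SuperCE.T_isShuffleSystem (k := k) (E := V₁) (O := V₀)
    exact SuperCE.assoc_hasCEMap (K := SuperCE.cyclicAssocFields B) (fun _ _ hx => hx.1)
      (SuperCE.symplecticFields_isLieSubalgebra h SuperCE.T_hasProductRule hB.isGradedAntisymm)
      hm hmm fun j a ha => SuperCE.dualField_actCoder_mem_symplecticFields h
        SuperCE.tCounit_ι_mul SuperCE.T_isCyclic_comp hm.2 (h.exists_coder hm.1).1 j a ha
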